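/- Let $\Omega=\mathbb{R}^2$. Let $b\in C^\infty(\mathbb{R}^2)$ satisfy $0<b_i\le b(x)\le b_s$ for all $x$, let the viscosity $\nu:\mathbb{R}^2\to\mathbb{R}$ be measurable with $0<\nu_i\le\nu(x)\le\nu_s$ for all $x$, and let $\eta\in C^\infty(\mathbb{R}^2)$ be bounded and strictly positive. Consider the viscous shallow water system $$\partial_t u+u\cdot\nabla u+\nabla p+\eta u=b^{-1}\nabla\cdot\big[\nu b\,S(u)\big]+f,\qquad \nabla\cdot(bu)=0,\qquad u(x,0)=u_0(x),$$ where $S(u)=\nabla u+(\nabla u)^T-\mathbf{I}\,\nabla\cdot u$. Let $L^2_b$ be the space of square-integrable vector fields on $\mathbb{R}^2$ with inner product $(u,v)_b=\int_{\mathbb{R}^2}b\,u\cdot v\,dx$, let $H=\{u\in L^2_b:\nabla\cdot(bu)=0\}$ (in the sense of distributions), and let $V=\{u\in H:\nabla u\in L^2_b\}$ (weak derivatives). A weak solution is a function $u$ which, for each $T>0$, belongs to $L^\infty([0,T],H)\cap L^2([0,T],V)$, is defined for every $t\ge 0$ with $u(t)\in H$ and $t\mapsto(u(t),w)_b$ continuous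 on $[0,\infty)$ for every $w\in H$, and which satisfies, for all $t\ge 0$ and every smooth vector field $\phi\in C([0,\infty),V)\cap C^1([0,\infty),H)$, $$(u(t),\phi(t))_b+\int_0^t\Big\{-(u,\partial_t\phi)_b+\int_{\mathbb{R}^2}b\,\nu\,S(u):S(\phi)\,dx+(\eta u,\phi)_b+(u\cdot\nabla u,\phi)_b\Big\}\,d\tau=\int_0^t(\phi,f)_b\,d\tau+(u_0,\phi(0))_b.$$ Let $u_0\in L^2(\mathbb{R}^2)$ and $f\in L^1([0,\infty),L^2_b(\mathbb{R}^2))$. Then every weak solution $u$ satisfies $$\lim_{t\to+\infty}\|u(t)\|_{L^2(\mathbb{R}^2)}=0.$$ -/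

import Mathlib

open MeasureTheory Set Filter Topology
open scoped ContDiff ENNReal

/-- The plane `ℝ²` with its Euclidean norm. -/
abbrev Plane : Type := EuclideanSpace ℝ (Fin 2)

/-- The measure `b(x) dx` on the plane, for a bottom topography `b`. -/
noncomputable def depthMeasure (b : Plane → ℝ) : Measure Plane :=
  (volume : Measure Plane).withDensity (fun x => ENNReal.ofReal (b x))

/-- The Hilbert space `L²_b(ℝ²)` of vector fields. Its inner product is `(u, v)_b = ∫ b u ⬝ v dx`,
its norm is `‖u‖_{b,2}`. -/
abbrev L2b (b : Plane → ℝ) : Type := Lp Plane 2 (depthMeasure b)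

/-- `u ∈ H`, that is, `∇ ⬝ (b u) = 0` in the sense of distributions:
`∫ b u ⬝ ∇ψ dx = 0` for every test function `ψ`. -/
def IsSolenoidal (b : Plane → ℝ) (u : L2b b) : Prop :=
  ∀ ψ : Plane → ℝ, ContDiff ℝ ∞ ψ → HasCompactSupport ψ →
    ∫ x, fderiv ℝ ψ x (u x) ∂(depthMeasure b) = 0

/-- `D i` is the weak partial derivative `∂ᵢ u`, for `i = 0, 1` (integrals against Lebesgue
measure), so that `u` is in `H¹_b` with `∇u = D`. -/
def IsWeakGradient {b : Plane → ℝ} (u : L2b b) (D : Fin 2 → L2b b) : Prop :=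
  ∀ i : Fin 2, ∀ ψ : Plane → ℝ, ContDiff ℝ ∞ ψ → HasCompactSupport ψ →
    ∫ x, (fderiv ℝ ψ x (EuclideanSpace.single i 1)) • u x = - ∫ x, ψ x • D i x

/-- The entry `(i, j)` of `∇u + (∇u)ᵀ - I ∇ ⬝ u` at a point where `∂ᵢ u = A i`. -/
def strain (A : Fin 2 → Plane) (i j : Fin 2) : ℝ :=
  A i j + A j i - (if i = j then ∑ k, A k k else 0)

/-- The viscous form `∫ b ν (∇u + (∇u)ᵀ - I ∇ ⬝ u) : (∇v + (∇v)ᵀ - I ∇ ⬝ v) dx`, where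
`Du = ∇u` and `Dv = ∇v`. -/
noncomputable def viscousForm {b : Plane → ℝ} (ν : Plane → ℝ) (Du Dv : Fin 2 → L2b b) : ℝ :=
  ∫ x, ν x * ∑ i, ∑ j, strain (fun k => Du k x) i j * strain (fun k => Dv k x) i j
    ∂(depthMeasure b)

/-- The friction form `(η u, v)_b`. -/
noncomputable def frictionForm {b : Plane → ℝ} (η : Plane → ℝ) (u v : L2b b) : ℝ :=
  ∫ x, η x * inner ℝ (u x) (v x) ∂(depthMeasure b)

/-- The convective form `(u ⬝ ∇w, v)_b`, where `Dw = ∇w`. -/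
noncomputable def convectiveForm {b : Plane → ℝ} (u : L2b b) (Dw : Fin 2 → L2b b)
    (v : L2b b) : ℝ :=
  ∫ x, ∑ j, u x j * inner ℝ (Dw j x) (v x) ∂(depthMeasure b)

/-- `φ` is a smooth vector field in `C([0, ∞), V) ∩ C¹([0, ∞), H)` with spatial gradient
`Dφ` and time derivative `φ'`. -/
structure IsTestField (b : Plane → ℝ) (φ : ℝ → L2b b) (Dφ : Fin 2 → ℝ → L2b b)
    (φ' : ℝ → L2b b) : Prop where
  smooth : ∃ F : ℝ → Plane → Plane,
    ContDiffOn ℝ ∞ (fun p : ℝ × Plane => F p.1 p.2) (Ici 0 ×ˢ univ) ∧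
      ∀ t, 0 ≤ t → φ t =ᵐ[depthMeasure b] F t
  solenoidal : ∀ t, 0 ≤ t → IsSolenoidal b (φ t)
  gradient : ∀ t, 0 ≤ t → IsWeakGradient (φ t) (fun i => Dφ i t)
  continuousOn : ContinuousOn φ (Ici 0)
  continuousOn_gradient : ∀ i, ContinuousOn (Dφ i) (Ici 0)
  hasDeriv : ∀ t, 0 ≤ t → HasDerivWithinAt φ (φ' t) (Ici 0) t
  continuousOn_deriv : ContinuousOn φ' (Ici 0)

/-- `u ∈ C_w([0, T], H)` for each `T > 0`: `u` has values in `H`, is in `L^∞([0, T], H)`, and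
is weakly continuous on `[0, ∞)`. -/
structure IsWeaklyContinuous (b : Plane → ℝ) (u : ℝ → L2b b) : Prop where
  solenoidal : ∀ t, 0 ≤ t → IsSolenoidal b (u t)
  bounded : ∀ T : ℝ, 0 < T → ∃ M : ℝ, ∀ᵐ t ∂(volume.restrict (Icc 0 T)), ‖u t‖ ≤ M
  continuousOn : ∀ w : L2b b, IsSolenoidal b w → ContinuousOn (fun t => inner ℝ (u t) w) (Ici 0)

/-- `u ∈ L²([0, T], H¹_b)` for each `T > 0`, with spatial gradient `Du`. -/
structure IsLocallySquareIntegrable (b : Plane → ℝ) (u : ℝ → L2b b)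
    (Du : Fin 2 → ℝ → L2b b) : Prop where
  gradient : ∀ᵐ t ∂(volume.restrict (Ici (0 : ℝ))), IsWeakGradient (u t) (fun i => Du i t)
  memLp : ∀ T : ℝ, 0 < T → MemLp u 2 (volume.restrict (Icc 0 T))
  memLp_gradient : ∀ T : ℝ, 0 < T → ∀ i, MemLp (Du i) 2 (volume.restrict (Icc 0 T))

/-- `u` is a weak solution of the viscous shallow water system on `ℝ²` with bottom topography
`b`, viscosity `ν`, friction `η`, force `f` and initial datum `u₀`. -/
def IsWeakSolution (b ν η : Plane → ℝ) (f : ℝ → L2b b) (u₀ : Plane → Plane)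
    (u : ℝ → L2b b) : Prop :=
  IsWeaklyContinuous b u ∧
  ∃ Du : Fin 2 → ℝ → L2b b, IsLocallySquareIntegrable b u Du ∧
    ∀ (φ : ℝ → L2b b) (Dφ : Fin 2 → ℝ → L2b b) (φ' : ℝ → L2b b), IsTestField b φ Dφ φ' →
      ∀ t : ℝ, 0 ≤ t →
        inner ℝ (u t) (φ t) +
          ∫ τ in (0 : ℝ)..t,
            (- inner ℝ (u τ) (φ' τ)
              + viscousForm ν (fun i => Du i τ) (fun i => Dφ i τ)
              + frictionForm η (u τ) (φ τ)
              + convectiveForm (u τ) (fun i => Du i τ) (φ τ)) =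
        (∫ τ in (0 : ℝ)..t, inner ℝ (φ τ) (f τ)) +
          ∫ x, inner ℝ (u₀ x) (φ 0 x) ∂(depthMeasure b)

/-!
The weighted problem is cast as an evolution equation `u' + A u + c(u) = f` in the Hilbert space
`L²_b`. Here `A ≥ 0` is the operator of the dissipation form `∫ b ν S(u) : S(v) dx + (η u, v)_b`
on the space `V` of solenoidal fields in `H¹_b`, and `c` is the convective term. Three facts about
the plane make the forms fit together.

* Korn's inequality `sum_norm_sq_le_strainEntry`: pointwise `|S(u)|² = 2 |∇u|² - 4 det ∇u`, and
  the Jacobian determinant has zero mean, so that the dissipation controls `∇u`.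
* Ladyzhenskaya's inequality `exists_eLpNorm_four_sq_le`, that is `‖u‖₄² ≤ C ‖u‖₂ ‖∇u‖₂`. Together
  with the skew symmetry `convection_eq_neg` it bounds `c(u)`, tested with `w`, by the norm of `u`
  times the square roots of the dissipations of `u` and `w` (`exists_abs_solConvection_le`).
* Smooth fields are dense in `V` (`dense_isSmoothJet`), so that the weak formulation extends from
  smooth test fields to all of `V`. As `∇b` may be unbounded, a field `u` in `V` cannot just be
  cut off or mollified. Instead, the mollified flux `b u` has a stream function, which is
  localised by cutoff functions, with the Poincaré inequality as the bound; the smoothing is then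
  chosen separately on each annulus.

Decay is a fact about such abstract equations (`IsDissipativeSolution.tendsto_norm_zero`). The
energy inequality (`energy_inequality`), which holds between almost all pairs of times since `u`
is square integrable in time with values in `V`, shows that the dissipation is integrable in time
and that, up to the remaining force, `‖u‖` does not grow. It remains to find times at which `‖u‖`
is small. The dissipation need not control `‖u‖`, as `η` may tend to zero at infinity; but it only
vanishes at `u = 0`, as `η > 0`. Therefore the powers of the resolvent `R = (1 + A)⁻¹` tend
strongly to zero (`tendsto_pow_apply_zero`). Testing the equation with the iterates `R ^ j v`, a
backward Euler scheme for the dual linear equation, compares `(u(t + j), v)` with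
`(u(t), R ^ j v)`, and the errors are controlled by the dissipation after the time `t`
(`inner_le_inner_resolvent_add`). With `v = u(t + j)`, choosing first `t` and then `j` large, this
makes `‖u(t + j)‖` small.
-/

/-! ### Continuity of translations in `L^p` -/

theorem tendsto_eLpNorm_translate_sub {G E : Type*} [NormedAddCommGroup G] [NormedSpace ℝ G]
    [FiniteDimensional ℝ G] [MeasurableSpace G] [BorelSpace G] [NormedAddCommGroup E]
    {μ : Measure G} [μ.IsAddHaarMeasure] {p : ℝ≥0∞} [Fact (1 ≤ p)] (hp : p ≠ ⊤)
    {f : G → E} (hf : MemLp f p μ) :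
    Tendsto (fun y => eLpNorm (fun x => f (x + y) - f x) p μ) (𝓝 0) (𝓝 0) := by
  have hpres : ∀ y : G, MeasurePreserving (fun x => x + y) μ μ :=
    fun y => measurePreserving_add_right μ y
  let g : G → C(G, G) := fun y => ⟨fun x => x + y, by fun_prop⟩
  have hg : Continuous g :=
    ContinuousMap.continuous_of_continuous_uncurry _ (continuous_snd.add continuous_fst)
  have h1 : Tendsto (fun y => Lp.compMeasurePreserving (g y) (hpres y) (hf.toLp f)) (𝓝 0)
      (𝓝 (Lp.compMeasurePreserving (g 0) (hpres 0) (hf.toLp f))) :=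
    (tendsto_const_nhds (x := hf.toLp f)).compMeasurePreservingLp (hg.tendsto 0) hpres (hpres 0) hp
  rw [Lp.tendsto_Lp_iff_tendsto_eLpNorm'] at h1
  refine h1.congr fun y => eLpNorm_congr_ae ?_
  rw [Lp.toLp_compMeasurePreserving, Lp.toLp_compMeasurePreserving]
  filter_upwards [(hf.comp_measurePreserving (hpres y)).coeFn_toLp,
    (hf.comp_measurePreserving (hpres 0)).coeFn_toLp] with x hx hx0
  simp only [Pi.sub_apply]
  erw [hx, hx0]
  simp

/-! ### The resolvent of a form -/

section Resolvent

open InnerProductSpace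

variable {H : Type*} [NormedAddCommGroup H] [InnerProductSpace ℝ H] [CompleteSpace H]

/-- Powers of a symmetric operator `R` with `‖R x‖² ≤ (x, R x)` and without nonzero fixed
points converge strongly to zero. -/
theorem tendsto_pow_apply_zero (R : H →L[ℝ] H) (hsymm : ∀ x y, inner ℝ (R x) y = inner ℝ x (R y))
    (hR : ∀ x, ‖R x‖ ^ 2 ≤ inner ℝ x (R x)) (hfix : ∀ x, R x = x → x = 0) (x : H) :
    Tendsto (fun n : ℕ => (R ^ n) x) atTop (𝓝 0) := by
  have hcontr : ∀ x, ‖R x‖ ≤ ‖x‖ := by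
    intro x
    by_contra! h
    have h1 := hR x
    have h2 := real_inner_le_norm x (R x)
    nlinarith [norm_nonneg x, norm_nonneg (R x)]
  have hpow : ∀ (n : ℕ) x, ‖(R ^ n) x‖ ≤ ‖x‖ := by
    intro n
    induction n with
    | zero => simp
    | succ n ih =>
      intro x
      rw [pow_succ]
      exact (ih (R x)).trans (hcontr x)
  have hsucc : ∀ (n : ℕ) x, (R ^ (n + 1)) x = R ((R ^ n) x) := by
    intro n x; rw [pow_succ']; rfl
  -- the increments `R ^ n (x - R x)` tend to zero, since `‖R ^ n x‖` is monotone
  have hinc : ∀ x, Tendsto (fun n : ℕ => (R ^ n) (x - R x)) atTop (𝓝 0) := by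
    intro x
    have hanti : Antitone fun n : ℕ => ‖(R ^ n) x‖ ^ 2 := by
      refine antitone_nat_of_succ_le fun n => ?_
      rw [hsucc]
      have := hcontr ((R ^ n) x)
      gcongr
    have hlim := tendsto_atTop_ciInf hanti ⟨0, by rintro _ ⟨n, rfl⟩; positivity⟩
    have hd : Tendsto (fun n : ℕ => ‖(R ^ n) x‖ ^ 2 - ‖(R ^ (n + 1)) x‖ ^ 2) atTop (𝓝 0) := by
      simpa using hlim.sub (hlim.comp (tendsto_add_atTop_nat 1))
    have hsq : Tendsto (fun n : ℕ => ‖(R ^ n) (x - R x)‖ ^ 2) atTop (𝓝 0) := by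
      refine squeeze_zero (fun n => by positivity) (fun n => ?_) hd
      have e : (R ^ n) (x - R x) = (R ^ n) x - R ((R ^ n) x) := by
        rw [map_sub, ← hsucc, pow_succ]; rfl
      rw [e, hsucc, norm_sub_sq_real]
      have := hR ((R ^ n) x)
      linarith
    rw [tendsto_zero_iff_norm_tendsto_zero]
    have := hsq.sqrt
    simpa using this
  -- the range of `1 - R` is dense
  have hdense : (LinearMap.range ((1 - R : H →L[ℝ] H) : H →ₗ[ℝ] H)).topologicalClosure = ⊤ := by
    rw [Submodule.topologicalClosure_eq_top_iff, Submodule.eq_bot_iff]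
    intro y hy
    apply hfix
    rw [Submodule.mem_orthogonal] at hy
    have h0 : ∀ z, inner ℝ z (y - R y) = 0 := by
      intro z
      have := hy ((1 - R : H →L[ℝ] H) z) ⟨z, rfl⟩
      simp only [sub_apply, one_apply_eq_self, inner_sub_left,
        hsymm] at this
      rw [inner_sub_right]; exact this
    have := h0 (y - R y)
    rw [inner_self_eq_zero, sub_eq_zero] at this
    exact this.symm
  rw [Metric.tendsto_atTop]
  intro ε hε
  have hx : x ∈ closure (LinearMap.range ((1 - R : H →L[ℝ] H) : H →ₗ[ℝ] H) : Set H) := by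
    rw [← Submodule.topologicalClosure_coe, hdense]; trivial
  obtain ⟨y, ⟨z, rfl⟩, hz⟩ := Metric.mem_closure_iff.1 hx (ε / 2) (by positivity)
  obtain ⟨N, hN⟩ := Metric.tendsto_atTop.1 (hinc z) (ε / 2) (by positivity)
  refine ⟨N, fun n hn => ?_⟩
  have h1 := hN n hn
  have h2 := hpow n (x - (z - R z))
  rw [map_sub] at h2
  rw [dist_zero_right] at h1 ⊢
  have h3 : ‖x - (z - R z)‖ < ε / 2 := by rw [← dist_eq_norm]; exact hz
  calc ‖(R ^ n) x‖ = ‖((R ^ n) x - (R ^ n) (z - R z)) + (R ^ n) (z - R z)‖ := by simp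
    _ ≤ _ := norm_add_le _ _
    _ < ε := by linarith

variable {V : Type*} [NormedAddCommGroup V] [InnerProductSpace ℝ V] [CompleteSpace V]

/-- The resolvent `(1 + A)⁻¹` of the operator `A` attached to a form `d` on `V`, as a map
into the form domain. -/
theorem exists_resolvent (ι : V →L[ℝ] H) (d : V →L[ℝ] V →L[ℝ] ℝ) {K : ℝ} (hK0 : 0 < K)
    (hK : ∀ v, ‖v‖ ^ 2 ≤ K * (‖ι v‖ ^ 2 + d v v)) :
    ∃ S : H →L[ℝ] V, ∀ x w, inner ℝ (ι (S x)) (ι w) + d (S x) w = inner ℝ x (ι w) := by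
  let B : V →L[ℝ] V →L[ℝ] ℝ :=
    (isBoundedBilinearMap_inner (𝕜 := ℝ) (E := H)).toContinuousLinearMap.bilinearComp ι ι + d
  have hB : ∀ v w, B v w = inner ℝ (ι v) (ι w) + d v w := fun v w => rfl
  have hcoer : IsCoercive B := by
    refine ⟨1 / K, by positivity, fun v => ?_⟩
    rw [hB, real_inner_self_eq_norm_sq]
    have := hK v
    rw [div_mul_eq_mul_div, div_mul_eq_mul_div, div_le_iff₀ hK0]
    nlinarith
  let e := hcoer.continuousLinearEquivOfBilin
  refine ⟨(e.symm : V →L[ℝ] V).comp (ContinuousLinearMap.adjoint ι), fun x w => ?_⟩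
  rw [← hB, ← hcoer.continuousLinearEquivOfBilin_apply]
  change inner ℝ (e (e.symm (ContinuousLinearMap.adjoint ι x))) w = _
  rw [e.apply_symm_apply, ContinuousLinearMap.adjoint_inner_left]

end Resolvent

/-! ### Translates of functions of one real variable -/

/-- If the increments `φ (τ + h) - φ τ` have integral over `[a, b]` at most `o(h)` as `h → 0⁺`, then
`φ b ≤ φ a` at Lebesgue points `a` and `b` of `φ`: the integral of the increments is the difference
of the integrals of `φ` over `[b, b + h]` and `[a, a + h]`. -/
theorem le_of_eventually_integral_translate_sub_le {φ : ℝ → ℝ} (hφ : LocallyIntegrable φ volume)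
    {a b : ℝ}
    (ha : HasDerivAt (fun x => ∫ t in (0 : ℝ)..x, φ t) (φ a) a)
    (hb : HasDerivAt (fun x => ∫ t in (0 : ℝ)..x, φ t) (φ b) b)
    (h : ∀ ε > 0, ∀ᶠ h in 𝓝[>] (0 : ℝ), ∫ τ in a..b, (φ (τ + h) - φ τ) ≤ h * ε) :
    φ b ≤ φ a := by
  have hi : ∀ x y, IntervalIntegrable φ volume x y := fun x y =>
    (hφ.integrableOn_isCompact isCompact_uIcc).intervalIntegrable
  have key : ∀ c, HasDerivAt (fun x => ∫ t in (0 : ℝ)..x, φ t) (φ c) c →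
      Tendsto (fun h => h⁻¹ * ∫ t in c..(c + h), φ t) (𝓝[>] 0) (𝓝 (φ c)) := by
    intro c hc
    have h1 := hc.tendsto_slope_zero_right
    refine h1.congr fun t => ?_
    rw [smul_eq_mul, intervalIntegral.integral_interval_sub_left (hi _ _) (hi _ _)]
  have h2 := (key b hb).sub (key a ha)
  refine le_of_forall_pos_le_add fun ε hε => ?_
  have h3 : φ b - φ a ≤ ε := by
    refine le_of_tendsto h2 ?_
    filter_upwards [h ε hε, self_mem_nhdsWithin] with t ht ht0
    have ht0 : 0 < t := ht0
    have hsh : ∀ x y : ℝ, IntervalIntegrable (fun τ => φ (τ + t)) volume x y := fun x y => by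
      have := (hi (x + t) (y + t)).comp_add_right t
      simpa using this
    rw [intervalIntegral.integral_sub (hsh _ _) (hi _ _),
      intervalIntegral.integral_comp_add_right] at ht
    have e : (∫ x in (a + t)..(b + t), φ x) - ∫ x in a..b, φ x
        = (∫ x in b..(b + t), φ x) - ∫ x in a..(a + t), φ x := by
      have e1 := intervalIntegral.integral_add_adjacent_intervals (hi a (a + t)) (hi (a + t) (b + t))
      have e2 := intervalIntegral.integral_add_adjacent_intervals (hi a b) (hi b (b + t))
      linarith
    rw [e] at ht
    rw [← mul_sub, inv_mul_le_iff₀ ht0]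
    exact ht
  linarith

/-- Averages of `‖U‖` against short increments of `U` are `o(h)`, by continuity of translations in
`L²` and the Cauchy–Schwarz inequality. -/
theorem lintegral_enorm_mul_translate_sub_le {V : Type*} [NormedAddCommGroup V]
    {U : ℝ → V} (hU : MemLp U 2 volume) {ε : ℝ} (hε : 0 < ε) :
    ∀ᶠ h in 𝓝[>] (0 : ℝ), ∫⁻ τ, ∫⁻ r in Ioc 0 h, ‖U (τ + r)‖ₑ * ‖U (τ + h) - U (τ + r)‖ₑ
      ≤ ENNReal.ofReal (h * ε) := by
  have : Fact ((1 : ℝ≥0∞) ≤ 2) := ⟨by norm_num⟩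
  have ht := tendsto_eLpNorm_translate_sub (μ := (volume : Measure ℝ)) (p := 2) (by norm_num) hU
  set N := eLpNorm U 2 volume with hN
  have hNtop : N ≠ ⊤ := hU.2.ne
  set ε' := ENNReal.ofReal ε / (N + 1) with hε'
  have hε'0 : 0 < ε' := ENNReal.div_pos (by simpa using hε) (by simp [hNtop])
  have hev : ∀ᶠ y in 𝓝 (0 : ℝ), eLpNorm (fun x => U (x + y) - U x) 2 volume < ε' :=
    ht.eventually (gt_mem_nhds hε'0)
  obtain ⟨δ, hδ, hδ'⟩ := Metric.eventually_nhds_iff.1 hev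
  filter_upwards [Ioo_mem_nhdsGT hδ] with h hh
  have hm : AEStronglyMeasurable U volume := hU.1
  have hqp : ∀ c : ℝ, Measure.QuasiMeasurePreserving (fun τ : ℝ => τ + c) volume volume :=
    fun c => (measurePreserving_add_right volume c).quasiMeasurePreserving
  have hmeas : AEMeasurable (Function.uncurry fun τ r : ℝ =>
      ‖U (τ + r)‖ₑ * ‖U (τ + h) - U (τ + r)‖ₑ)
      ((volume : Measure ℝ).prod (volume.restrict (Ioc 0 h))) := by
    have h1 : AEStronglyMeasurable (fun p : ℝ × ℝ => U (p.1 + p.2))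
        ((volume : Measure ℝ).prod (volume.restrict (Ioc 0 h))) := by
      have : Measure.QuasiMeasurePreserving (fun p : ℝ × ℝ => p.1 + p.2)
          ((volume : Measure ℝ).prod volume) volume := by
        have := quasiMeasurePreserving_add (volume : Measure ℝ) volume
        exact this
      refine (hm.comp_quasiMeasurePreserving this).mono_ac ?_
      exact Measure.AbsolutelyContinuous.prod Measure.AbsolutelyContinuous.rfl
        Measure.restrict_le_self.absolutelyContinuous
    have h2 : AEStronglyMeasurable (fun p : ℝ × ℝ => U (p.1 + h))
        ((volume : Measure ℝ).prod (volume.restrict (Ioc 0 h))) :=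
      (hm.comp_quasiMeasurePreserving (hqp h)).comp_fst
    exact h1.enorm.mul (h2.sub h1).enorm
  rw [lintegral_lintegral_swap hmeas]
  calc ∫⁻ r in Ioc 0 h, ∫⁻ τ, ‖U (τ + r)‖ₑ * ‖U (τ + h) - U (τ + r)‖ₑ
      ≤ ∫⁻ r in Ioc 0 h, N * ε' := by
        refine setLIntegral_mono' measurableSet_Ioc fun r hr => ?_
        have e1 : ∫⁻ τ, ‖U (τ + r)‖ₑ * ‖U (τ + h) - U (τ + r)‖ₑ
            = ∫⁻ τ, ‖U τ‖ₑ * ‖U (τ + (h - r)) - U τ‖ₑ := by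
          rw [← lintegral_add_right_eq_self
            (fun τ => ‖U τ‖ₑ * ‖U (τ + (h - r)) - U τ‖ₑ) r]
          congr with τ
          rw [show τ + r + (h - r) = τ + h by ring]
        rw [e1]
        have hmd : AEStronglyMeasurable (fun τ => U (τ + (h - r)) - U τ) volume :=
          (hm.comp_quasiMeasurePreserving (hqp (h - r))).sub hm
        have hH := ENNReal.lintegral_mul_le_Lp_mul_Lq (volume : Measure ℝ)
          Real.HolderConjugate.two_two hm.enorm hmd.enorm
        have n1 : (∫⁻ a, ‖U a‖ₑ ^ (2 : ℝ)) ^ (1 / (2 : ℝ)) = N := by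
          rw [hN, eLpNorm_eq_lintegral_rpow_enorm_toReal (by norm_num) (by norm_num)]; simp
        have n2 : (∫⁻ a, ‖U (a + (h - r)) - U a‖ₑ ^ (2 : ℝ)) ^ (1 / (2 : ℝ))
            = eLpNorm (fun x => U (x + (h - r)) - U x) 2 volume := by
          rw [eLpNorm_eq_lintegral_rpow_enorm_toReal (by norm_num) (by norm_num)]; simp
        rw [n1, n2] at hH
        refine hH.trans ?_
        gcongr
        refine (hδ' ?_).le
        rw [Real.dist_eq, sub_zero, abs_lt]
        constructor <;> linarith [hr.1, hr.2, hh.1, hh.2]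
    _ = N * ε' * ENNReal.ofReal h := by
        rw [setLIntegral_const, Real.volume_Ioc, sub_zero]
    _ ≤ ENNReal.ofReal ε * ENNReal.ofReal h := by
        gcongr
        rw [hε', ← ENNReal.mul_comm_div]
        calc N / (N + 1) * ENNReal.ofReal ε ≤ 1 * ENNReal.ofReal ε := by
              gcongr
              exact ENNReal.div_le_of_le_mul (by rw [one_mul]; exact le_self_add)
          _ = _ := one_mul _
    _ = ENNReal.ofReal (h * ε) := by rw [mul_comm, ← ENNReal.ofReal_mul hh.1.le]

/-! ### The energy inequality -/

/-- Young's inequality for a nonnegative symmetric form. -/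
theorem two_mul_form_le {V : Type*} [NormedAddCommGroup V] [InnerProductSpace ℝ V]
    (d : V →L[ℝ] V →L[ℝ] ℝ) (hsymm : ∀ v w, d v w = d w v) (hnn : ∀ v, 0 ≤ d v v)
    {r : ℝ} (hr : 0 < r) (v w : V) : 2 * d v w ≤ r * d v v + r⁻¹ * d w w := by
  have h := hnn (r • v - w)
  simp only [map_sub, map_smul, sub_apply, smul_apply,
    smul_eq_mul, hsymm w v] at h
  have h2 : 0 ≤ r⁻¹ * (r * (r * d v v) - r * d v w - (r * d v w - d w w)) := by
    apply mul_nonneg (by positivity); linarith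
  have e : r⁻¹ * (r * (r * d v v) - r * d v w - (r * d v w - d w w))
      = r * d v v - 2 * d v w + r⁻¹ * d w w := by field_simp; ring
  linarith

section Energy

variable {H : Type*} [NormedAddCommGroup H] [InnerProductSpace ℝ H]
  {V : Type*} [NormedAddCommGroup V] [InnerProductSpace ℝ V]

theorem sqrt_form_le (d : V →L[ℝ] V →L[ℝ] ℝ) (v : V) : √(d v v) ≤ √‖d‖ * ‖v‖ := by
  have h : d v v ≤ ‖d‖ * ‖v‖ ^ 2 := by
    calc d v v ≤ ‖d v v‖ := le_abs_self _
      _ ≤ ‖d‖ * ‖v‖ * ‖v‖ := d.le_opNorm₂ v v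
      _ = _ := by ring
  calc √(d v v) ≤ √(‖d‖ * ‖v‖ ^ 2) := Real.sqrt_le_sqrt h
    _ = _ := by rw [Real.sqrt_mul (norm_nonneg d), Real.sqrt_sq (norm_nonneg v)]

/-- The defect in testing the equation at `v` with a nearby vector `w` in place of `v`. -/
theorem form_sub_form_le (ι : V →L[ℝ] H) (d : V →L[ℝ] V →L[ℝ] ℝ)
    (c : V → V →L[ℝ] ℝ) {C M : ℝ} (hC : 0 ≤ C)
    (hcb : ∀ v w, |c v w| ≤ C * ‖ι v‖ * √(d v v) * √(d w w)) (hcz : ∀ v, c v v = 0)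
    (v w : V) (hv : ‖ι v‖ ≤ M) :
    d v v - d v w - c v w ≤ ‖d‖ * (1 + C * M) * (‖v‖ * ‖w - v‖) := by
  have hM : 0 ≤ M := (norm_nonneg _).trans hv
  have hdb := sqrt_form_le d
  have h1 : d v v - d v w ≤ ‖d‖ * (‖v‖ * ‖w - v‖) := by
    calc d v v - d v w = d v (v - w) := by rw [map_sub]
      _ ≤ ‖d v (v - w)‖ := le_abs_self _
      _ ≤ ‖d‖ * ‖v‖ * ‖v - w‖ := d.le_opNorm₂ _ _
      _ = _ := by rw [norm_sub_rev]; ring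
  have h2 : - c v w ≤ C * M * ‖d‖ * (‖v‖ * ‖w - v‖) := by
    calc - c v w = - c v (w - v) := by rw [map_sub, hcz, sub_zero]
      _ ≤ |c v (w - v)| := neg_le_abs _
      _ ≤ C * ‖ι v‖ * √(d v v) * √(d (w - v) (w - v)) := hcb _ _
      _ ≤ C * M * (√‖d‖ * ‖v‖) * (√‖d‖ * ‖w - v‖) := by
          gcongr
          · exact hdb v
          · exact hdb (w - v)
      _ = C * M * (√‖d‖ * √‖d‖) * (‖v‖ * ‖w - v‖) := by ring
      _ = _ := by rw [Real.mul_self_sqrt (norm_nonneg d)]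
  nlinarith

/-- Integrability in time of the terms that occur when the equation is tested. -/
theorem intervalIntegrable_equation (ι : V →L[ℝ] H) (d : V →L[ℝ] V →L[ℝ] ℝ)
    (c : V → V →L[ℝ] ℝ) {C M : ℝ} (hC : 0 ≤ C) (hc : Continuous c)
    (hcb : ∀ v w, |c v w| ≤ C * ‖ι v‖ * √(d v v) * √(d w w))
    {U : ℝ → V} {a b : ℝ} (hU : MemLp U 2 (volume.restrict (uIcc a b)))
    (hM : ∀ᵐ t ∂volume.restrict (uIcc a b), ‖ι (U t)‖ ≤ M) :
    IntervalIntegrable (fun t => ‖U t‖) volume a b ∧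
    IntervalIntegrable (fun t => d (U t) (U t)) volume a b ∧
    (∀ w, IntervalIntegrable (fun t => d (U t) w) volume a b) ∧
    (∀ w, IntervalIntegrable (fun t => c (U t) w) volume a b) ∧
    (∀ w, IntervalIntegrable (fun t => ‖U t‖ * ‖w - U t‖) volume a b) := by
  have hfin : IsFiniteMeasure (volume.restrict (uIcc a b)) :=
    ⟨by rw [Measure.restrict_apply_univ]; exact isCompact_uIcc.measure_lt_top⟩
  have hii : ∀ {g : ℝ → ℝ}, Integrable g (volume.restrict (uIcc a b)) →
      IntervalIntegrable g volume a b := fun hg => IntegrableOn.intervalIntegrable hg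
  have hU1 : Integrable U (volume.restrict (uIcc a b)) := hU.integrable (by norm_num)
  have hn : Integrable (fun t => ‖U t‖) (volume.restrict (uIcc a b)) := hU1.norm
  have hn2 : Integrable (fun t => ‖U t‖ ^ 2) (volume.restrict (uIcc a b)) :=
    hU.integrable_norm_pow (by norm_num)
  have hd : ∀ v w, ‖d v w‖ ≤ ‖d‖ * ‖v‖ * ‖w‖ := d.le_opNorm₂
  have hms := hU1.aestronglyMeasurable
  refine ⟨hii hn, hii ?_, fun w => hii ?_, fun w => hii ?_, fun w => hii ?_⟩
  · refine (hn2.const_mul ‖d‖).mono' ?_ (Eventually.of_forall fun t => ?_)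
    · exact (show Continuous fun v => d v v by fun_prop).comp_aestronglyMeasurable hms
    · calc _ ≤ _ := hd _ _
        _ = _ := by ring
  · exact (hn.const_mul (‖d‖ * ‖w‖)).mono'
      ((show Continuous fun v => d v w by fun_prop).comp_aestronglyMeasurable hms)
      (Eventually.of_forall fun t => (hd _ _).trans (by linarith))
  · have hM' : ∀ᵐ t ∂volume.restrict (uIcc a b), ‖c (U t) w‖ ≤ C * M * √‖d‖ * √(d w w) * ‖U t‖ := by
      filter_upwards [hM] with t ht
      have hM0 : 0 ≤ M := (norm_nonneg _).trans ht
      have hdb := sqrt_form_le d (U t)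
      calc ‖c (U t) w‖ ≤ C * ‖ι (U t)‖ * √(d (U t) (U t)) * √(d w w) := hcb _ _
        _ ≤ C * M * (√‖d‖ * ‖U t‖) * √(d w w) := by gcongr
        _ = _ := by ring
    exact (hn.const_mul _).mono'
      ((show Continuous fun v => c v w by fun_prop).comp_aestronglyMeasurable hms) hM'
  · refine ((hn.mul_const ‖w‖).add hn2).mono'
      ((show Continuous fun v => ‖v‖ * ‖w - v‖ by fun_prop).comp_aestronglyMeasurable hms)
      (Eventually.of_forall fun t => ?_)
    rw [Real.norm_of_nonneg (by positivity)]
    calc ‖U t‖ * ‖w - U t‖ ≤ ‖U t‖ * (‖w‖ + ‖U t‖) := by gcongr; exact norm_sub_le _ _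
      _ = _ := by simp; ring

/-- The energy inequality between almost all pairs of times. No time derivative of `u` is needed:
the equation between `τ` and `τ + h` is tested with `u (τ + h)`, which bounds the increments of
`φ t = ‖u t‖² + 2 ∫₀ᵗ (d (U, U) - M ‖f‖)` by integrals of `‖U (τ + r)‖ ‖U (τ + h) - U (τ + r)‖`.
These are `o(h)` in the mean, so that `φ` decreases along its Lebesgue points. -/
theorem energy_inequality (ι : V →L[ℝ] H) (d : V →L[ℝ] V →L[ℝ] ℝ)
    (c : V → V →L[ℝ] ℝ) {C M T : ℝ} (hC : 0 ≤ C) (hc : Continuous c)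
    (hcb : ∀ v w, |c v w| ≤ C * ‖ι v‖ * √(d v v) * √(d w w)) (hcz : ∀ v, c v v = 0)
    {f u : ℝ → H} (hf : IntegrableOn f (Ici 0) volume) {U : ℝ → V}
    (hU : MemLp U 2 (volume.restrict (Icc 0 T)))
    (hUu : ∀ᵐ t ∂volume.restrict (Icc 0 T), ι (U t) = u t)
    (hM : ∀ᵐ t ∂volume.restrict (Icc 0 T), ‖u t‖ ≤ M)
    (heq : ∀ w s t, 0 ≤ s → s ≤ t → inner ℝ (u t) (ι w) - inner ℝ (u s) (ι w) =
      ∫ τ in s..t, (inner ℝ (f τ) (ι w) - d (U τ) w - c (U τ) w)) :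
    ∃ G : Set ℝ, G ⊆ Ioo 0 T ∧ (∀ᵐ t ∂volume.restrict (Icc 0 T), t ∈ G) ∧
      (∀ t ∈ G, ι (U t) = u t ∧ ‖u t‖ ≤ M) ∧ ∀ s ∈ G, ∀ t ∈ G, s < t →
        ‖u t‖ ^ 2 + 2 * ∫ τ in s..t, d (U τ) (U τ) ≤ ‖u s‖ ^ 2 + 2 * M * ∫ τ in s..t, ‖f τ‖ := by
  rcases le_or_gt T 0 with hT | hT
  · refine ⟨∅, by simp, ?_, by simp, by simp⟩
    have : volume.restrict (Icc 0 T) = 0 := by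
      rw [Measure.restrict_eq_zero, Real.volume_Icc, ENNReal.ofReal_eq_zero]; linarith
    rw [this]; simp
  have hmI : MeasurableSet (Icc (0 : ℝ) T) := measurableSet_Icc
  -- extension by zero outside `[0, T]`
  set W : ℝ → V := (Icc 0 T).indicator U with hW
  have hWU : ∀ t ∈ Icc 0 T, W t = U t := fun t ht => indicator_of_mem ht _
  have hW2 : MemLp W 2 volume := (memLp_indicator_iff_restrict hmI).2 hU
  set g : ℝ → ℝ := (Icc 0 T).indicator fun t => d (U t) (U t) - M * ‖f t‖ with hg
  have hfI : ∀ s t, 0 ≤ s → 0 ≤ t → IntervalIntegrable f volume s t := by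
    intro s t hs ht
    refine (hf.mono_set ?_).intervalIntegrable
    intro x hx
    exact (le_inf hs ht).trans hx.1
  have hιM : ∀ᵐ t ∂volume.restrict (Icc 0 T), ‖ι (U t)‖ ≤ M := by
    filter_upwards [hUu, hM] with t h1 h2; rw [h1]; exact h2
  have hsub : ∀ s t, s ∈ Icc 0 T → t ∈ Icc 0 T → uIcc s t ⊆ Icc 0 T :=
    fun s t hs ht => uIcc_subset_Icc hs ht
  have hint : ∀ s t, s ∈ Icc 0 T → t ∈ Icc 0 T → _ := fun s t hs ht =>
    intervalIntegrable_equation (a := s) (b := t) ι d c hC hc hcb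
      (hU.mono_measure (Measure.restrict_mono (hsub s t hs ht) le_rfl))
      (ae_restrict_of_ae_restrict_of_subset (hsub s t hs ht) hιM)
  have h0T : (0 : ℝ) ∈ Icc 0 T := ⟨le_rfl, hT.le⟩
  have hTT : T ∈ Icc 0 T := ⟨hT.le, le_rfl⟩
  have hgI : Integrable g volume := by
    rw [hg, integrable_indicator_iff hmI]
    have h1 := (hint 0 T h0T hTT).2.1
    have h2 := ((hfI 0 T le_rfl hT.le).norm.const_mul M)
    have := h1.sub h2
    rw [intervalIntegrable_iff_integrableOn_Icc_of_le hT.le] at this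
    exact this
  set φ : ℝ → ℝ := fun t => ‖ι (W t)‖ ^ 2 + 2 * ∫ τ in (0 : ℝ)..t, g τ with hφ
  have hφ1 : Continuous fun t => ∫ τ in (0 : ℝ)..t, g τ :=
    intervalIntegral.continuous_primitive (fun a b => hgI.intervalIntegrable) 0
  have hφ2 : Integrable (fun t => ‖ι (W t)‖ ^ 2) volume :=
    (ι.comp_memLp' hW2).integrable_norm_pow (by norm_num)
  have hφL : LocallyIntegrable φ volume :=
    hφ2.locallyIntegrable.add
      (by fun_prop : Continuous fun t => 2 * ∫ τ in (0 : ℝ)..t, g τ).locallyIntegrable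
  -- the times at which everything is defined as it should be and `φ` has a Lebesgue point
  set G : Set ℝ := {t | t ∈ Ioo 0 T ∧ ι (U t) = u t ∧ ‖u t‖ ≤ M ∧
    HasDerivAt (fun x => ∫ t in (0 : ℝ)..x, φ t) (φ t) t} with hG
  have hGae : ∀ᵐ t ∂volume.restrict (Icc 0 T), t ∈ G := by
    have h1 : ∀ᵐ t ∂volume.restrict (Icc 0 T), t ∈ Ioo 0 T := by
      rw [← restrict_Ioo_eq_restrict_Icc]
      exact ae_restrict_mem measurableSet_Ioo
    filter_upwards [h1, hUu, hM, ae_restrict_of_ae (LocallyIntegrable.ae_hasDerivAt_integral hφL)]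
      with t a b c d using ⟨a, b, c, d 0⟩
  refine ⟨G, fun t ht => ht.1, hGae, fun t ht => ⟨ht.2.1, ht.2.2.1⟩, fun a ha b hb hab => ?_⟩
  have hGae' : ∀ᵐ t, t ∈ Icc 0 T → t ∈ G := (ae_restrict_iff' hmI).1 hGae
  set L := 2 * (‖d‖ * (1 + C * M)) with hL
  have hM0 : 0 ≤ M := (norm_nonneg _).trans ha.2.2.1
  have hL0 : 0 ≤ L := by positivity
  -- pointwise bound of the increments of `φ`
  have hincr : ∀ h, 0 < h → ∀ τ ∈ G, τ + h ∈ G → φ (τ + h) - φ τ ≤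
      L * ∫ r in (0 : ℝ)..h, ‖W (τ + r)‖ * ‖W (τ + h) - W (τ + r)‖ := by
    intro h hh τ hτ hτh
    have hτI := Ioo_subset_Icc_self hτ.1
    have hτhI := Ioo_subset_Icc_self hτh.1
    set w := U (τ + h) with hw
    obtain ⟨-, i1, i2, i3, i4⟩ := hint τ (τ + h) hτI hτhI
    have ifn := hfI τ (τ + h) hτ.1.1.le hτh.1.1.le
    have ifw : IntervalIntegrable (fun t => inner ℝ (f t) (ι w)) volume τ (τ + h) := by
      refine ((ifn.norm.mul_const ‖ι w‖)).mono_fun ?_ (Eventually.of_forall fun t => ?_)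
      · exact (show Continuous fun x => inner ℝ x (ι w) by fun_prop).comp_aestronglyMeasurable
          ifn.def'.aestronglyMeasurable
      · simpa using norm_inner_le_norm (𝕜 := ℝ) (f t) (ι w)
    have hle : τ ≤ τ + h := by linarith
    have e1 : ‖u (τ + h)‖ ^ 2 - ‖u τ‖ ^ 2 ≤ 2 * ∫ t in τ..(τ + h),
        (inner ℝ (f t) (ι w) - d (U t) w - c (U t) w) := by
      rw [← heq w τ (τ + h) hτI.1 hle, hw, hτh.2.1, real_inner_self_eq_norm_sq]
      have := sq_nonneg ‖u (τ + h) - u τ‖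
      rw [norm_sub_sq_real, real_inner_comm] at this
      linarith
    have e2 : (∫ t in (0 : ℝ)..(τ + h), g t) - ∫ t in (0 : ℝ)..τ, g t
        = ∫ t in τ..(τ + h), (d (U t) (U t) - M * ‖f t‖) := by
      rw [intervalIntegral.integral_interval_sub_left hgI.intervalIntegrable
        hgI.intervalIntegrable]
      refine intervalIntegral.integral_congr fun t ht => ?_
      exact indicator_of_mem (hsub _ _ hτI hτhI ht) _
    have e3 : (∫ t in τ..(τ + h), (inner ℝ (f t) (ι w) - d (U t) w - c (U t) w))
        + ∫ t in τ..(τ + h), (d (U t) (U t) - M * ‖f t‖)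
        ≤ ∫ t in τ..(τ + h), ‖d‖ * (1 + C * M) * (‖U t‖ * ‖w - U t‖) := by
      rw [← intervalIntegral.integral_add ((ifw.sub (i2 w)).sub (i3 w))
        (i1.sub (ifn.norm.const_mul M))]
      refine intervalIntegral.integral_mono_ae_restrict hle
        (((ifw.sub (i2 w)).sub (i3 w)).add (i1.sub (ifn.norm.const_mul M)))
        ((i4 w).const_mul _) ?_
      have hs : Icc τ (τ + h) ⊆ Icc 0 T := Icc_subset_Icc hτI.1 hτhI.2
      filter_upwards [ae_restrict_of_ae_restrict_of_subset hs hιM] with t ht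
      have b1 := form_sub_form_le ι d c hC hcb hcz (U t) w ht
      have b2 : inner ℝ (f t) (ι w) ≤ M * ‖f t‖ := by
        refine (real_inner_le_norm _ _).trans ?_
        rw [mul_comm]
        gcongr
        rw [hw, hτh.2.1]; exact hτh.2.2.1
      linarith
    have e4 : ∫ t in τ..(τ + h), ‖d‖ * (1 + C * M) * (‖U t‖ * ‖w - U t‖)
        = ‖d‖ * (1 + C * M) * ∫ r in (0 : ℝ)..h, ‖W (τ + r)‖ * ‖W (τ + h) - W (τ + r)‖ := by
      rw [intervalIntegral.integral_const_mul, intervalIntegral.integral_comp_add_left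
        (fun t => ‖W t‖ * ‖W (τ + h) - W t‖), add_zero]
      congr 1
      refine intervalIntegral.integral_congr fun t ht => ?_
      rw [hWU _ (hsub _ _ hτI hτhI ht), hWU _ hτhI]
    have hW' : W (τ + h) = w := hWU _ hτhI
    simp only [hφ, hWU _ hτI, hW', hw, hτ.2.1, hτh.2.1, hL] at e4 ⊢
    linarith
  have hmain : φ b ≤ φ a := by
    refine le_of_eventually_integral_translate_sub_le hφL ha.2.2.2 hb.2.2.2 fun ε hε => ?_
    have hε1 : 0 < ε / (L + 1) := by positivity
    filter_upwards [lintegral_enorm_mul_translate_sub_le hW2 hε1, Ioo_mem_nhdsGT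
      (show (0 : ℝ) < T - b by linarith [hb.1.2])] with h hh1 hh2
    set ψ : ℝ → ℝ := fun τ => φ (τ + h) - φ τ with hψ
    have hψi : IntervalIntegrable ψ volume a b := by
      have hi : ∀ x y, IntervalIntegrable φ volume x y := fun x y =>
        (hφL.integrableOn_isCompact isCompact_uIcc).intervalIntegrable
      have := (hi (a + h) (b + h)).comp_add_right h
      simp only [add_sub_cancel_right] at this
      exact this.sub (hi a b)
    have hψi' : IntegrableOn ψ (Ioc a b) volume := (intervalIntegrable_iff_integrableOn_Ioc_of_le
      hab.le).1 hψi
    have hGh : ∀ᵐ τ, τ + h ∈ Icc 0 T → τ + h ∈ G :=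
      (measurePreserving_add_right volume h).quasiMeasurePreserving.ae hGae'
    have hpt : ∀ᵐ τ ∂volume.restrict (Ioc a b), ENNReal.ofReal (ψ τ) ≤ ENNReal.ofReal L *
        ∫⁻ r in Ioc 0 h, ‖W (τ + r)‖ₑ * ‖W (τ + h) - W (τ + r)‖ₑ := by
      rw [ae_restrict_iff' measurableSet_Ioc]
      filter_upwards [hGae', hGh] with τ h1 h2 hτ
      have hτG := h1 ⟨ha.1.1.le.trans hτ.1.le, hτ.2.trans hb.1.2.le⟩
      have hτhG := h2 ⟨by linarith [hτ.1, ha.1.1, hh2.1], by linarith [hτ.2, hh2.2]⟩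
      refine (ENNReal.ofReal_le_ofReal (hincr h hh2.1 τ hτG hτhG)).trans ?_
      rw [ENNReal.ofReal_mul hL0, intervalIntegral.integral_of_le hh2.1.le]
      gcongr
      refine (Real.ofReal_le_enorm _).trans ((enorm_integral_le_lintegral_enorm _).trans_eq ?_)
      simp [enorm_mul]
    have h3 : ENNReal.ofReal (∫ τ in a..b, ψ τ) ≤ ENNReal.ofReal (h * ε) := by
      rw [intervalIntegral.integral_of_le hab.le]
      calc ENNReal.ofReal (∫ τ in Ioc a b, ψ τ)
          ≤ ENNReal.ofReal (∫ τ in Ioc a b, max (ψ τ) 0) := by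
            refine ENNReal.ofReal_le_ofReal (integral_mono hψi' hψi'.pos_part fun τ => ?_)
            exact le_max_left _ _
        _ ≤ ∫⁻ τ in Ioc a b, ‖max (ψ τ) 0‖ₑ :=
            (Real.ofReal_le_enorm _).trans (enorm_integral_le_lintegral_enorm _)
        _ = ∫⁻ τ in Ioc a b, ENNReal.ofReal (ψ τ) := by
            congr with τ
            rw [Real.enorm_eq_ofReal (le_max_right _ _), ENNReal.ofReal_max]
            simp
        _ ≤ ∫⁻ τ in Ioc a b, ENNReal.ofReal L *
            ∫⁻ r in Ioc 0 h, ‖W (τ + r)‖ₑ * ‖W (τ + h) - W (τ + r)‖ₑ := lintegral_mono_ae hpt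
        _ = ENNReal.ofReal L * ∫⁻ τ in Ioc a b,
            ∫⁻ r in Ioc 0 h, ‖W (τ + r)‖ₑ * ‖W (τ + h) - W (τ + r)‖ₑ :=
            lintegral_const_mul' _ _ ENNReal.ofReal_ne_top
        _ ≤ ENNReal.ofReal L * ENNReal.ofReal (h * (ε / (L + 1))) := by
            gcongr
            exact (setLIntegral_le_lintegral _ _).trans hh1
        _ = ENNReal.ofReal (L * (h * (ε / (L + 1)))) := (ENNReal.ofReal_mul hL0).symm
        _ ≤ ENNReal.ofReal (h * ε) := by
            apply ENNReal.ofReal_le_ofReal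
            have : L * (h * (ε / (L + 1))) = h * ε * (L / (L + 1)) := by ring
            rw [this]
            refine mul_le_of_le_one_right (mul_pos hh2.1 hε).le ?_
            rw [div_le_one (by positivity)]; linarith
    exact (ENNReal.ofReal_le_ofReal_iff (mul_pos hh2.1 hε).le).1 h3
  have hfin : (∫ t in (0 : ℝ)..b, g t) - ∫ t in (0 : ℝ)..a, g t
      = (∫ t in a..b, d (U t) (U t)) - M * ∫ t in a..b, ‖f t‖ := by
    have haI := Ioo_subset_Icc_self ha.1
    have hbI := Ioo_subset_Icc_self hb.1
    rw [intervalIntegral.integral_interval_sub_left hgI.intervalIntegrable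
      hgI.intervalIntegrable, ← intervalIntegral.integral_const_mul,
      ← intervalIntegral.integral_sub (hint a b haI hbI).2.1
        ((hfI a b haI.1 hbI.1).norm.const_mul M)]
    refine intervalIntegral.integral_congr fun t ht => ?_
    exact indicator_of_mem (hsub _ _ haI hbI ht) _
  simp only [hφ, hWU _ (Ioo_subset_Icc_self ha.1), hWU _ (Ioo_subset_Icc_self hb.1), ha.2.1,
    hb.2.1] at hmain
  linarith

end Energy

/-! ### Dissipative evolution equations -/

theorem exists_mem_Ioo_of_ae_restrict {P : ℝ → Prop} {S : Set ℝ}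
    (h : ∀ᵐ t ∂volume.restrict S, P t) {a b : ℝ} (hab : a < b) (hS : Ioo a b ⊆ S) :
    ∃ t ∈ Ioo a b, P t := by
  by_contra! hcon
  have h1 : ∀ᵐ t ∂volume.restrict (Ioo a b), P t := ae_restrict_of_ae_restrict_of_subset hS h
  have h2 : ∀ᵐ t ∂volume.restrict (Ioo a b), False := by
    filter_upwards [h1, ae_restrict_mem measurableSet_Ioo] with t h1 h2 using hcon t h2 h1
  rw [eventually_false_iff_eq_bot, ae_eq_bot, Measure.restrict_eq_zero, Real.volume_Ioo,
    ENNReal.ofReal_eq_zero] at h2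
  linarith

theorem tendsto_setIntegral_Ioi_zero {g : ℝ → ℝ} {a : ℝ} (hg : IntegrableOn g (Ioi a) volume) :
    Tendsto (fun t => ∫ x in Ioi t, g x) atTop (𝓝 0) := by
  have h1 := intervalIntegral_tendsto_integral_Ioi a hg tendsto_id
  have h2 : Tendsto (fun t => (∫ x in Ioi a, g x) - ∫ x in a..t, g x) atTop (𝓝 0) := by
    simpa using (tendsto_const_nhds (x := ∫ x in Ioi a, g x)).sub h1
  refine h2.congr' ?_
  filter_upwards [eventually_ge_atTop a] with t ht
  rw [intervalIntegral.integral_of_le ht, sub_eq_iff_eq_add, ← Ioc_union_Ioi_eq_Ioi ht,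
    setIntegral_union (Ioc_disjoint_Ioi_same) measurableSet_Ioi
      (hg.mono_set Ioc_subset_Ioi_self) (hg.mono_set (Ioi_subset_Ioi ht)), add_comm]

section Decay

variable {H : Type*} [NormedAddCommGroup H] [InnerProductSpace ℝ H]
  {V : Type*} [NormedAddCommGroup V] [InnerProductSpace ℝ V]

/-- `u` is a weak solution of the evolution equation with derivative `f - A u - c(u)`, where `A`
is the operator of the form `d` on `V`, the form domain `V` is mapped into `H` by `ι`, and `U` is
`u` as a function with values in `V`. The nonlinearity `c` is controlled by the dissipation `d`
and does not contribute to the energy balance. -/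
structure IsDissipativeSolution (ι : V →L[ℝ] H) (d : V →L[ℝ] V →L[ℝ] ℝ) (c : V → V →L[ℝ] ℝ)
    (C : ℝ) (f u : ℝ → H) (U : ℝ → V) : Prop where
  form_symm : ∀ v w, d v w = d w v
  form_nonneg : ∀ v, 0 ≤ d v v
  const_nonneg : 0 ≤ C
  continuous_convection : Continuous c
  convection_le : ∀ v w, |c v w| ≤ C * ‖ι v‖ * √(d v v) * √(d w w)
  convection_self : ∀ v, c v v = 0
  integrable_force : IntegrableOn f (Ici 0) volume
  memLp : ∀ T : ℝ, 0 < T → MemLp U 2 (volume.restrict (Icc 0 T))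
  ae_eq : ∀ᵐ t ∂volume.restrict (Ici (0 : ℝ)), ι (U t) = u t
  bounded : ∀ T : ℝ, 0 < T → ∃ M : ℝ, ∀ᵐ t ∂volume.restrict (Icc 0 T), ‖u t‖ ≤ M
  continuousOn : ∀ t, 0 ≤ t → ContinuousOn (fun s => inner ℝ (u s) (u t)) (Ici 0)
  equation : ∀ w s t, 0 ≤ s → s ≤ t → inner ℝ (u t) (ι w) - inner ℝ (u s) (ι w) =
      ∫ τ in s..t, (inner ℝ (f τ) (ι w) - d (U τ) w - c (U τ) w)

namespace IsDissipativeSolution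

variable {ι : V →L[ℝ] H} {d : V →L[ℝ] V →L[ℝ] ℝ} {c : V → V →L[ℝ] ℝ}
    {C : ℝ} {f u : ℝ → H} {U : ℝ → V}

theorem intervalIntegrable_force (h : IsDissipativeSolution ι d c C f u U) {s t : ℝ}
    (hs : 0 ≤ s) (ht : 0 ≤ t) : IntervalIntegrable f volume s t :=
  (h.integrable_force.mono_set fun _ hx => (le_inf hs ht).trans hx.1).intervalIntegrable

theorem integrableOn_norm_force (h : IsDissipativeSolution ι d c C f u U) :
    IntegrableOn (fun t => ‖f t‖) (Ici 0) volume := Integrable.norm h.integrable_force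

theorem integral_norm_force_le (h : IsDissipativeSolution ι d c C f u U) {s t : ℝ}
    (hs : 0 ≤ s) (hst : s ≤ t) : ∫ τ in s..t, ‖f τ‖ ≤ ∫ τ in Ioi s, ‖f τ‖ := by
  rw [intervalIntegral.integral_of_le hst]
  refine setIntegral_mono_set (h.integrableOn_norm_force.mono_set ?_)
    (Eventually.of_forall fun _ => norm_nonneg _) Ioc_subset_Ioi_self.eventuallyLE
  exact fun x hx => hs.trans hx.le

/-- The energy inequality for a dissipative solution on `[0, T]`, with the a priori bound `M` in
front of the force. -/
theorem exists_ae_energy (h : IsDissipativeSolution ι d c C f u U) (T : ℝ) {M : ℝ}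
    (hM : ∀ᵐ t ∂volume.restrict (Icc 0 T), ‖u t‖ ≤ M) (hT : 0 < T) :
    ∃ G : Set ℝ, G ⊆ Ioo 0 T ∧ (∀ᵐ t ∂volume.restrict (Icc 0 T), t ∈ G) ∧
      (∀ t ∈ G, ι (U t) = u t ∧ ‖u t‖ ≤ M) ∧ ∀ s ∈ G, ∀ t ∈ G, s < t →
        ‖u t‖ ^ 2 + 2 * ∫ τ in s..t, d (U τ) (U τ) ≤ ‖u s‖ ^ 2 + 2 * M * ∫ τ in s..t, ‖f τ‖ :=
  energy_inequality ι d c h.const_nonneg h.continuous_convection h.convection_le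
    h.convection_self h.integrable_force (h.memLp T hT)
    (ae_restrict_of_ae_restrict_of_subset Icc_subset_Ici_self h.ae_eq) hM h.equation

/-- The energy inequality makes the local bounds on `‖u‖` uniform in time: the best bound `m` on
`[0, T]` satisfies `m² ≤ M₁² + 2 m ∫ ‖f‖` with `M₁` a bound on `[0, 1]`. -/
theorem exists_ae_norm_le (h : IsDissipativeSolution ι d c C f u U) :
    ∃ M, 0 ≤ M ∧ ∀ T, 1 ≤ T → ∀ᵐ t ∂volume.restrict (Icc 0 T), ‖u t‖ ≤ M := by
  obtain ⟨M₁', hM₁'⟩ := h.bounded 1 one_pos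
  set M₁ := max M₁' 0 with hM₁d
  have hM₁0 : 0 ≤ M₁ := le_max_right _ _
  have hM₁ : ∀ᵐ t ∂volume.restrict (Icc (0 : ℝ) 1), ‖u t‖ ≤ M₁ := by
    filter_upwards [hM₁'] with t ht using ht.trans (le_max_left _ _)
  set F := ∫ τ in Ioi (0 : ℝ), ‖f τ‖ with hF
  have hF0 : 0 ≤ F := integral_nonneg fun _ => norm_nonneg _
  refine ⟨M₁ + 2 * F, by positivity, fun T hT => ?_⟩
  have hT0 : 0 < T := by linarith
  set B : Set ℝ := {M | 0 ≤ M ∧ ∀ᵐ t ∂volume.restrict (Icc 0 T), ‖u t‖ ≤ M} with hB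
  have hBne : B.Nonempty := by
    obtain ⟨M, hM⟩ := h.bounded T hT0
    refine ⟨max M 0, le_max_right _ _, ?_⟩
    filter_upwards [hM] with t ht using ht.trans (le_max_left _ _)
  have hBb : BddBelow B := ⟨0, fun M hM => hM.1⟩
  set m := sInf B with hm
  have hmB : m ∈ B := by
    refine ⟨le_csInf hBne fun M hM => hM.1, ?_⟩
    have h1 : ∀ n : ℕ, ∀ᵐ t ∂volume.restrict (Icc 0 T), ‖u t‖ ≤ m + 1 / ((n : ℝ) + 1) := by
      intro n
      obtain ⟨M, hM, hMm⟩ := exists_lt_of_csInf_lt hBne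
        (show sInf B < m + 1 / ((n : ℝ) + 1) by
          rw [← hm]; linarith [Nat.one_div_pos_of_nat (α := ℝ) (n := n)])
      filter_upwards [hM.2] with t ht using ht.trans hMm.le
    filter_upwards [ae_all_iff.2 h1] with t ht
    refine ge_of_tendsto' (x := atTop) ?_ ht
    simpa using (tendsto_const_nhds (x := m)).add tendsto_one_div_add_atTop_nhds_zero_nat
  obtain ⟨G, hGT, hGae, hG, hGE⟩ := h.exists_ae_energy T hmB.2 hT0
  have hsq : ∀ t ∈ G, ‖u t‖ ^ 2 ≤ M₁ ^ 2 + 2 * m * F := by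
    intro t ht
    have hIoo : Ioo 0 (min t 1) ⊆ Icc (0 : ℝ) 1 := fun x hx =>
      ⟨hx.1.le, (hx.2.trans_le (min_le_right _ _)).le⟩
    obtain ⟨s, hs, hsG, hsM⟩ := exists_mem_Ioo_of_ae_restrict (P := fun s => s ∈ G ∧ ‖u s‖ ≤ M₁)
      ((ae_restrict_of_ae_restrict_of_subset (Icc_subset_Icc_right hT) hGae).and hM₁)
      (lt_min (hGT ht).1 one_pos) hIoo
    have hst : s < t := hs.2.trans_le (min_le_left _ _)
    have h1 := hGE s hsG t ht hst
    have h2 : 0 ≤ ∫ τ in s..t, d (U τ) (U τ) :=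
      intervalIntegral.integral_nonneg hst.le fun _ _ => h.form_nonneg _
    have h3 : ∫ τ in s..t, ‖f τ‖ ≤ F := by
      refine (h.integral_norm_force_le hs.1.le hst.le).trans ?_
      exact setIntegral_mono_set (h.integrableOn_norm_force.mono_set Ioi_subset_Ici_self)
        (Eventually.of_forall fun _ => norm_nonneg _)
        (Ioi_subset_Ioi hs.1.le).eventuallyLE
    have h4 : ‖u s‖ ^ 2 ≤ M₁ ^ 2 := by gcongr
    have h5 : 2 * m * ∫ τ in s..t, ‖f τ‖ ≤ 2 * m * F := by
      have := hmB.1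
      gcongr
    linarith
  have hle : m ≤ √(M₁ ^ 2 + 2 * m * F) := by
    refine csInf_le hBb ⟨Real.sqrt_nonneg _, ?_⟩
    filter_upwards [hGae] with t ht
    exact Real.le_sqrt_of_sq_le (hsq t ht)
  have hm0 := hmB.1
  have hm2 : m ^ 2 ≤ M₁ ^ 2 + 2 * m * F := by
    rwa [Real.le_sqrt hm0 (by positivity)] at hle
  have : m ≤ M₁ + 2 * F := by
    by_contra! hcon
    nlinarith
  filter_upwards [hmB.2] with t ht using ht.trans this

/-- Weak continuity extends a bound on `‖u‖` from a dense set of times to all times. -/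
theorem norm_le_of_dense (h : IsDissipativeSolution ι d c C f u U) {t B : ℝ} (ht : 0 ≤ t)
    {S : Set ℝ} (hS : S ⊆ Ici 0) (htS : t ∈ closure S) (hB : ∀ r ∈ S, ‖u r‖ ≤ B) : ‖u t‖ ≤ B := by
  have h1 : ContinuousWithinAt (fun s => inner ℝ (u s) (u t)) S t :=
    ((h.continuousOn t ht) t ht).mono hS
  have h2 : inner ℝ (u t) (u t) ≤ B * ‖u t‖ := by
    refine h1.closure_le htS (continuousWithinAt_const (b := B * ‖u t‖)) fun r hr => ?_
    refine (real_inner_le_norm _ _).trans ?_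
    gcongr
    exact hB r hr
  rw [real_inner_self_eq_norm_sq, sq] at h2
  rcases (norm_nonneg (u t)).eq_or_lt with h0 | h0
  · obtain ⟨r, hr⟩ := (closure_nonempty_iff.1 ⟨t, htS⟩)
    rw [← h0]
    exact (norm_nonneg _).trans (hB r hr)
  · exact le_of_mul_le_mul_right h2 h0

/-- Global consequences of the energy inequality: `‖u‖` is bounded, the dissipation is integrable on
`(1, ∞)`, and up to the remaining force `‖u‖` cannot grow after almost every time. Only
large times matter below, whence the interval `(1, ∞)`. -/
theorem exists_energy_bound (h : IsDissipativeSolution ι d c C f u U) :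
    ∃ (M : ℝ) (G : Set ℝ), 0 ≤ M ∧ G ⊆ Ioi 0 ∧ (∀ᵐ t ∂volume.restrict (Ici (0 : ℝ)), t ∈ G) ∧
      (∀ t ∈ G, ι (U t) = u t) ∧ (∀ t, 0 ≤ t → ‖u t‖ ≤ M) ∧
      IntegrableOn (fun t => d (U t) (U t)) (Ioi 1) volume ∧
      ∀ s ∈ G, ∀ t, s < t → ‖u t‖ ^ 2 ≤ ‖u s‖ ^ 2 + 2 * M * ∫ τ in Ioi s, ‖f τ‖ := by
  obtain ⟨M, hM0, hM⟩ := h.exists_ae_norm_le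
  choose G' hG1 hG2 hG3 hG4 using fun n : ℕ => h.exists_ae_energy ((n : ℝ) + 1)
    (hM _ (by linarith [n.cast_nonneg (α := ℝ)])) (by positivity)
  set G : Set ℝ := {t | 0 < t ∧ ∀ n : ℕ, t ≤ n + 1 → t ∈ G' n} with hG
  have hGae : ∀ᵐ t ∂volume.restrict (Ici (0 : ℝ)), t ∈ G := by
    have h1 : ∀ᵐ t : ℝ, ∀ n : ℕ, t ∈ Icc (0 : ℝ) (n + 1) → t ∈ G' n :=
      ae_all_iff.2 fun n => (ae_restrict_iff' measurableSet_Icc).1 (hG2 n)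
    rw [← restrict_Ioi_eq_restrict_Ici, ae_restrict_iff' measurableSet_Ioi]
    filter_upwards [h1] with t ht ht0
    exact ⟨ht0, fun n hn => ht n ⟨ht0.le, hn⟩⟩
  have hGU : ∀ t ∈ G, ι (U t) = u t ∧ ‖u t‖ ≤ M := by
    intro t ht
    obtain ⟨n, hn⟩ := exists_nat_ge t
    exact hG3 n t (ht.2 n (by linarith))
  have hGE : ∀ s ∈ G, ∀ t ∈ G, s < t → ‖u t‖ ^ 2 + 2 * ∫ τ in s..t, d (U τ) (U τ)
      ≤ ‖u s‖ ^ 2 + 2 * M * ∫ τ in Ioi s, ‖f τ‖ := by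
    intro s hs t ht hst
    obtain ⟨n, hn⟩ := exists_nat_ge t
    have h1 := hG4 n s (hs.2 n (by linarith)) t (ht.2 n (by linarith)) hst
    have h2 := h.integral_norm_force_le hs.1.le hst.le
    have h3 : 2 * M * ∫ τ in s..t, ‖f τ‖ ≤ 2 * M * ∫ τ in Ioi s, ‖f τ‖ := by gcongr
    linarith
  have hclos : ∀ s t : ℝ, 0 ≤ s → s ≤ t → t ∈ closure (G ∩ Ioi s) := by
    intro s t hs hst
    rw [Metric.mem_closure_iff]
    intro ε hε
    obtain ⟨r, hr, hrG⟩ := exists_mem_Ioo_of_ae_restrict hGae (show t < t + ε by linarith)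
      (fun x hx => (hs.trans hst).trans hx.1.le)
    refine ⟨r, ⟨hrG, hst.trans_lt hr.1⟩, ?_⟩
    rw [dist_comm, Real.dist_eq, abs_lt]
    constructor <;> linarith [hr.1, hr.2]
  have hGI : ∀ s, G ∩ Ioi s ⊆ Ici 0 := fun s x hx => hx.1.1.le
  have hfin : ∀ a b : ℝ, 0 ≤ a → 0 ≤ b →
      IntervalIntegrable (fun t => d (U t) (U t)) volume a b := by
    intro a b ha hb
    have hsub : uIcc a b ⊆ Icc 0 (max a b + 1) := fun x hx =>
      ⟨(le_inf ha hb).trans hx.1, hx.2.trans (by simp)⟩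
    refine (intervalIntegrable_equation (a := a) (b := b) (M := M) ι d c h.const_nonneg
      h.continuous_convection h.convection_le ((h.memLp (max a b + 1)
        (by positivity)).mono_measure (Measure.restrict_mono hsub le_rfl)) ?_).2.1
    filter_upwards [ae_restrict_of_ae_restrict_of_subset
      (hsub.trans Icc_subset_Ici_self) hGae] with t ht
    rw [(hGU t ht).1]; exact (hGU t ht).2
  refine ⟨M, G, hM0, fun t ht => ht.1, hGae, fun t ht => (hGU t ht).1, fun t ht => ?_, ?_, ?_⟩
  · exact h.norm_le_of_dense ht (hGI 0) (hclos 0 t le_rfl ht) fun r hr => (hGU r hr.1).2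
  · obtain ⟨s, hs, hsG⟩ := exists_mem_Ioo_of_ae_restrict hGae (zero_lt_one' ℝ)
      (fun x hx => hx.1.le)
    refine integrableOn_Ioi_of_intervalIntegral_norm_bounded
      ((‖u s‖ ^ 2 + 2 * M * ∫ τ in Ioi s, ‖f τ‖) / 2) 1 (fun n : ℕ => ?_) tendsto_natCast_atTop_atTop ?_
    · have := hfin 1 (max 1 n) zero_le_one (by positivity)
      rw [intervalIntegrable_iff_integrableOn_Ioc_of_le (le_max_left _ _)] at this
      exact this.mono_set (Ioc_subset_Ioc_right (le_max_right _ _))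
    · filter_upwards [eventually_ge_atTop 1] with n hn
      have hn1 : (1 : ℝ) ≤ n := by exact_mod_cast hn
      obtain ⟨t, ht, htG⟩ := exists_mem_Ioo_of_ae_restrict hGae
        (show (n : ℝ) < n + 1 by linarith) (fun x hx => (by linarith : (0 : ℝ) ≤ n).trans hx.1.le)
      have h1 := hGE s hsG t htG (by linarith [hs.2, ht.1])
      have h2 : ∫ τ in (1 : ℝ)..n, ‖d (U τ) (U τ)‖ ≤ ∫ τ in s..t, d (U τ) (U τ) := by
        have : ∀ τ, ‖d (U τ) (U τ)‖ = d (U τ) (U τ) := fun τ =>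
          Real.norm_of_nonneg (h.form_nonneg _)
        simp only [this]
        exact intervalIntegral.integral_mono_interval hs.2.le hn1 ht.1.le
          (Eventually.of_forall fun _ => h.form_nonneg _) (hfin _ _ hs.1.le (by linarith [ht.1]))
      nlinarith [sq_nonneg ‖u t‖]
  · intro s hs t hst
    have h0 : 0 ≤ ‖u s‖ ^ 2 + 2 * M * ∫ τ in Ioi s, ‖f τ‖ := by
      have : 0 ≤ ∫ τ in Ioi s, ‖f τ‖ := integral_nonneg fun _ => norm_nonneg _
      positivity
    have h1 : ‖u t‖ ≤ √(‖u s‖ ^ 2 + 2 * M * ∫ τ in Ioi s, ‖f τ‖) := by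
      refine h.norm_le_of_dense (hs.1.le.trans hst.le) (hGI s) (hclos s t hs.1.le hst.le) ?_
      intro r hr
      apply Real.le_sqrt_of_sq_le
      have h2 := hGE s hs r hr.1 hr.2
      have h3 : 0 ≤ ∫ τ in s..r, d (U τ) (U τ) :=
        intervalIntegral.integral_nonneg (le_of_lt hr.2) fun _ _ => h.form_nonneg _
      linarith
    calc ‖u t‖ ^ 2 ≤ √(‖u s‖ ^ 2 + 2 * M * ∫ τ in Ioi s, ‖f τ‖) ^ 2 := by gcongr
      _ = _ := Real.sq_sqrt h0

end IsDissipativeSolution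
end Decay

/-! ### Decay of dissipative solutions -/

section Decay

variable {H : Type*} [NormedAddCommGroup H] [InnerProductSpace ℝ H]
  {V : Type*} [NormedAddCommGroup V] [InnerProductSpace ℝ V]

namespace IsDissipativeSolution

variable {ι : V →L[ℝ] H} {d : V →L[ℝ] V →L[ℝ] ℝ} {c : V → V →L[ℝ] ℝ}
    {C : ℝ} {f u : ℝ → H} {U : ℝ → V}

/-- One step of the duality argument: over the time step from `a` to `b`, the solution is compared
with one step `v ↦ (1 + A)⁻¹ v` of the backward Euler scheme for the dual equation. The errors are
split by Young's inequality with weight `r` into the dissipation of `u`, with factor `r`, and that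
of the scheme, which is at most a multiple of `r⁻¹ (‖v‖² - ‖(1 + A)⁻¹ v‖²)` and telescopes over
successive steps. -/
theorem inner_le_inner_resolvent_add (h : IsDissipativeSolution ι d c C f u U)
    {S : H →L[ℝ] V} (hS : ∀ x w, inner ℝ (ι (S x)) (ι w) + d (S x) w = inner ℝ x (ι w))
    {M : ℝ} (hM : ∀ t, 0 ≤ t → ‖u t‖ ≤ M) {a b : ℝ} (ha : 0 ≤ a) (hab : a ≤ b) (hba : b - a ≤ 2)
    (hb : ι (U b) = u b) {r : ℝ} (hr : 0 < r) (v : H) :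
    inner ℝ (u b) v + (C * M + 2) * r⁻¹ * ‖ι (S v)‖ ^ 2 ≤ inner ℝ (u a) (ι (S v))
      + ‖v‖ * (∫ τ in a..b, ‖f τ‖) + (C * M + 1) * r * (∫ τ in a..b, d (U τ) (U τ))
      + r * d (U b) (U b) + (C * M + 2) * r⁻¹ * ‖v‖ ^ 2 := by
  have hM0 : 0 ≤ M := (norm_nonneg _).trans (hM 0 le_rfl)
  have hC := h.const_nonneg
  set z := S v with hz
  have hzz := hS v z
  rw [← hz, real_inner_self_eq_norm_sq] at hzz
  have hdz : 2 * d z z ≤ ‖v‖ ^ 2 - ‖ι z‖ ^ 2 := by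
    have := sq_nonneg ‖v - ι z‖
    rw [norm_sub_sq_real] at this
    linarith
  have hdz0 := h.form_nonneg z
  have hιz : ‖ι z‖ ≤ ‖v‖ := by
    apply le_of_sq_le_sq _ (norm_nonneg v)
    linarith
  have hb0 := ha.trans hab
  have hsub : uIcc a b ⊆ Icc 0 (b + 1) := fun x hx => by
    rw [uIcc_of_le hab] at hx
    exact ⟨ha.trans hx.1, by linarith [hx.2]⟩
  have hUM : ∀ᵐ t ∂volume.restrict (uIcc a b), ‖ι (U t)‖ ≤ M := by
    filter_upwards [ae_restrict_of_ae_restrict_of_subset (hsub.trans Icc_subset_Ici_self) h.ae_eq,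
      ae_restrict_mem measurableSet_uIcc] with t ht ht0
    rw [ht]; exact hM t (hsub ht0).1
  obtain ⟨-, i1, i2, i3, -⟩ := intervalIntegrable_equation (a := a) (b := b) ι d c hC
      h.continuous_convection h.convection_le ((h.memLp (b + 1)
        (by positivity)).mono_measure (Measure.restrict_mono hsub le_rfl)) hUM
  have ifn := h.intervalIntegrable_force ha hb0
  have ifw : IntervalIntegrable (fun t => inner ℝ (f t) (ι z)) volume a b := by
    refine ((ifn.norm.mul_const ‖ι z‖)).mono_fun ?_ (Eventually.of_forall fun t => ?_)
    · exact (show Continuous fun x => inner ℝ x (ι z) by fun_prop).comp_aestronglyMeasurable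
        ifn.def'.aestronglyMeasurable
    · simpa using norm_inner_le_norm (𝕜 := ℝ) (f t) (ι z)
  have e1 : inner ℝ (u b) (ι z) - inner ℝ (u a) (ι z) ≤ ‖v‖ * (∫ τ in a..b, ‖f τ‖)
      + (C * M + 1) / 2 * r * (∫ τ in a..b, d (U τ) (U τ)) + (C * M + 1) * r⁻¹ * d z z := by
    rw [h.equation z a b ha hab]
    have e2 : ∫ τ in a..b, (inner ℝ (f τ) (ι z) - d (U τ) z - c (U τ) z) ≤
        ∫ τ in a..b, (‖v‖ * ‖f τ‖ + (C * M + 1) / 2 * r * d (U τ) (U τ)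
          + (C * M + 1) / 2 * r⁻¹ * d z z) := by
      refine intervalIntegral.integral_mono_ae_restrict hab ((ifw.sub (i2 z)).sub (i3 z))
        (((ifn.norm.const_mul _).add (i1.const_mul _)).add intervalIntegrable_const) ?_
      rw [uIcc_of_le hab] at hUM
      filter_upwards [hUM] with t ht
      have b1 : inner ℝ (f t) (ι z) ≤ ‖v‖ * ‖f t‖ := by
        refine (real_inner_le_norm _ _).trans ?_
        rw [mul_comm]
        gcongr
      have b2 : - d (U t) z ≤ (r * d (U t) (U t) + r⁻¹ * d z z) / 2 := by
        have := two_mul_form_le d h.form_symm h.form_nonneg hr (U t) (-z)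
        simp only [map_neg, neg_apply, neg_neg] at this
        linarith
      have b3 : - c (U t) z ≤ C * M * ((r * d (U t) (U t) + r⁻¹ * d z z) / 2) := by
        have hdt := h.form_nonneg (U t)
        have s1 : √(d (U t) (U t)) * √(d z z) ≤ (r * d (U t) (U t) + r⁻¹ * d z z) / 2 := by
          have q1 := Real.sq_sqrt hdt
          have q2 := Real.sq_sqrt hdz0
          have q3 : 0 ≤ r⁻¹ * (r * √(d (U t) (U t)) - √(d z z)) ^ 2 := by positivity
          have q4 : r⁻¹ * (r * √(d (U t) (U t)) - √(d z z)) ^ 2 = r * √(d (U t) (U t)) ^ 2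
              - 2 * (√(d (U t) (U t)) * √(d z z)) + r⁻¹ * √(d z z) ^ 2 := by
            field_simp; ring
          rw [q1, q2] at q4
          linarith
        calc - c (U t) z ≤ |c (U t) z| := neg_le_abs _
          _ ≤ C * ‖ι (U t)‖ * √(d (U t) (U t)) * √(d z z) := h.convection_le _ _
          _ = C * ‖ι (U t)‖ * (√(d (U t) (U t)) * √(d z z)) := by ring
          _ ≤ C * M * ((r * d (U t) (U t) + r⁻¹ * d z z) / 2) := by gcongr
      linarith
    refine e2.trans ?_
    rw [intervalIntegral.integral_add ((ifn.norm.const_mul _).add (i1.const_mul _))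
      intervalIntegrable_const, intervalIntegral.integral_add (ifn.norm.const_mul _)
      (i1.const_mul _), intervalIntegral.integral_const_mul, intervalIntegral.integral_const_mul,
      intervalIntegral.integral_const, smul_eq_mul]
    have : (b - a) * ((C * M + 1) / 2 * r⁻¹ * d z z) ≤ 2 * ((C * M + 1) / 2 * r⁻¹ * d z z) := by
      gcongr
    linarith
  have e3 : inner ℝ (u b) v - inner ℝ (u b) (ι z) ≤ (r * d (U b) (U b) + r⁻¹ * d z z) / 2 := by
    have := hS v (U b)
    rw [hb, ← hz] at this
    rw [real_inner_comm, real_inner_comm _ (u b), ← this]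
    have := two_mul_form_le d h.form_symm h.form_nonneg hr (U b) z
    rw [h.form_symm (U b) z] at this
    linarith
  have e4 : (C * M + 2) * r⁻¹ * (2 * d z z) ≤ (C * M + 2) * r⁻¹ * (‖v‖ ^ 2 - ‖ι z‖ ^ 2) := by
    gcongr
  have p1 : 0 ≤ (C * M + 1) * r * ∫ τ in a..b, d (U τ) (U τ) := by
    have : 0 ≤ ∫ τ in a..b, d (U τ) (U τ) :=
      intervalIntegral.integral_nonneg hab fun _ _ => h.form_nonneg _
    positivity
  have p2 : 0 ≤ r * d (U b) (U b) := mul_nonneg hr.le (h.form_nonneg _)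
  have p3 : 0 ≤ (C * M) * r⁻¹ * d z z := by positivity
  have p4 : 0 ≤ r⁻¹ * d z z := by positivity
  nlinarith

variable [CompleteSpace H] [CompleteSpace V]

/-- If the form `d` is coercive modulo the norm of `H` and only vanishes at zero,
every dissipative solution tends to zero. With `R = (1 + A)⁻¹`, iterating the one-step comparison
along times `t k` gives, for `v = u (t (m + j))`, a bound of `‖v‖²` by `(R ^ j (u (t m)), v)` plus
errors. These are small if first `r`, then `m` is taken large, and then `R ^ j (u (t m)) → 0`. -/
theorem tendsto_norm_zero (h : IsDissipativeSolution ι d c C f u U) {K : ℝ} (hK0 : 0 < K)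
    (hK : ∀ v, ‖v‖ ^ 2 ≤ K * (‖ι v‖ ^ 2 + d v v)) (hdef : ∀ v, d v v = 0 → ι v = 0) :
    Tendsto (fun t => ‖u t‖) atTop (𝓝 0) := by
  obtain ⟨S, hS⟩ := exists_resolvent ι d hK0 hK
  obtain ⟨M, G, hM0, hG0, hGae, hGU, hM, hdI, hE⟩ := h.exists_energy_bound
  have hC := h.const_nonneg
  set R : H →L[ℝ] H := ι.comp S with hR
  have hRS : ∀ x, R x = ι (S x) := fun _ => rfl
  have hRpow : ∀ x, Tendsto (fun n : ℕ => (R ^ n) x) atTop (𝓝 0) := by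
    refine tendsto_pow_apply_zero R (fun x y => ?_) (fun x => ?_) fun x hx => ?_
    · rw [hRS, hRS, ← hS x (S y), real_inner_comm, ← hS y (S x), h.form_symm (S y),
        real_inner_comm]
    · rw [hRS, ← hS x (S x), real_inner_self_eq_norm_sq]
      linarith [h.form_nonneg (S x)]
    · have h1 := hS x (S x)
      rw [← hRS, hx] at h1
      rw [← hx, hRS]
      apply hdef; linarith
  -- times `t k` at which the dissipation is controlled by its integral over a unit interval
  have htime : ∀ k : ℕ, ∃ t ∈ Ioc ((k : ℝ) + 1) (k + 2), t ∈ G ∧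
      d (U t) (U t) ≤ ∫ τ in ((k : ℝ) + 1)..(k + 2), d (U τ) (U τ) := by
    intro k
    have hk : (0 : ℝ) ≤ k := k.cast_nonneg
    have hprob : IsProbabilityMeasure (volume.restrict (Ioc ((k : ℝ) + 1) (k + 2))) := by
      constructor
      rw [Measure.restrict_apply_univ, Real.volume_Ioc]; norm_num
    have h1 : ∀ᵐ t ∂volume.restrict (Ioc ((k : ℝ) + 1) (k + 2)),
        t ∈ G ∧ t ∈ Ioc ((k : ℝ) + 1) (k + 2) :=
      (ae_restrict_of_ae_restrict_of_subset (fun x hx => by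
        have := hx.1
        exact (by linarith : (0 : ℝ) ≤ x)) hGae).and (ae_restrict_mem measurableSet_Ioc)
    obtain ⟨t, ht, htd⟩ := exists_notMem_null_le_integral
      (hdI.mono_set (fun x hx => by
        have := hx.1
        exact (by linarith : (1 : ℝ) < x))) (ae_iff.1 h1)
    rw [mem_ofPred_eq, not_not] at ht
    refine ⟨t, ht.2, ht.1, htd.trans_eq ?_⟩
    rw [intervalIntegral.integral_of_le (by linarith)]
  choose t htI htG htd using htime
  have ht1 : ∀ k, 1 < t k := fun k => by
    have := (htI k).1; have := k.cast_nonneg (α := ℝ); linarith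
  have htk : ∀ k, t k ≤ t (k + 1) := fun k => by
    have h1 := (htI k).2; have h2 := (htI (k + 1)).1; push_cast at h2; linarith
  have htk2 : ∀ k, t (k + 1) - t k ≤ 2 := fun k => by
    have h1 := (htI k).1; have h2 := (htI (k + 1)).2; push_cast at h2; linarith
  have hdII : ∀ a b : ℝ, 1 ≤ a → 1 ≤ b → IntervalIntegrable (fun t => d (U t) (U t)) volume a b :=
    fun a b ha hb => ⟨hdI.mono_set fun x hx => ha.trans_lt hx.1,
      hdI.mono_set fun x hx => hb.trans_lt hx.1⟩
  -- `j` steps of the comparison; the dissipation of the scheme has telescoped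
  have hcmp : ∀ r, 0 < r → ∀ (m j : ℕ) (v : H),
      inner ℝ (u (t (m + j))) v + (C * M + 2) * r⁻¹ * ‖(R ^ j) v‖ ^ 2
        ≤ inner ℝ (u (t m)) ((R ^ j) v) + ‖v‖ * (∫ τ in (t m)..(t (m + j)), ‖f τ‖)
        + (C * M + 1) * r * (∫ τ in (t m)..(t (m + j)), d (U τ) (U τ))
        + r * (∫ τ in ((m : ℝ) + 2)..(m + j + 2), d (U τ) (U τ))
        + (C * M + 2) * r⁻¹ * ‖v‖ ^ 2 := by
    intro r hr m j
    induction j with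
    | zero => intro v; simp
    | succ j ih =>
      intro v
      have h0 : ∀ k, 0 ≤ t k := fun k => by linarith [ht1 k]
      have h1 := ih (R v)
      have h2 := h.inner_le_inner_resolvent_add hS hM (h0 (m + j)) (htk _) (htk2 _)
        (hGU _ (htG (m + j + 1))) hr v
      have h3 := htd (m + j + 1)
      have hRj : (R ^ j) (R v) = (R ^ (j + 1)) v := by rw [pow_succ]; rfl
      rw [← hRS] at h2
      rw [hRj] at h1
      have hRv : ‖R v‖ ≤ ‖v‖ := by
        have q := hS v (S v)
        rw [← hRS, real_inner_self_eq_norm_sq] at q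
        have := sq_nonneg ‖v - R v‖
        rw [norm_sub_sq_real] at this
        have := h.form_nonneg (S v)
        apply le_of_sq_le_sq _ (norm_nonneg v)
        linarith
      have htmj : t m ≤ t (m + j) := monotone_nat_of_le_succ htk (Nat.le_add_right m j)
      have f1 := intervalIntegral.integral_add_adjacent_intervals
        (h.intervalIntegrable_force (h0 m) (h0 (m + j))).norm
        (h.intervalIntegrable_force (h0 (m + j)) (h0 (m + j + 1))).norm
      have f2 := intervalIntegral.integral_add_adjacent_intervals
        (hdII _ _ (ht1 m).le (ht1 (m + j)).le) (hdII _ _ (ht1 (m + j)).le (ht1 (m + j + 1)).le)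
      have f3 := intervalIntegral.integral_add_adjacent_intervals
        (hdII ((m : ℝ) + 2) (m + j + 2) (by linarith [m.cast_nonneg (α := ℝ)])
          (by linarith [m.cast_nonneg (α := ℝ), j.cast_nonneg (α := ℝ)]))
        (hdII (m + j + 2) (m + j + 3) (by linarith [m.cast_nonneg (α := ℝ), j.cast_nonneg (α := ℝ)])
          (by linarith [m.cast_nonneg (α := ℝ), j.cast_nonneg (α := ℝ)]))
      have f4 : ‖R v‖ * (∫ τ in (t m)..(t (m + j)), ‖f τ‖)
          ≤ ‖v‖ * ∫ τ in (t m)..(t (m + j)), ‖f τ‖ := by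
        have : 0 ≤ ∫ τ in (t m)..(t (m + j)), ‖f τ‖ :=
          intervalIntegral.integral_nonneg htmj fun _ _ => norm_nonneg _
        gcongr
      simp only [Nat.cast_add, Nat.cast_one] at h3 ⊢
      rw [show (m : ℝ) + j + 1 + 1 = m + j + 2 by ring,
        show (m : ℝ) + j + 1 + 2 = m + j + 3 by ring] at h3
      rw [show (m : ℝ) + (j + 1) + 2 = m + j + 3 by ring, ← add_assoc m j 1, ← f1, ← f2, ← f3]
      have h3' := mul_le_mul_of_nonneg_left h3 hr.le
      linarith
  have htails : ∀ a b : ℝ, 1 ≤ a → a ≤ b → ∀ s ≤ a, 1 ≤ s →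
      ∫ τ in a..b, d (U τ) (U τ) ≤ ∫ τ in Ioi s, d (U τ) (U τ) := by
    intro a b ha hab s hs hs1
    rw [intervalIntegral.integral_of_le hab]
    exact setIntegral_mono_set (hdI.mono_set (Ioi_subset_Ioi hs1))
      (Eventually.of_forall fun _ => h.form_nonneg _)
      (Ioc_subset_Ioi_self.trans (Ioi_subset_Ioi hs)).eventuallyLE
  have hD := (tendsto_setIntegral_Ioi_zero hdI).comp (tendsto_atTop_add_const_right _ (1 : ℝ)
    (tendsto_natCast_atTop_atTop (R := ℝ)))
  have htt : Tendsto t atTop atTop := by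
    refine tendsto_atTop_mono (fun k => ?_) (tendsto_natCast_atTop_atTop (R := ℝ))
    linarith [(htI k).1]
  have hF := (tendsto_setIntegral_Ioi_zero
    (h.integrableOn_norm_force.mono_set Ioi_subset_Ici_self)).comp htt
  -- smallness at one of the times `t n`, together with a small remaining force
  have hsmall : ∀ ε > 0, ∃ n, ‖u (t n)‖ ^ 2 ≤ ε ∧ M * ∫ τ in Ioi (t n), ‖f τ‖ ≤ ε := by
    intro ε hε
    -- `r` makes the dissipation of the scheme, `m` that of the solution and the force, and
    -- `j` the remaining inner product at most `ε / 4`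
    set r : ℝ := 4 * (C * M + 2) * M ^ 2 / ε + 1 with hrd
    have hr : 0 < r := by positivity
    have hr2 : (C * M + 2) * r⁻¹ * M ^ 2 ≤ ε / 4 := by
      rw [mul_right_comm, ← div_eq_mul_inv, div_le_iff₀ hr, hrd]
      have : ε / 4 * (4 * (C * M + 2) * M ^ 2 / ε + 1) = (C * M + 2) * M ^ 2 + ε / 4 := by
        field_simp
      linarith
    have hev1 : ∀ᶠ m : ℕ in atTop, (C * M + 2) * r * ∫ τ in Ioi ((m : ℝ) + 1), d (U τ) (U τ)
        < ε / 4 := by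
      have := hD.const_mul ((C * M + 2) * r)
      rw [mul_zero] at this
      exact this.eventually (gt_mem_nhds (by positivity))
    have hev2 : ∀ᶠ m : ℕ in atTop, M * ∫ τ in Ioi (t m), ‖f τ‖ < ε / 4 := by
      have := hF.const_mul M
      rw [mul_zero] at this
      exact this.eventually (gt_mem_nhds (by positivity))
    obtain ⟨m, hm1, hm2⟩ := (hev1.and hev2).exists
    have hev3 : ∀ᶠ j : ℕ in atTop, M * ‖(R ^ j) (u (t m))‖ < ε / 4 := by
      have := ((hRpow (u (t m))).norm).const_mul M
      rw [norm_zero, mul_zero] at this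
      exact this.eventually (gt_mem_nhds (by positivity))
    obtain ⟨j, hj⟩ := hev3.exists
    have hmj : t m ≤ t (m + j) := monotone_nat_of_le_succ htk (Nat.le_add_right m j)
    have h0 : ∀ k, 0 ≤ t k := fun k => by linarith [ht1 k]
    have hfm := h.integral_norm_force_le (h0 m) hmj
    refine ⟨m + j, ?_, ?_⟩
    · have hsymm : inner ℝ (u (t m)) ((R ^ j) (u (t (m + j))))
          ≤ M * ‖(R ^ j) (u (t m))‖ := by
        have hs : ∀ (n : ℕ) x y, inner ℝ ((R ^ n) x) y = inner ℝ x ((R ^ n) y) := by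
          intro n
          induction n with
          | zero => simp
          | succ n ih =>
            intro x y
            have e1 : (R ^ (n + 1)) x = (R ^ n) (R x) := by rw [pow_succ]; rfl
            have e2 : (R ^ (n + 1)) y = R ((R ^ n) y) := by rw [pow_succ']; rfl
            rw [e1, e2, ih, hRS, hRS, ← hS x, real_inner_comm, ← hS _ (S x), h.form_symm (S x),
              real_inner_comm]
        rw [← hs, mul_comm]
        refine (real_inner_le_norm _ _).trans ?_
        gcongr
        exact hM _ (h0 _)
      have hc := hcmp r hr m j (u (t (m + j)))
      rw [real_inner_self_eq_norm_sq] at hc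
      have q1 : ‖u (t (m + j))‖ ≤ M := hM _ (h0 _)
      have q2 : ‖u (t (m + j))‖ * ∫ τ in (t m)..(t (m + j)), ‖f τ‖
          ≤ M * ∫ τ in Ioi (t m), ‖f τ‖ := by
        have : 0 ≤ ∫ τ in (t m)..(t (m + j)), ‖f τ‖ :=
          intervalIntegral.integral_nonneg hmj fun _ _ => norm_nonneg _
        gcongr
      have q3 := htails (t m) (t (m + j)) (ht1 m).le hmj (m + 1) (htI m).1.le
        (by linarith [m.cast_nonneg (α := ℝ)])
      have q4 := htails (m + 2) (m + j + 2) (by linarith [m.cast_nonneg (α := ℝ)])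
        (by linarith [j.cast_nonneg (α := ℝ)]) (m + 1) (by linarith)
        (by linarith [m.cast_nonneg (α := ℝ)])
      have q5 : (C * M + 1) * r * (∫ τ in (t m)..(t (m + j)), d (U τ) (U τ))
          ≤ (C * M + 1) * r * ∫ τ in Ioi ((m : ℝ) + 1), d (U τ) (U τ) := by gcongr
      have q6 : r * (∫ τ in ((m : ℝ) + 2)..(m + j + 2), d (U τ) (U τ))
          ≤ r * ∫ τ in Ioi ((m : ℝ) + 1), d (U τ) (U τ) := by gcongr
      have q7 : (C * M + 2) * r⁻¹ * ‖u (t (m + j))‖ ^ 2 ≤ (C * M + 2) * r⁻¹ * M ^ 2 := by gcongr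
      have q8 : 0 ≤ (C * M + 2) * r⁻¹ * ‖(R ^ j) (u (t (m + j)))‖ ^ 2 := by positivity
      linarith
    · have : ∫ τ in Ioi (t (m + j)), ‖f τ‖ ≤ ∫ τ in Ioi (t m), ‖f τ‖ :=
        setIntegral_mono_set (h.integrableOn_norm_force.mono_set fun x hx => (h0 m).trans hx.le)
          (Eventually.of_forall fun _ => norm_nonneg _) (Ioi_subset_Ioi hmj).eventuallyLE
      have := mul_le_mul_of_nonneg_left this hM0
      linarith
  rw [Metric.tendsto_atTop]
  intro ε hε
  obtain ⟨n, hn1, hn2⟩ := hsmall (ε ^ 2 / 4) (by positivity)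
  refine ⟨t n + 1, fun s hs => ?_⟩
  have h1 := hE (t n) (htG n) s (by linarith)
  rw [dist_zero_right, norm_norm]
  refine lt_of_pow_lt_pow_left₀ 2 hε.le ?_
  nlinarith

end IsDissipativeSolution
end Decay

/-! ### Weak derivatives and mollification on the plane -/

/-- The `i`-th coordinate vector of the plane. -/
noncomputable abbrev coordVec (i : Fin 2) : Plane := EuclideanSpace.single i 1

theorem eq_add_coordVec (v : Plane) : v = v 0 • coordVec 0 + v 1 • coordVec 1 := by
  ext i; fin_cases i <;> simp

section Mollification

variable {F : Type*} [NormedAddCommGroup F] [NormedSpace ℝ F]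

/-- `G i` is the weak partial derivative `∂ᵢ g` on the plane, for `i = 0, 1`. -/
def HasWeakGrad (g : Plane → F) (G : Fin 2 → Plane → F) : Prop :=
  ∀ i : Fin 2, ∀ ψ : Plane → ℝ, ContDiff ℝ ∞ ψ → HasCompactSupport ψ →
    ∫ x, (fderiv ℝ ψ x (coordVec i)) • g x = - ∫ x, ψ x • G i x

/-- The convolution of `g` with the normalised bump function `ρ`. -/
noncomputable def mollify (ρ : ContDiffBump (0 : Plane)) (g : Plane → F) : Plane → F :=
  convolution (ρ.normed volume) g (ContinuousLinearMap.lsmul ℝ ℝ) volume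

theorem contDiff_mollify (ρ : ContDiffBump (0 : Plane)) {g : Plane → F}
    (hg : LocallyIntegrable g volume) : ContDiff ℝ ∞ (mollify ρ g) :=
  ρ.hasCompactSupport_normed.contDiff_convolution_left _ ρ.contDiff_normed hg

theorem fderiv_mollify_apply [CompleteSpace F] (ρ : ContDiffBump (0 : Plane)) {g : Plane → F}
    {G : Fin 2 → Plane → F} (hgG : HasWeakGrad g G) (hg : LocallyIntegrable g volume) (i : Fin 2)
    (x : Plane) : fderiv ℝ (mollify ρ g) x (coordVec i) = mollify ρ (G i) x := by
  have hρc : ContDiff ℝ ∞ (ρ.normed (volume : Measure Plane)) := ρ.contDiff_normed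
  have hρ1 : ContDiff ℝ 1 (ρ.normed (volume : Measure Plane)) := ρ.contDiff_normed
  have hρs := ρ.hasCompactSupport_normed (μ := (volume : Measure Plane))
  have h1 := (hρs.hasFDerivAt_convolution_left (ContinuousLinearMap.lsmul ℝ ℝ : ℝ →L[ℝ] F →L[ℝ] F)
    hρ1 hg x).fderiv
  rw [mollify, h1, convolution_eq_swap]
  have hex : Integrable (fun t => (ContinuousLinearMap.precompL Plane
      (ContinuousLinearMap.lsmul ℝ ℝ : ℝ →L[ℝ] F →L[ℝ] F))
      (fderiv ℝ (ρ.normed volume) (x - t)) (g t)) volume :=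
    ((hρs.fderiv ℝ).convolutionExists_left (ContinuousLinearMap.precompL Plane
      (ContinuousLinearMap.lsmul ℝ ℝ : ℝ →L[ℝ] F →L[ℝ] F)) (hρ1.continuous_fderiv (by norm_num)) hg
      x).integrable_swap
  rw [ContinuousLinearMap.integral_apply hex]
  set ψ : Plane → ℝ := fun t => ρ.normed volume (x - t) with hψ
  have hψc : ContDiff ℝ ∞ ψ := hρc.comp (contDiff_const.sub contDiff_id)
  have hψs : HasCompactSupport ψ := hρs.comp_homeomorph (Homeomorph.subLeft x)
  have h2 := hgG i ψ hψc hψs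
  have h3 : ∀ t, fderiv ℝ ψ t (coordVec i) = - fderiv ℝ (ρ.normed volume) (x - t) (coordVec i) := by
    intro t
    have hd : HasFDerivAt (ρ.normed (volume : Measure Plane))
        (fderiv ℝ (ρ.normed volume) (x - t)) (x - t) :=
      (hρ1.differentiable (by norm_num) _).hasFDerivAt
    have := (hd.comp t ((hasFDerivAt_const x t).sub (hasFDerivAt_id t))).fderiv
    change fderiv ℝ ψ t = _ at this
    rw [this]
    simp
  simp only [h3, neg_smul, integral_neg, neg_inj] at h2
  simp only [ContinuousLinearMap.precompL_apply, ContinuousLinearMap.lsmul_apply]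
  rw [h2, mollify, convolution_eq_swap]
  rfl

/-- Jensen's inequality for the average which defines the mollification. -/
theorem enorm_mollify_sub_sq_le [CompleteSpace F] (ρ : ContDiffBump (0 : Plane)) {g : Plane → F}
    (hg : LocallyIntegrable g volume) (x : Plane) :
    ‖mollify ρ g x - g x‖ₑ ^ (2 : ℝ) ≤
      ∫⁻ t, ENNReal.ofReal (ρ.normed volume t) * ‖g (x - t) - g x‖ₑ ^ (2 : ℝ) := by
  have hρs := ρ.hasCompactSupport_normed (μ := (volume : Measure Plane))
  have hρc : Continuous (ρ.normed (volume : Measure Plane)) := ρ.continuous_normed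
  have hi1 : Integrable (fun t => ρ.normed volume t • g (x - t)) volume :=
    (hρs.convolutionExists_left (ContinuousLinearMap.lsmul ℝ ℝ : ℝ →L[ℝ] F →L[ℝ] F) hρc hg x)
  have hi2 : Integrable (fun t => ρ.normed volume t • g x) volume :=
    (hρc.integrable_of_hasCompactSupport hρs).smul_const _
  have e1 : mollify ρ g x - g x = ∫ t, ρ.normed volume t • (g (x - t) - g x) := by
    simp only [smul_sub]
    rw [integral_sub hi1 hi2, integral_smul_const, ρ.integral_normed, one_smul]
    rfl
  have hone : ∫⁻ t, ENNReal.ofReal (ρ.normed volume t) = 1 := by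
    rw [← ofReal_integral_eq_lintegral_ofReal (hρc.integrable_of_hasCompactSupport hρs)
      (Eventually.of_forall fun t => ρ.nonneg_normed t), ρ.integral_normed, ENNReal.ofReal_one]
  have hm : AEMeasurable (fun t => ‖g (x - t) - g x‖ₑ) volume := by
    have hq := (Measure.measurePreserving_sub_left (volume : Measure Plane) x).quasiMeasurePreserving
    exact ((hg.aestronglyMeasurable.comp_quasiMeasurePreserving hq).sub
      aestronglyMeasurable_const).enorm
  have hρm : AEMeasurable (fun t => ENNReal.ofReal (ρ.normed (volume : Measure Plane) t)) volume :=
    hρc.measurable.ennreal_ofReal.aemeasurable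
  calc ‖mollify ρ g x - g x‖ₑ ^ (2 : ℝ)
      ≤ (∫⁻ t, ENNReal.ofReal (ρ.normed volume t) * ‖g (x - t) - g x‖ₑ) ^ (2 : ℝ) := by
        gcongr
        rw [e1]
        refine (enorm_integral_le_lintegral_enorm _).trans_eq ?_
        congr with t
        rw [enorm_smul, Real.enorm_eq_ofReal (ρ.nonneg_normed t)]
    _ = (∫⁻ t, ENNReal.ofReal (ρ.normed volume t) ^ (1 / 2 : ℝ) *
          (ENNReal.ofReal (ρ.normed volume t) * ‖g (x - t) - g x‖ₑ ^ (2 : ℝ)) ^ (1 / 2 : ℝ))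
          ^ (2 : ℝ) := by
        congr with t
        rw [ENNReal.mul_rpow_of_nonneg _ _ (by norm_num), ← mul_assoc,
          ← ENNReal.rpow_add_of_nonneg _ _ (by norm_num) (by norm_num), ← ENNReal.rpow_mul]
        norm_num
    _ ≤ ((∫⁻ t, ENNReal.ofReal (ρ.normed volume t)) ^ (1 / 2 : ℝ) *
          (∫⁻ t, ENNReal.ofReal (ρ.normed volume t) * ‖g (x - t) - g x‖ₑ ^ (2 : ℝ)) ^ (1 / 2 : ℝ))
          ^ (2 : ℝ) := by
        gcongr
        exact ENNReal.lintegral_mul_norm_pow_le hρm (hρm.mul (hm.pow_const _)) (by norm_num)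
          (by norm_num) (by norm_num)
    _ = _ := by
        rw [hone, ENNReal.one_rpow, one_mul, ← ENNReal.rpow_mul]
        norm_num

/-- Mollification converges in `L²` as the radius of the bump function tends to zero. -/
theorem exists_eLpNorm_mollify_sub_le [CompleteSpace F] {g : Plane → F} (hg : MemLp g 2 volume)
    {ε : ℝ≥0∞} (hε : 0 < ε) : ∃ δ > 0, ∀ ρ : ContDiffBump (0 : Plane), ρ.rOut < δ →
      eLpNorm (mollify ρ g - g) 2 volume ≤ ε := by
  have : Fact ((1 : ℝ≥0∞) ≤ 2) := ⟨by norm_num⟩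
  have hgl : LocallyIntegrable g volume := hg.locallyIntegrable (by norm_num)
  have ht := tendsto_eLpNorm_translate_sub (μ := (volume : Measure Plane)) (p := 2) (by norm_num) hg
  obtain ⟨δ, hδ, hδ'⟩ := Metric.eventually_nhds_iff.1 (ht.eventually (gt_mem_nhds hε))
  refine ⟨δ, hδ, fun ρ hρ => ?_⟩
  have hρc : Continuous (ρ.normed (volume : Measure Plane)) := ρ.continuous_normed
  have hρs := ρ.hasCompactSupport_normed (μ := (volume : Measure Plane))
  have hone : ∫⁻ t, ENNReal.ofReal (ρ.normed volume t) = 1 := by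
    rw [← ofReal_integral_eq_lintegral_ofReal (hρc.integrable_of_hasCompactSupport hρs)
      (Eventually.of_forall fun t => ρ.nonneg_normed t), ρ.integral_normed, ENNReal.ofReal_one]
  have hmeas : AEMeasurable (Function.uncurry fun (x t : Plane) =>
      ENNReal.ofReal (ρ.normed volume t) * ‖g (x - t) - g x‖ₑ ^ (2 : ℝ))
      ((volume : Measure Plane).prod volume) := by
    have h1 : AEStronglyMeasurable (fun p : Plane × Plane => g (p.1 - p.2))
        ((volume : Measure Plane).prod volume) :=
      hg.1.comp_quasiMeasurePreserving (quasiMeasurePreserving_sub volume volume)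
    have h2 : AEStronglyMeasurable (fun p : Plane × Plane => g p.1)
        ((volume : Measure Plane).prod volume) := hg.1.comp_fst
    exact ((hρc.measurable.comp measurable_snd).ennreal_ofReal.aemeasurable).mul
      ((h1.sub h2).enorm.pow_const _)
  have key : ∫⁻ x, ‖mollify ρ g x - g x‖ₑ ^ (2 : ℝ) ≤ ε ^ (2 : ℝ) := by
    calc ∫⁻ x, ‖mollify ρ g x - g x‖ₑ ^ (2 : ℝ)
        ≤ ∫⁻ x, ∫⁻ t, ENNReal.ofReal (ρ.normed volume t) * ‖g (x - t) - g x‖ₑ ^ (2 : ℝ) :=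
          lintegral_mono fun x => enorm_mollify_sub_sq_le ρ hgl x
      _ = ∫⁻ t, ENNReal.ofReal (ρ.normed volume t) * ∫⁻ x, ‖g (x - t) - g x‖ₑ ^ (2 : ℝ) := by
          rw [lintegral_lintegral_swap hmeas]
          congr with t
          exact lintegral_const_mul' _ _ ENNReal.ofReal_ne_top
      _ ≤ ∫⁻ t, ENNReal.ofReal (ρ.normed volume t) * ε ^ (2 : ℝ) := by
          refine lintegral_mono fun t => ?_
          by_cases h0 : t ∈ Metric.ball (0 : Plane) ρ.rOut
          · gcongr
            have h1 := hδ' (y := -t) (by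
              rw [dist_zero_right, norm_neg, ← dist_zero_right]
              exact (Metric.mem_ball.1 h0).trans hρ)
            rw [eLpNorm_eq_lintegral_rpow_enorm_toReal (by norm_num) (by norm_num)] at h1
            simp only [ENNReal.toReal_ofNat, ← sub_eq_add_neg] at h1
            have h2 := ENNReal.rpow_le_rpow h1.le (z := 2) (by norm_num)
            rw [← ENNReal.rpow_mul] at h2
            simpa using h2
          · rw [← ρ.support_normed_eq (μ := volume), Function.notMem_support] at h0
            simp [h0]
      _ = ε ^ (2 : ℝ) := by
          rw [lintegral_mul_const _ hρc.measurable.ennreal_ofReal, hone, one_mul]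
  rw [eLpNorm_eq_lintegral_rpow_enorm_toReal (by norm_num) (by norm_num)]
  simp only [ENNReal.toReal_ofNat, Pi.sub_apply]
  calc _ ≤ (ε ^ (2 : ℝ)) ^ (1 / 2 : ℝ) := by gcongr
    _ = ε := by rw [← ENNReal.rpow_mul]; norm_num

theorem memLp_mollify_of_sub [CompleteSpace F] {g : Plane → F} (hg : MemLp g 2 volume)
    {ρ : ContDiffBump (0 : Plane)} (h : eLpNorm (mollify ρ g - g) 2 volume < ⊤) :
    MemLp (mollify ρ g) 2 volume := by
  have h1 : MemLp (mollify ρ g - g) 2 volume :=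
    ⟨(contDiff_mollify ρ (hg.locallyIntegrable (by norm_num))).continuous.aestronglyMeasurable.sub
      hg.1, h⟩
  simpa using h1.add hg

end Mollification

/-! ### Cutoff functions and density of test functions in `H¹` -/

/-- A smooth cutoff function: one on the ball of radius `R`, zero outside the ball of radius
`2 * R`. -/
noncomputable def cutoff (R : ℝ) (x : Plane) : ℝ :=
  (⟨1, 2, one_pos, one_lt_two⟩ : ContDiffBump (0 : Plane)) (R⁻¹ • x)

theorem contDiff_cutoff (R : ℝ) : ContDiff ℝ ∞ (cutoff R) :=
  (ContDiffBump.contDiff _).comp (contDiff_const_smul _)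

theorem cutoff_nonneg (R : ℝ) (x : Plane) : 0 ≤ cutoff R x := ContDiffBump.nonneg _

theorem cutoff_le_one (R : ℝ) (x : Plane) : cutoff R x ≤ 1 := ContDiffBump.le_one _

theorem cutoff_eq_one {R : ℝ} (hR : 0 < R) {x : Plane} (hx : ‖x‖ ≤ R) : cutoff R x = 1 := by
  apply ContDiffBump.one_of_mem_closedBall
  rw [mem_closedBall_zero_iff, norm_smul, norm_inv, Real.norm_of_nonneg hR.le]
  rw [inv_mul_le_iff₀ hR]; simpa using hx

theorem cutoff_eq_zero {R : ℝ} (hR : 0 < R) {x : Plane} (hx : 2 * R ≤ ‖x‖) : cutoff R x = 0 := by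
  apply ContDiffBump.zero_of_le_dist
  rw [dist_zero_right, norm_smul, norm_inv, Real.norm_of_nonneg hR.le]
  rw [le_inv_mul_iff₀ hR]; simp only []; linarith

theorem hasCompactSupport_cutoff {R : ℝ} (hR : 0 < R) : HasCompactSupport (cutoff R) := by
  refine HasCompactSupport.of_support_subset_isCompact (isCompact_closedBall (0 : Plane) (2 * R))
    fun x hx => ?_
  rw [mem_closedBall_zero_iff]
  by_contra! h
  exact hx (cutoff_eq_zero hR h.le)

theorem exists_fderiv_cutoff_le : ∃ C, 0 ≤ C ∧ ∀ R, 0 < R → ∀ x, ‖fderiv ℝ (cutoff R) x‖ ≤ C / R := by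
  set θ : ContDiffBump (0 : Plane) := ⟨1, 2, one_pos, one_lt_two⟩ with hθ
  have hc : Continuous (fderiv ℝ θ) := θ.contDiff.continuous_fderiv (n := 1) (by norm_num)
  obtain ⟨C, hC⟩ := (θ.hasCompactSupport.fderiv ℝ).exists_bound_of_continuous hc
  refine ⟨C, (norm_nonneg _).trans (hC 0), fun R hR x => ?_⟩
  have h1 : HasFDerivAt (cutoff R) ((fderiv ℝ θ (R⁻¹ • x)).comp
      (R⁻¹ • ContinuousLinearMap.id ℝ Plane)) x := by
    have hd : HasFDerivAt θ (fderiv ℝ θ (R⁻¹ • x)) (R⁻¹ • x) :=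
      (θ.contDiff.differentiable (n := 1) (by norm_num) _).hasFDerivAt
    exact hd.comp x ((hasFDerivAt_id x).const_smul R⁻¹)
  rw [h1.fderiv, ContinuousLinearMap.comp_smul, norm_smul, norm_inv, Real.norm_of_nonneg hR.le,
    ContinuousLinearMap.comp_id, inv_mul_eq_div]
  gcongr
  exact hC _

section Approximation

variable {F : Type*} [NormedAddCommGroup F] [NormedSpace ℝ F]

theorem eLpNorm_cutoff_smul_sub_tendsto {g : Plane → F} (hg : MemLp g 2 volume) :
    Tendsto (fun R => eLpNorm (fun x => cutoff R x • g x - g x) 2 volume) atTop (𝓝 0) := by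
  rw [ENNReal.tendsto_atTop_zero]
  intro ε hε
  obtain ⟨k, hks, hk, hkc, hkm⟩ := hg.exists_hasCompactSupport_eLpNorm_sub_le (by norm_num)
    (ENNReal.half_pos hε.ne').ne'
  obtain ⟨R₀, hR₀⟩ := hks.isCompact.isBounded.exists_norm_le
  refine ⟨max R₀ 1, fun R hR => ?_⟩
  have hR0 : 0 < R := lt_of_lt_of_le one_pos ((le_max_right _ _).trans hR)
  have h1 : eLpNorm (fun x => cutoff R x • g x - g x) 2 volume ≤
      eLpNorm ((fun x => cutoff R x • (g - k) x) - (g - k)) 2 volume := by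
    refine le_of_eq (eLpNorm_congr_ae (Eventually.of_forall fun x => ?_))
    simp only [Pi.sub_apply]
    have : cutoff R x • k x = k x := by
      by_cases hx : x ∈ tsupport k
      · rw [cutoff_eq_one hR0 ((hR₀ x hx).trans ((le_max_left _ _).trans hR)), one_smul]
      · rw [image_eq_zero_of_notMem_tsupport hx, smul_zero]
    rw [smul_sub, this]; abel
  have hm : AEStronglyMeasurable (fun x => cutoff R x • (g - k) x) volume :=
    (contDiff_cutoff R).continuous.aestronglyMeasurable.smul (hg.1.sub hkm.1)
  have h2 : eLpNorm (fun x => cutoff R x • (g - k) x) 2 volume ≤ eLpNorm (g - k) 2 volume := by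
    refine eLpNorm_mono_ae (Eventually.of_forall fun x => ?_)
    rw [norm_smul, Real.norm_of_nonneg (cutoff_nonneg R x)]
    exact mul_le_of_le_one_left (norm_nonneg _) (cutoff_le_one R x)
  calc _ ≤ _ := h1
    _ ≤ eLpNorm (fun x => cutoff R x • (g - k) x) 2 volume + eLpNorm (g - k) 2 volume :=
        eLpNorm_sub_le hm (hg.1.sub hkm.1) (by norm_num)
    _ ≤ ε / 2 + ε / 2 := add_le_add (h2.trans hk) hk
    _ = ε := ENNReal.add_halves ε

/-- Smooth compactly supported functions are dense in `H¹` of the plane: mollify, then cut off. -/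
theorem HasWeakGrad.exists_contDiff_eLpNorm_sub_le [CompleteSpace F] {g : Plane → F}
    {G : Fin 2 → Plane → F} (hgG : HasWeakGrad g G) (hg : MemLp g 2 volume)
    (hG : ∀ i, MemLp (G i) 2 volume) {ε : ℝ≥0∞} (hε : ε ≠ 0) :
    ∃ w : Plane → F, ContDiff ℝ ∞ w ∧ HasCompactSupport w ∧ eLpNorm (w - g) 2 volume ≤ ε ∧
      ∀ i, eLpNorm ((fun x => fderiv ℝ w x (coordVec i)) - G i) 2 volume ≤ ε := by
  -- it suffices to work with a finite tolerance
  wlog hεt : ε ≠ ⊤ generalizing ε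
  · obtain ⟨w, h1, h2, h3, h4⟩ := this (ε := 1) one_ne_zero ENNReal.one_ne_top
    rw [ne_eq, not_not] at hεt
    exact ⟨w, h1, h2, by simp [hεt], by simp [hεt]⟩
  have hε3 : 0 < ε / 3 := ENNReal.div_pos hε (by norm_num)
  have hε3t : ε / 3 < ⊤ := ENNReal.div_lt_top hεt (by norm_num)
  obtain ⟨δ, hδ, hδ'⟩ := exists_eLpNorm_mollify_sub_le hg hε3
  choose δG hδG hδG' using fun i => exists_eLpNorm_mollify_sub_le (hG i) hε3
  set s := min δ (min (δG 0) (δG 1)) with hs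
  have hs0 : 0 < s := by simp [hs, hδ, hδG]
  set ρ : ContDiffBump (0 : Plane) := ⟨s / 4, s / 2, by positivity, by linarith⟩ with hρ
  have hρ1 : ρ.rOut < δ := by
    have : s ≤ δ := min_le_left _ _
    change s / 2 < δ; linarith
  have hρ2 : ∀ i, ρ.rOut < δG i := by
    intro i
    have h1 : s ≤ δG 0 := (min_le_right _ _).trans (min_le_left _ _)
    have h2 : s ≤ δG 1 := (min_le_right _ _).trans (min_le_right _ _)
    have : s ≤ δG i := by fin_cases i <;> assumption
    change s / 2 < δG i; linarith [hδG i]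
  set v := mollify ρ g with hv
  have hgl : LocallyIntegrable g volume := hg.locallyIntegrable (by norm_num)
  have hvc : ContDiff ℝ ∞ v := contDiff_mollify ρ hgl
  have hvd : ∀ i, (fun x => fderiv ℝ v x (coordVec i)) = mollify ρ (G i) := fun i => by
    ext x; exact fderiv_mollify_apply ρ hgG hgl i x
  have hvm : MemLp v 2 volume := memLp_mollify_of_sub hg ((hδ' ρ hρ1).trans_lt hε3t)
  have hvdm : ∀ i, MemLp (mollify ρ (G i)) 2 volume := fun i =>
    memLp_mollify_of_sub (hG i) ((hδG' i ρ (hρ2 i)).trans_lt hε3t)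
  obtain ⟨C, hC0, hC⟩ := exists_fderiv_cutoff_le
  have t1 := (eLpNorm_cutoff_smul_sub_tendsto hvm).eventually (ge_mem_nhds hε3)
  have t2 : ∀ i, ∀ᶠ R in atTop, eLpNorm (fun x => cutoff R x • mollify ρ (G i) x
      - mollify ρ (G i) x) 2 volume ≤ ε / 3 := fun i =>
    (eLpNorm_cutoff_smul_sub_tendsto (hvdm i)).eventually (ge_mem_nhds hε3)
  have t3 : ∀ᶠ R : ℝ in atTop, ENNReal.ofReal (C / R) * eLpNorm v 2 volume ≤ ε / 3 := by
    have h1 : Tendsto (fun R : ℝ => ENNReal.ofReal (C / R) * eLpNorm v 2 volume) atTop (𝓝 0) := by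
      have : Tendsto (fun R : ℝ => C / R) atTop (𝓝 0) := tendsto_const_nhds.div_atTop tendsto_id
      have := ENNReal.Tendsto.mul_const (b := eLpNorm v 2 volume) (ENNReal.tendsto_ofReal this)
        (Or.inr hvm.2.ne)
      simpa using this
    exact h1.eventually (ge_mem_nhds hε3)
  obtain ⟨R, ⟨⟨h1, h20⟩, h21⟩, h3, hR⟩ :=
    (((t1.and (t2 0)).and (t2 1)).and (t3.and (eventually_gt_atTop 0))).exists
  have h2 : ∀ i, eLpNorm (fun x => cutoff R x • mollify ρ (G i) x
      - mollify ρ (G i) x) 2 volume ≤ ε / 3 := fun i => by fin_cases i <;> assumption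
  have hcc := contDiff_cutoff R
  have h3ε : ε / 3 + ε / 3 + ε / 3 = ε := ENNReal.add_thirds ε
  refine ⟨fun x => cutoff R x • v x, hcc.smul hvc, (hasCompactSupport_cutoff hR).smul_right, ?_,
    fun i => ?_⟩
  · have e : (fun x => cutoff R x • v x) - g = (fun x => cutoff R x • v x - v x) + (v - g) := by
      ext x; simp
    rw [e]
    calc _ ≤ eLpNorm (fun x => cutoff R x • v x - v x) 2 volume + eLpNorm (v - g) 2 volume :=
          eLpNorm_add_le ((hcc.continuous.smul hvc.continuous).sub
            hvc.continuous).aestronglyMeasurable (hvm.1.sub hg.1) (by norm_num)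
      _ ≤ ε / 3 + ε / 3 := add_le_add h1 (hδ' ρ hρ1)
      _ ≤ ε / 3 + ε / 3 + ε / 3 := le_self_add
      _ = ε := h3ε
  · have e : (fun x => fderiv ℝ (fun x => cutoff R x • v x) x (coordVec i)) - G i
        = (fun x => cutoff R x • mollify ρ (G i) x - mollify ρ (G i) x)
          + (mollify ρ (G i) - G i) + fun x => fderiv ℝ (cutoff R) x (coordVec i) • v x := by
      ext x
      have hd := ((hcc.differentiable (by norm_num) x).hasFDerivAt.smul
        (hvc.differentiable (by norm_num) x).hasFDerivAt).fderiv
      change fderiv ℝ (fun x => cutoff R x • v x) x = _ at hd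
      simp only [Pi.sub_apply, Pi.add_apply, hd, ← hvd i]
      simp only [add_apply, smul_apply, ContinuousLinearMap.smulRight_apply]
      abel
    rw [e]
    have m1 : AEStronglyMeasurable (fun x => cutoff R x • mollify ρ (G i) x - mollify ρ (G i) x)
        volume := (hcc.continuous.aestronglyMeasurable.smul (hvdm i).1).sub (hvdm i).1
    have m2 : AEStronglyMeasurable (fun x => fderiv ℝ (cutoff R) x (coordVec i) • v x) volume :=
      (((hcc.continuous_fderiv (by norm_num)).clm_apply continuous_const).smul
        hvc.continuous).aestronglyMeasurable
    have b3 : eLpNorm (fun x => fderiv ℝ (cutoff R) x (coordVec i) • v x) 2 volume ≤ ε / 3 := by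
      refine le_trans ?_ h3
      refine eLpNorm_le_mul_eLpNorm_of_ae_le_mul (Eventually.of_forall fun x => ?_) 2
      rw [norm_smul]
      gcongr
      calc _ ≤ ‖fderiv ℝ (cutoff R) x‖ * ‖coordVec i‖ := ContinuousLinearMap.le_opNorm _ _
        _ ≤ C / R := by simpa using hC R hR x
    calc _ ≤ eLpNorm ((fun x => cutoff R x • mollify ρ (G i) x - mollify ρ (G i) x)
          + (mollify ρ (G i) - G i)) 2 volume
          + eLpNorm (fun x => fderiv ℝ (cutoff R) x (coordVec i) • v x) 2 volume :=
          eLpNorm_add_le (m1.add ((hvdm i).1.sub (hG i).1)) m2 (by norm_num)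
      _ ≤ (ε / 3 + ε / 3) + ε / 3 := by
          gcongr
          exact (eLpNorm_add_le m1 ((hvdm i).1.sub (hG i).1) (by norm_num)).trans
            (add_le_add (h2 i) (hδG' i ρ (hρ2 i)))
      _ = ε := h3ε

/-- Classical derivatives are weak derivatives. -/
theorem hasWeakGrad_of_contDiff {g : Plane → F} (hg : ContDiff ℝ 1 g) :
    HasWeakGrad g (fun i x => fderiv ℝ g x (coordVec i)) := by
  intro i ψ hψ hψs
  have hψ1 : ContDiff ℝ 1 ψ := hψ.of_le (by exact_mod_cast le_top)
  have c1 : Continuous fun x => fderiv ℝ ψ x (coordVec i) :=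
    (hψ1.continuous_fderiv (by norm_num)).clm_apply continuous_const
  have c2 : Continuous fun x => fderiv ℝ g x (coordVec i) :=
    (hg.continuous_fderiv (by norm_num)).clm_apply continuous_const
  have s1 : HasCompactSupport fun x => fderiv ℝ ψ x (coordVec i) := hψs.fderiv_apply ℝ _
  rw [integral_smul_fderiv_eq_neg_fderiv_smul_of_integrable
    ((c1.smul hg.continuous).integrable_of_hasCompactSupport s1.smul_right)
    ((hψ.continuous.smul c2).integrable_of_hasCompactSupport hψs.smul_right)
    ((hψ.continuous.smul hg.continuous).integrable_of_hasCompactSupport hψs.smul_right)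
    (fun x _ => hψ1.differentiable (by norm_num) x) (fun x _ => hg.differentiable (by norm_num) x),
    neg_neg]

end Approximation

/-! ### The weighted spaces `L²_b`, `H¹_b` and `V` -/

/-- `b` is a smooth bottom topography with values in `[bᵢ, bₛ]`, where `bᵢ > 0`. -/
structure IsDepth (b : Plane → ℝ) (bᵢ bₛ : ℝ) : Prop where
  contDiff : ContDiff ℝ ∞ b
  lower_pos : 0 < bᵢ
  lower_le : ∀ x, bᵢ ≤ b x
  le_upper : ∀ x, b x ≤ bₛ

namespace IsDepth

variable {b : Plane → ℝ} {bᵢ bₛ : ℝ}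

theorem pos (h : IsDepth b bᵢ bₛ) (x : Plane) : 0 < b x := h.lower_pos.trans_le (h.lower_le x)

theorem upper_pos (h : IsDepth b bᵢ bₛ) : 0 < bₛ := (h.pos 0).trans_le (h.le_upper 0)

theorem measurable (h : IsDepth b bᵢ bₛ) : Measurable b := h.contDiff.continuous.measurable

theorem depthMeasure_le (h : IsDepth b bᵢ bₛ) :
    depthMeasure b ≤ ENNReal.ofReal bₛ • (volume : Measure Plane) := by
  rw [depthMeasure, ← withDensity_const]
  exact withDensity_mono (Eventually.of_forall fun x => ENNReal.ofReal_le_ofReal (h.le_upper x))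

theorem volume_le (h : IsDepth b bᵢ bₛ) :
    (volume : Measure Plane) ≤ ENNReal.ofReal bᵢ⁻¹ • depthMeasure b := by
  have h1 : ENNReal.ofReal bᵢ • (volume : Measure Plane) ≤ depthMeasure b := by
    rw [depthMeasure, ← withDensity_const]
    exact withDensity_mono (Eventually.of_forall fun x => ENNReal.ofReal_le_ofReal (h.lower_le x))
  have h2 : (volume : Measure Plane) =
      ENNReal.ofReal bᵢ⁻¹ • ENNReal.ofReal bᵢ • (volume : Measure Plane) := by
    rw [smul_smul, ← ENNReal.ofReal_mul (inv_nonneg.2 h.lower_pos.le),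
      inv_mul_cancel₀ h.lower_pos.ne', ENNReal.ofReal_one, one_smul]
  rw [h2]
  intro s
  simp only [Measure.smul_apply, smul_eq_mul]
  gcongr
  have := h1 s
  simpa using this

theorem ae_iff (h : IsDepth b bᵢ bₛ) {p : Plane → Prop} :
    (∀ᵐ x ∂(depthMeasure b), p x) ↔ ∀ᵐ x, p x :=
  ⟨fun hp => (Measure.absolutelyContinuous_of_le_smul h.volume_le).ae_le hp,
    fun hp => (Measure.absolutelyContinuous_of_le_smul h.depthMeasure_le).ae_le hp⟩

theorem integral_depthMeasure {F : Type*} [NormedAddCommGroup F] [NormedSpace ℝ F]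
    (h : IsDepth b bᵢ bₛ) (g : Plane → F) :
    ∫ x, g x ∂(depthMeasure b) = ∫ x, b x • g x := by
  rw [depthMeasure, integral_withDensity_eq_integral_toReal_smul
    h.measurable.ennreal_ofReal (Eventually.of_forall fun _ => ENNReal.ofReal_lt_top)]
  congr with x
  rw [ENNReal.toReal_ofReal (h.pos x).le]

theorem memLp_iff {F : Type*} [NormedAddCommGroup F] (h : IsDepth b bᵢ bₛ)
    {p : ℝ≥0∞} {g : Plane → F} : MemLp g p (depthMeasure b) ↔ MemLp g p volume :=
  ⟨fun hg => hg.of_measure_le_smul ENNReal.ofReal_ne_top h.volume_le,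
    fun hg => hg.of_measure_le_smul ENNReal.ofReal_ne_top h.depthMeasure_le⟩

theorem eLpNorm_volume_le {F : Type*} [NormedAddCommGroup F] (h : IsDepth b bᵢ bₛ)
    {p : ℝ≥0∞} (hp : p ≠ ⊤) (g : Plane → F) :
    eLpNorm g p volume ≤ ENNReal.ofReal bᵢ⁻¹ ^ (1 / p).toReal * eLpNorm g p (depthMeasure b) := by
  refine (eLpNorm_mono_measure g h.volume_le).trans ?_
  rw [eLpNorm_smul_measure_of_ne_top hp, smul_eq_mul]

theorem eLpNorm_depthMeasure_le {F : Type*} [NormedAddCommGroup F] (h : IsDepth b bᵢ bₛ)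
    {p : ℝ≥0∞} (hp : p ≠ ⊤) (g : Plane → F) :
    eLpNorm g p (depthMeasure b) ≤ ENNReal.ofReal bₛ ^ (1 / p).toReal * eLpNorm g p volume := by
  refine (eLpNorm_mono_measure g h.depthMeasure_le).trans ?_
  rw [eLpNorm_smul_measure_of_ne_top hp, smul_eq_mul]

theorem isFiniteMeasureOnCompacts (h : IsDepth b bᵢ bₛ) :
    IsFiniteMeasureOnCompacts (depthMeasure b) := by
  constructor
  intro K hK
  refine (h.depthMeasure_le K).trans_lt ?_
  rw [Measure.smul_apply, smul_eq_mul]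
  exact ENNReal.mul_lt_top ENNReal.ofReal_lt_top hK.measure_lt_top

/-- A field in `L²_b`, regarded as an element of `L²` for Lebesgue measure. -/
noncomputable def toVolume (h : IsDepth b bᵢ bₛ) :
    L2b b →L[ℝ] Lp Plane 2 (volume : Measure Plane) :=
  LinearMap.mkContinuous
    { toFun := fun u => (h.memLp_iff.1 (Lp.memLp u)).toLp u
      map_add' := fun u v => by
        rw [← MemLp.toLp_add]
        exact MemLp.toLp_congr _ _ (h.ae_iff.1 (Lp.coeFn_add u v))
      map_smul' := fun c u => by
        rw [RingHom.id_apply, ← MemLp.toLp_const_smul]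
        exact MemLp.toLp_congr _ _ (h.ae_iff.1 (Lp.coeFn_smul c u)) }
    (ENNReal.ofReal bᵢ⁻¹ ^ (1 / 2 : ℝ≥0∞).toReal).toReal fun u => by
      have h1 := h.eLpNorm_volume_le (p := 2) (by norm_num) u
      change ‖(h.memLp_iff.1 (Lp.memLp u)).toLp u‖ ≤ _
      rw [Lp.norm_toLp, Lp.norm_def, ← ENNReal.toReal_mul]
      exact ENNReal.toReal_mono (ENNReal.mul_ne_top (by simp) (Lp.eLpNorm_ne_top u)) h1

theorem coeFn_toVolume (h : IsDepth b bᵢ bₛ) (u : L2b b) : h.toVolume u =ᵐ[volume] u :=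
  (h.memLp_iff.1 (Lp.memLp u)).coeFn_toLp

end IsDepth

section Sobolev

variable {b : Plane → ℝ} {bᵢ bₛ : ℝ}

/-- Pairing of an `L²_b` field with a continuous compactly supported function, with respect to
Lebesgue measure. -/
theorem IsDepth.exists_pairing (h : IsDepth b bᵢ bₛ) {φ : Plane → ℝ} (hφ : Continuous φ)
    (hφs : HasCompactSupport φ) :
    ∃ L : L2b b →L[ℝ] Plane, ∀ u, L u = ∫ x, φ x • u x := by
  have hm : MemLp φ 2 (volume : Measure Plane) := hφ.memLp_of_hasCompactSupport hφs
  refine ⟨((ContinuousLinearMap.lsmul ℝ ℝ : ℝ →L[ℝ] Plane →L[ℝ] Plane).lpPairing volume 2 2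
    (hm.toLp φ)).comp h.toVolume, fun u => ?_⟩
  rw [ContinuousLinearMap.comp_apply, ContinuousLinearMap.lpPairing_eq_integral]
  refine integral_congr_ae ?_
  filter_upwards [hm.coeFn_toLp, h.coeFn_toVolume u] with x h1 h2
  rw [h1, h2, ContinuousLinearMap.lsmul_apply]

/-- The distributional divergence of `b u`, tested with `ψ`, as a continuous functional of `u`. -/
theorem IsDepth.exists_divergence_pairing (h : IsDepth b bᵢ bₛ) {ψ : Plane → ℝ}
    (hψ : ContDiff ℝ ∞ ψ) (hψs : HasCompactSupport ψ) :
    ∃ L : L2b b →L[ℝ] ℝ, ∀ u, L u = ∫ x, fderiv ℝ ψ x (u x) ∂(depthMeasure b) := by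
  have := h.isFiniteMeasureOnCompacts
  have hm : MemLp (fderiv ℝ ψ) 2 (depthMeasure b) :=
    (hψ.continuous_fderiv (by norm_num)).memLp_of_hasCompactSupport (hψs.fderiv ℝ)
  refine ⟨(ContinuousLinearMap.id ℝ (Plane →L[ℝ] ℝ)).lpPairing (depthMeasure b) 2 2
    (hm.toLp _), fun u => ?_⟩
  rw [ContinuousLinearMap.lpPairing_eq_integral]
  refine integral_congr_ae ?_
  filter_upwards [hm.coeFn_toLp] with x h1
  rw [h1]; rfl

/-- The ambient Hilbert space of triples `(u, D 0, D 1)` of fields in `L²_b`. -/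
abbrev Jet (b : Plane → ℝ) : Type := PiLp 2 fun _ : Fin 3 => L2b b

/-- The space `H¹_b` of fields in `L²_b` with weak gradient in `L²_b`. It is encoded as the space
of triples `(u, ∂₀ u, ∂₁ u)`, with the norm of `L²_b × L²_b × L²_b`. -/
noncomputable def sobolev (h : IsDepth b bᵢ bₛ) : Submodule ℝ (Jet b) where
  carrier := {x | IsWeakGradient (x 0) fun i => x i.succ}
  add_mem' := fun {x y} hx hy i ψ hψ hψs => by
    obtain ⟨L, hL⟩ := h.exists_pairing hψ.continuous hψs
    obtain ⟨L', hL'⟩ := h.exists_pairing (φ := fun x => fderiv ℝ ψ x (coordVec i))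
      ((hψ.continuous_fderiv (by norm_num)).clm_apply continuous_const) (hψs.fderiv_apply ℝ _)
    have h1 := hx i ψ hψ hψs
    have h2 := hy i ψ hψ hψs
    rw [← hL, ← hL'] at h1 h2 ⊢
    simp only [PiLp.add_apply, map_add, h1, h2, neg_add]
  zero_mem' := fun i ψ hψ hψs => by
    obtain ⟨L, hL⟩ := h.exists_pairing hψ.continuous hψs
    obtain ⟨L', hL'⟩ := h.exists_pairing (φ := fun x => fderiv ℝ ψ x (coordVec i))
      ((hψ.continuous_fderiv (by norm_num)).clm_apply continuous_const) (hψs.fderiv_apply ℝ _)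
    rw [← hL, ← hL']
    simp
  smul_mem' := fun c x hx i ψ hψ hψs => by
    obtain ⟨L, hL⟩ := h.exists_pairing hψ.continuous hψs
    obtain ⟨L', hL'⟩ := h.exists_pairing (φ := fun x => fderiv ℝ ψ x (coordVec i))
      ((hψ.continuous_fderiv (by norm_num)).clm_apply continuous_const) (hψs.fderiv_apply ℝ _)
    have h1 := hx i ψ hψ hψs
    rw [← hL, ← hL'] at h1 ⊢
    simp only [PiLp.smul_apply, map_smul, h1, smul_neg]

theorem isClosed_sobolev (h : IsDepth b bᵢ bₛ) : IsClosed (sobolev h : Set (Jet b)) := by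
  have : (sobolev h : Set (Jet b)) = ⋂ (i : Fin 2) (ψ : Plane → ℝ) (_ : ContDiff ℝ ∞ ψ)
      (_ : HasCompactSupport ψ), {x : Jet b | ∫ t, (fderiv ℝ ψ t (coordVec i)) • (x 0) t
        = - ∫ t, ψ t • (x i.succ) t} := by
    ext x
    simp only [mem_iInter]
    rfl
  rw [this]
  refine isClosed_iInter fun i => isClosed_iInter fun ψ => isClosed_iInter fun hψ =>
    isClosed_iInter fun hψs => ?_
  obtain ⟨L, hL⟩ := h.exists_pairing hψ.continuous hψs
  obtain ⟨L', hL'⟩ := h.exists_pairing (φ := fun x => fderiv ℝ ψ x (coordVec i))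
    ((hψ.continuous_fderiv (by norm_num)).clm_apply continuous_const) (hψs.fderiv_apply ℝ _)
  simp only [← hL, ← hL']
  exact isClosed_eq (by fun_prop) (by fun_prop)

/-- The space `V` of solenoidal fields in `H¹_b`. -/
noncomputable def solSobolev (h : IsDepth b bᵢ bₛ) : Submodule ℝ (Jet b) where
  carrier := {x | x ∈ sobolev h ∧ IsSolenoidal b (x 0)}
  add_mem' := fun {x y} hx hy => by
    refine ⟨add_mem hx.1 hy.1, fun ψ hψ hψs => ?_⟩
    obtain ⟨L, hL⟩ := h.exists_divergence_pairing hψ hψs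
    have h1 := hx.2 ψ hψ hψs
    have h2 := hy.2 ψ hψ hψs
    rw [← hL] at h1 h2 ⊢
    simp [h1, h2]
  zero_mem' := by
    refine ⟨zero_mem _, fun ψ hψ hψs => ?_⟩
    obtain ⟨L, hL⟩ := h.exists_divergence_pairing hψ hψs
    rw [← hL]
    simp
  smul_mem' := fun c x hx => by
    refine ⟨Submodule.smul_mem _ c hx.1, fun ψ hψ hψs => ?_⟩
    obtain ⟨L, hL⟩ := h.exists_divergence_pairing hψ hψs
    have h1 := hx.2 ψ hψ hψs
    rw [← hL] at h1 ⊢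
    simp [h1]

theorem isClosed_solSobolev (h : IsDepth b bᵢ bₛ) : IsClosed (solSobolev h : Set (Jet b)) := by
  have : (solSobolev h : Set (Jet b)) = (sobolev h : Set (Jet b)) ∩ ⋂ (ψ : Plane → ℝ)
      (_ : ContDiff ℝ ∞ ψ) (_ : HasCompactSupport ψ),
      {x : Jet b | ∫ t, fderiv ℝ ψ t ((x 0) t) ∂(depthMeasure b) = 0} := by
    ext x
    simp only [mem_inter_iff, mem_iInter]
    rfl
  rw [this]
  refine (isClosed_sobolev h).inter (isClosed_iInter fun ψ => isClosed_iInter fun hψ =>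
    isClosed_iInter fun hψs => ?_)
  obtain ⟨L, hL⟩ := h.exists_divergence_pairing hψ hψs
  simp only [← hL]
  exact isClosed_eq (by fun_prop) (by fun_prop)

end Sobolev

/-! ### Ladyzhenskaya's inequality -/

section Ladyzhenskaya

instance holderTriple_four_four_two : ENNReal.HolderTriple 4 4 2 where
  inv_add_inv_eq_inv := by
    rw [← two_mul, show (4 : ℝ≥0∞) = 2 * 2 by norm_num,
      ENNReal.mul_inv (Or.inl two_ne_zero) (Or.inl ENNReal.ofNat_ne_top), ← mul_assoc,
      ENNReal.mul_inv_cancel two_ne_zero ENNReal.ofNat_ne_top, one_mul]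

/-- On the plane, the operator norm of a linear map is at most the sum of the norms of its
values on the coordinate vectors. -/
theorem opNorm_le_add_coordVec {F : Type*} [NormedAddCommGroup F] [NormedSpace ℝ F]
    (A : Plane →L[ℝ] F) : ‖A‖ ≤ ‖A (coordVec 0)‖ + ‖A (coordVec 1)‖ := by
  refine A.opNorm_le_bound (by positivity) fun x => ?_
  have h0 : ‖x 0‖ ≤ ‖x‖ := PiLp.norm_apply_le x 0
  have h1 : ‖x 1‖ ≤ ‖x‖ := PiLp.norm_apply_le x 1
  calc ‖A x‖ = ‖x 0 • A (coordVec 0) + x 1 • A (coordVec 1)‖ := by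
        conv_lhs => rw [eq_add_coordVec x]
        rw [map_add, map_smul, map_smul]
    _ ≤ ‖x 0‖ * ‖A (coordVec 0)‖ + ‖x 1‖ * ‖A (coordVec 1)‖ := by
        refine (norm_add_le _ _).trans ?_
        rw [norm_smul, norm_smul]
    _ ≤ ‖x‖ * ‖A (coordVec 0)‖ + ‖x‖ * ‖A (coordVec 1)‖ := by gcongr
    _ = _ := by ring

theorem eLpNorm_fderiv_le {F : Type*} [NormedAddCommGroup F] [NormedSpace ℝ F] {w : Plane → F}
    (hw : ContDiff ℝ 1 w) :
    eLpNorm (fderiv ℝ w) 2 volume ≤ ∑ i, eLpNorm (fun x => fderiv ℝ w x (coordVec i)) 2 volume := by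
  have hc : ∀ i : Fin 2, Continuous fun x => fderiv ℝ w x (coordVec i) := fun i =>
    (hw.continuous_fderiv (by norm_num)).clm_apply continuous_const
  rw [Fin.sum_univ_two]
  calc eLpNorm (fderiv ℝ w) 2 volume
      ≤ eLpNorm ((fun x => ‖fderiv ℝ w x (coordVec 0)‖) + fun x => ‖fderiv ℝ w x (coordVec 1)‖) 2
        volume := by
        refine eLpNorm_mono fun x => ?_
        rw [Pi.add_apply, Real.norm_of_nonneg (by positivity)]
        exact opNorm_le_add_coordVec _
    _ ≤ _ := eLpNorm_add_le (hc 0).norm.aestronglyMeasurable (hc 1).norm.aestronglyMeasurable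
        (by norm_num)
    _ = _ := by rw [eLpNorm_norm, eLpNorm_norm]

/-- Ladyzhenskaya's inequality for smooth fields: the Gagliardo–Nirenberg–Sobolev inequality
applied to `‖w‖ ^ 2`. -/
theorem exists_eLpNorm_four_sq_le_of_contDiff : ∃ C : ℝ≥0∞, C ≠ ⊤ ∧ ∀ w : Plane → Plane,
    ContDiff ℝ 1 w → HasCompactSupport w → eLpNorm w 4 volume ^ 2 ≤ C * (eLpNorm w 2 volume *
      ∑ i, eLpNorm (fun x => fderiv ℝ w x (coordVec i)) 2 volume) := by
  have hp : NNReal.HolderConjugate (Module.finrank ℝ Plane) 2 := by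
    have : Module.finrank ℝ Plane = 2 := by simp [Plane]
    rw [this]
    exact_mod_cast NNReal.HolderConjugate.two_two
  refine ⟨eLpNormLESNormFDerivOneConst (volume : Measure Plane) 2 * 2, by finiteness,
    fun w hw hws => ?_⟩
  have h1 := eLpNorm_le_eLpNorm_fderiv_one (volume : Measure Plane) (u := fun x => ‖w x‖ ^ 2)
    (hw.norm_sq ℝ) (hws.comp_left (g := fun v => ‖v‖ ^ 2) (by simp)) hp
  have h2 : eLpNorm (fun x => ‖w x‖ ^ 2) (2 : NNReal) volume = eLpNorm w 4 volume ^ 2 := by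
    have := eLpNorm_norm_rpow (p := 2) (μ := volume) w (q := 2) two_pos
    simp only [Real.rpow_ofNat, ENNReal.ofReal_ofNat, ENNReal.rpow_ofNat] at this
    norm_num at this
    simpa using this
  have h3 : eLpNorm (fderiv ℝ fun x => ‖w x‖ ^ 2) 1 volume
      ≤ 2 * eLpNorm w 2 volume * eLpNorm (fderiv ℝ w) 2 volume := by
    have e : (fderiv ℝ fun x => ‖w x‖ ^ 2) = fun x => 2 • (innerSL ℝ) (w x) ∘SL (fderiv ℝ w x) := by
      ext1 x
      exact ((hw.differentiable (by norm_num) x).hasFDerivAt.norm_sq).fderiv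
    rw [e]
    refine eLpNorm_le_eLpNorm_mul_eLpNorm_of_nnnorm hw.continuous.aestronglyMeasurable
      (hw.continuous_fderiv (by norm_num)).aestronglyMeasurable
      (fun v A => 2 • (innerSL ℝ) v ∘SL A) 2 (Eventually.of_forall fun x => ?_)
    rw [← NNReal.coe_le_coe]
    simp only [NNReal.coe_mul, coe_nnnorm, NNReal.coe_ofNat]
    rw [two_smul, ← two_smul ℝ, norm_smul, Real.norm_ofNat, mul_assoc]
    gcongr
    refine (ContinuousLinearMap.opNorm_comp_le _ _).trans_eq ?_
    rw [innerSL_apply_norm]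
  rw [h2] at h1
  calc _ ≤ _ := h1
    _ ≤ eLpNormLESNormFDerivOneConst (volume : Measure Plane) 2 * (2 * eLpNorm w 2 volume *
        ∑ i, eLpNorm (fun x => fderiv ℝ w x (coordVec i)) 2 volume) := by
        refine mul_le_mul_right (h3.trans ?_) _
        gcongr
        exact eLpNorm_fderiv_le hw
    _ = _ := by ring

/-- Ladyzhenskaya's inequality `‖g‖₄² ≤ C ‖g‖₂ ‖∇g‖₂` on the plane. -/
theorem exists_eLpNorm_four_sq_le : ∃ C : ℝ≥0∞, C ≠ ⊤ ∧ ∀ (g : Plane → Plane)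
    (G : Fin 2 → Plane → Plane), HasWeakGrad g G → MemLp g 2 volume → (∀ i, MemLp (G i) 2 volume) →
    eLpNorm g 4 volume ^ 2 ≤ C * (eLpNorm g 2 volume * ∑ i, eLpNorm (G i) 2 volume) := by
  obtain ⟨C, hC, hw⟩ := exists_eLpNorm_four_sq_le_of_contDiff
  refine ⟨C, hC, fun g G hgG hg hG => ?_⟩
  have hε : ∀ n : ℕ, ((n : ℝ≥0∞) + 1)⁻¹ ≠ 0 := fun n => by simp
  choose w hwc hws hw1 hw2 using fun n : ℕ => hgG.exists_contDiff_eLpNorm_sub_le hg hG (hε n)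
  have ht : Tendsto (fun n : ℕ => ((n : ℝ≥0∞) + 1)⁻¹) atTop (𝓝 0) := by
    have := ENNReal.tendsto_inv_nat_nhds_zero.comp (tendsto_add_atTop_nat 1)
    refine this.congr fun n => by simp
  have hwm : ∀ n, AEStronglyMeasurable (w n) volume := fun n =>
    (hwc n).continuous.aestronglyMeasurable
  have hdm : ∀ n i, AEStronglyMeasurable (fun x => fderiv ℝ (w n) x (coordVec i)) volume := fun n i =>
    (((hwc n).continuous_fderiv (by norm_num)).clm_apply continuous_const).aestronglyMeasurable
  have hL2 : Tendsto (fun n => eLpNorm (w n - g) 2 volume) atTop (𝓝 0) :=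
    tendsto_of_tendsto_of_tendsto_of_le_of_le tendsto_const_nhds ht (fun _ => zero_le) hw1
  obtain ⟨ns, hns, hae⟩ := (tendstoInMeasure_of_tendsto_eLpNorm (by norm_num) hwm hg.1
    hL2).exists_seq_tendsto_ae
  have hF := Lp.eLpNorm_lim_le_liminf_eLpNorm (p := 4) (fun n => hwm (ns n)) g hae
  -- an upper bound for the approximating sequence, convergent to the right-hand side
  have hub : ∀ n, eLpNorm (w (ns n)) 4 volume ≤ (C * ((eLpNorm g 2 volume + ((ns n : ℝ≥0∞) + 1)⁻¹) *
      ∑ i, (eLpNorm (G i) 2 volume + ((ns n : ℝ≥0∞) + 1)⁻¹))) ^ (1 / 2 : ℝ) := by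
    intro n
    have h1 : eLpNorm (w (ns n)) 2 volume ≤ eLpNorm g 2 volume + ((ns n : ℝ≥0∞) + 1)⁻¹ := by
      have := eLpNorm_add_le hg.1 ((hwm (ns n)).sub hg.1) (p := 2) (by norm_num)
      rw [add_sub_cancel] at this
      exact this.trans (by gcongr; exact hw1 _)
    have h2 : ∀ i, eLpNorm (fun x => fderiv ℝ (w (ns n)) x (coordVec i)) 2 volume
        ≤ eLpNorm (G i) 2 volume + ((ns n : ℝ≥0∞) + 1)⁻¹ := by
      intro i
      have := eLpNorm_add_le (hG i).1 ((hdm (ns n) i).sub (hG i).1) (p := 2) (by norm_num)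
      rw [add_sub_cancel] at this
      exact this.trans (by gcongr; exact hw2 _ i)
    have h3 := hw (w (ns n)) ((hwc _).of_le (by exact_mod_cast le_top)) (hws _)
    calc eLpNorm (w (ns n)) 4 volume = (eLpNorm (w (ns n)) 4 volume ^ 2) ^ (1 / 2 : ℝ) := by
          rw [← ENNReal.rpow_natCast, ← ENNReal.rpow_mul]; norm_num
      _ ≤ _ := by
          gcongr
          refine h3.trans ?_
          gcongr with i
          exact h2 i
  have hlim : Tendsto (fun n => (C * ((eLpNorm g 2 volume + ((ns n : ℝ≥0∞) + 1)⁻¹) *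
      ∑ i, (eLpNorm (G i) 2 volume + ((ns n : ℝ≥0∞) + 1)⁻¹))) ^ (1 / 2 : ℝ)) atTop
      (𝓝 ((C * (eLpNorm g 2 volume * ∑ i, eLpNorm (G i) 2 volume)) ^ (1 / 2 : ℝ))) := by
    have ht' : Tendsto (fun n => ((ns n : ℝ≥0∞) + 1)⁻¹) atTop (𝓝 0) := ht.comp hns.tendsto_atTop
    have hf1 : eLpNorm g 2 volume ≠ ⊤ := hg.2.ne
    have hf2 : ∑ i, eLpNorm (G i) 2 volume ≠ ⊤ := by
      rw [ENNReal.sum_ne_top]; exact fun i _ => (hG i).2.ne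
    have h1 : Tendsto (fun n => eLpNorm g 2 volume + ((ns n : ℝ≥0∞) + 1)⁻¹) atTop
        (𝓝 (eLpNorm g 2 volume)) := by simpa using tendsto_const_nhds.add ht'
    have h2 : Tendsto (fun n => ∑ i, (eLpNorm (G i) 2 volume + ((ns n : ℝ≥0∞) + 1)⁻¹)) atTop
        (𝓝 (∑ i, eLpNorm (G i) 2 volume)) :=
      tendsto_finsetSum _ fun i _ => by simpa using tendsto_const_nhds.add ht'
    refine (ENNReal.continuous_rpow_const.tendsto _).comp (ENNReal.Tendsto.const_mul
      (ENNReal.Tendsto.mul h1 (Or.inr hf2) h2 (Or.inr hf1)) (Or.inr hC))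
  have hfin : eLpNorm g 4 volume ≤
      (C * (eLpNorm g 2 volume * ∑ i, eLpNorm (G i) 2 volume)) ^ (1 / 2 : ℝ) :=
    hF.trans ((liminf_le_liminf (Eventually.of_forall hub)).trans_eq hlim.liminf_eq)
  calc _ ≤ ((C * (eLpNorm g 2 volume * ∑ i, eLpNorm (G i) 2 volume)) ^ (1 / 2 : ℝ)) ^ 2 := by
        gcongr
    _ = _ := by rw [← ENNReal.rpow_natCast, ← ENNReal.rpow_mul]; norm_num

end Ladyzhenskaya

/-! ### Density of test fields in `H¹_b` -/

section Jets

variable {b : Plane → ℝ} {bᵢ bₛ : ℝ}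

theorem IsDepth.enorm_le (h : IsDepth b bᵢ bₛ) (u : L2b b) {g : Plane → Plane}
    (hg : u =ᵐ[volume] g) :
    ‖u‖ₑ ≤ ENNReal.ofReal bₛ ^ (1 / 2 : ℝ≥0∞).toReal * eLpNorm g 2 volume := by
  rw [Lp.enorm_def, ← eLpNorm_congr_ae hg]
  exact h.eLpNorm_depthMeasure_le (by norm_num) u

theorem IsDepth.memLp_volume (h : IsDepth b bᵢ bₛ) (u : L2b b) : MemLp u 2 volume :=
  h.memLp_iff.1 (Lp.memLp u)

theorem IsDepth.exists_ae_eq (h : IsDepth b bᵢ bₛ) {g : Plane → Plane} (hg : MemLp g 2 volume) :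
    ∃ u : L2b b, u =ᵐ[volume] g :=
  ⟨(h.memLp_iff.2 hg).toLp g, h.ae_iff.1 (MemLp.coeFn_toLp _)⟩

theorem mem_sobolev_iff {h : IsDepth b bᵢ bₛ} {x : Jet b} :
    x ∈ sobolev h ↔ HasWeakGrad (x 0) fun i => x i.succ := Iff.rfl

theorem HasWeakGrad.congr {F : Type*} [NormedAddCommGroup F] [NormedSpace ℝ F]
    {g g' : Plane → F} {G G' : Fin 2 → Plane → F} (hgG : HasWeakGrad g G) (hg : g =ᵐ[volume] g')
    (hG : ∀ i, G i =ᵐ[volume] G' i) : HasWeakGrad g' G' := by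
  intro i ψ hψ hψs
  have e1 : ∫ x, (fderiv ℝ ψ x (coordVec i)) • g' x = ∫ x, (fderiv ℝ ψ x (coordVec i)) • g x :=
    integral_congr_ae (by filter_upwards [hg] with x hx; rw [hx])
  have e2 : ∫ x, ψ x • G' i x = ∫ x, ψ x • G i x :=
    integral_congr_ae (by filter_upwards [hG i] with x hx; rw [hx])
  rw [e1, e2, hgG i ψ hψ hψs]

theorem IsDepth.exists_jet (h : IsDepth b bᵢ bₛ) {g : Plane → Plane} {G : Fin 2 → Plane → Plane}
    (hgG : HasWeakGrad g G) (hg : MemLp g 2 volume) (hG : ∀ i, MemLp (G i) 2 volume) :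
    ∃ x ∈ sobolev h, x 0 =ᵐ[volume] g ∧ ∀ i : Fin 2, x i.succ =ᵐ[volume] G i := by
  obtain ⟨u, hu⟩ := h.exists_ae_eq hg
  choose D hD using fun i => h.exists_ae_eq (hG i)
  refine ⟨WithLp.toLp 2 (Fin.cons u D), ?_, hu, hD⟩
  exact mem_sobolev_iff.2 (hgG.congr hu.symm fun i => (hD i).symm)

theorem Jet.norm_le_sum (x : Jet b) : ‖x‖ ≤ ‖x 0‖ + ∑ i : Fin 2, ‖x i.succ‖ := by
  rw [← Fin.sum_univ_succ (fun i => ‖x i‖)]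
  have e : x = ∑ i, PiLp.single 2 i (x i) := by
    ext1 i
    simp
  calc ‖x‖ = ‖∑ i, (PiLp.single 2 i (x i) : Jet b)‖ := by rw [← e]
    _ ≤ ∑ i, ‖(PiLp.single 2 i (x i) : Jet b)‖ := norm_sum_le _ _
    _ = ∑ i, ‖x i‖ := by simp

/-- `x` consists of a smooth compactly supported field and its gradient. -/
def IsTestJet (x : Jet b) : Prop :=
  ∃ w : Plane → Plane, ContDiff ℝ ∞ w ∧ HasCompactSupport w ∧ x 0 =ᵐ[volume] w ∧
    ∀ i : Fin 2, x i.succ =ᵐ[volume] fun t => fderiv ℝ w t (coordVec i)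

theorem dense_isTestJet (h : IsDepth b bᵢ bₛ) : Dense {x : sobolev h | IsTestJet (x : Jet b)} := by
  rw [Metric.dense_iff]
  rintro ⟨x, hx⟩ r hr
  set K : ℝ≥0∞ := ENNReal.ofReal bₛ ^ (1 / 2 : ℝ≥0∞).toReal with hK
  have hKt : K ≠ ⊤ := by simp [hK]
  set ε : ℝ := r / (4 * (K.toReal + 1)) with hε
  have hε0 : 0 < ε := by positivity
  obtain ⟨w, hw, hws, hw0, hw1⟩ := (mem_sobolev_iff.1 hx).exists_contDiff_eLpNorm_sub_le
    (h.memLp_volume _) (fun i => h.memLp_volume _) (ENNReal.ofReal_pos.2 hε0).ne'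
  have hw' : ContDiff ℝ 1 w := hw.of_le (by exact_mod_cast le_top)
  obtain ⟨y, hy, hy0, hy1⟩ := h.exists_jet (hasWeakGrad_of_contDiff hw')
    (hw.continuous.memLp_of_hasCompactSupport hws) (fun i =>
      ((hw.continuous_fderiv (by norm_num)).clm_apply continuous_const).memLp_of_hasCompactSupport
        (hws.fderiv_apply ℝ (coordVec i)))
  refine ⟨⟨y, hy⟩, ?_, w, hw, hws, hy0, hy1⟩
  have key : ∀ (u v : L2b b) (g : Plane → Plane), u =ᵐ[volume] g →
      eLpNorm (g - ⇑v) 2 volume ≤ ENNReal.ofReal ε → ‖u - v‖ ≤ K.toReal * ε := by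
    intro u v g hu hg
    have h1 : (u - v : L2b b) =ᵐ[volume] g - ⇑v := by
      filter_upwards [h.ae_iff.1 (Lp.coeFn_sub u v), hu] with t h1 h2
      rw [h1, Pi.sub_apply, Pi.sub_apply, h2]
    have h2 := (h.enorm_le (u - v) h1).trans (mul_le_mul_right hg _)
    have h3 := ENNReal.toReal_mono (ENNReal.mul_ne_top hKt ENNReal.ofReal_ne_top) h2
    rwa [ENNReal.toReal_mul, ENNReal.toReal_ofReal hε0.le, toReal_enorm] at h3
  rw [Metric.mem_ball, Subtype.dist_eq, dist_eq_norm]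
  have h0 := key (y 0) (x 0) w hy0 hw0
  have h1 := fun i : Fin 2 => key (y i.succ) (x i.succ) _ (hy1 i) (hw1 i)
  calc ‖y - x‖ ≤ _ := Jet.norm_le_sum _
    _ ≤ K.toReal * ε + ∑ i : Fin 2, K.toReal * ε := add_le_add h0 (Finset.sum_le_sum fun i _ => h1 i)
    _ = 3 * (K.toReal * ε) := by simp; ring
    _ < 4 * ((K.toReal + 1) * ε) := by nlinarith [ENNReal.toReal_nonneg (a := K)]
    _ = r := by rw [hε]; field_simp

/-- Ladyzhenskaya's inequality in `H¹_b`. -/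
theorem IsDepth.exists_eLpNorm_four_sq_le (h : IsDepth b bᵢ bₛ) : ∃ C : ℝ, 0 ≤ C ∧
    ∀ x ∈ sobolev h, MemLp (x 0) 4 (depthMeasure b) ∧
      (eLpNorm (x 0) 4 (depthMeasure b)).toReal ^ 2 ≤ C * (‖x 0‖ * ∑ i : Fin 2, ‖x i.succ‖) := by
  obtain ⟨C, hC, hL⟩ := _root_.exists_eLpNorm_four_sq_le
  set K : ℝ≥0∞ := ENNReal.ofReal bₛ ^ (1 / 4 : ℝ≥0∞).toReal with hK
  set L : ℝ≥0∞ := ENNReal.ofReal bᵢ⁻¹ ^ (1 / 2 : ℝ≥0∞).toReal with hL'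
  have hKt : K ≠ ⊤ := by simp [hK]
  have hLt : L ≠ ⊤ := by simp [hL']
  refine ⟨(K ^ 2 * (C * L ^ 2)).toReal, ENNReal.toReal_nonneg, fun x hx => ?_⟩
  have h2 : ∀ u : L2b b, eLpNorm u 2 volume ≤ L * ‖u‖ₑ := fun u => by
    rw [Lp.enorm_def]; exact h.eLpNorm_volume_le (by norm_num) u
  have key : eLpNorm (x 0) 4 (depthMeasure b) ^ 2 ≤
      (K ^ 2 * (C * L ^ 2)) * (‖x 0‖ₑ * ∑ i : Fin 2, ‖x i.succ‖ₑ) := by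
    calc _ ≤ (K * eLpNorm (x 0) 4 volume) ^ 2 := by
          gcongr; exact h.eLpNorm_depthMeasure_le (by norm_num) _
      _ = K ^ 2 * eLpNorm (x 0) 4 volume ^ 2 := mul_pow _ _ _
      _ ≤ K ^ 2 * (C * ((L * ‖x 0‖ₑ) * ∑ i : Fin 2, (L * ‖x i.succ‖ₑ))) := by
          refine mul_le_mul_right ((hL _ _ (mem_sobolev_iff.1 hx) (h.memLp_volume _)
            fun i => h.memLp_volume _).trans ?_) _
          gcongr with i
          · exact h2 _
          · exact h2 _
      _ = _ := by rw [← Finset.mul_sum]; ring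
  have hfin : (K ^ 2 * (C * L ^ 2)) * (‖x 0‖ₑ * ∑ i : Fin 2, ‖x i.succ‖ₑ) ≠ ⊤ := by
    have : ∑ i : Fin 2, ‖x i.succ‖ₑ ≠ ⊤ := by rw [ENNReal.sum_ne_top]; simp
    finiteness
  refine ⟨⟨(Lp.memLp (x 0)).1, ?_⟩, ?_⟩
  · by_contra! htop
    rw [top_le_iff] at htop
    rw [htop] at key
    exact hfin (top_le_iff.1 (by simpa using key))
  · have := ENNReal.toReal_mono hfin key
    rw [ENNReal.toReal_pow, ENNReal.toReal_mul (a := K ^ 2 * (C * L ^ 2)),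
      ENNReal.toReal_mul (a := ‖x 0‖ₑ), ENNReal.toReal_sum (by simp)] at this
    simpa only [toReal_enorm] using this

end Jets

/-! ### The convective form -/

section Convection

variable {b : Plane → ℝ} {bᵢ bₛ : ℝ}

/-- The component `i` of a triple in `H¹_b`: the field for `i = 0`, its derivatives otherwise. -/
noncomputable def component (h : IsDepth b bᵢ bₛ) (i : Fin 3) : sobolev h →L[ℝ] L2b b :=
  (PiLp.proj 2 (fun _ : Fin 3 => L2b b) i : Jet b →L[ℝ] L2b b).comp (sobolev h).subtypeL

theorem component_apply (h : IsDepth b bᵢ bₛ) (i : Fin 3) (x : sobolev h) :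
    component h i x = (x : Jet b) i := rfl

theorem Jet.norm_apply_le (x : Jet b) (i : Fin 3) : ‖x i‖ ≤ ‖x‖ := PiLp.norm_apply_le x i

instance fact_one_le_four : Fact ((1 : ℝ≥0∞) ≤ 4) := ⟨by norm_num⟩

/-- The embedding of `H¹_b` into `L⁴_b`. -/
noncomputable def sobolevToL4 (h : IsDepth b bᵢ bₛ) :
    sobolev h →L[ℝ] Lp Plane 4 (depthMeasure b) :=
  LinearMap.mkContinuous
    { toFun := fun x => (h.exists_eLpNorm_four_sq_le.choose_spec.2 x x.2).1.toLp _
      map_add' := fun x y => by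
        rw [← MemLp.toLp_add]
        exact MemLp.toLp_congr _ _ (Lp.coeFn_add (component h 0 x) (component h 0 y))
      map_smul' := fun c x => by
        rw [RingHom.id_apply, ← MemLp.toLp_const_smul]
        exact MemLp.toLp_congr _ _ (Lp.coeFn_smul c (component h 0 x)) }
    (√(h.exists_eLpNorm_four_sq_le.choose * 2)) fun x => by
      obtain ⟨h0, h1⟩ := h.exists_eLpNorm_four_sq_le.choose_spec
      have h2 := (h1 x x.2).2
      change ‖(h1 x x.2).1.toLp _‖ ≤ _
      rw [Lp.norm_toLp]
      refine Real.le_sqrt_of_sq_le (y := _) ?_ |>.trans_eq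
        (b := √(h.exists_eLpNorm_four_sq_le.choose * 2 * ‖x‖ ^ 2)) ?_
      · refine h2.trans ?_
        rw [mul_assoc]
        refine mul_le_mul_of_nonneg_left ?_ h0
        rw [Fin.sum_univ_two]
        have e0 := Jet.norm_apply_le (x : Jet b) 0
        have e1 := Jet.norm_apply_le (x : Jet b) (Fin.succ 0)
        have e2 := Jet.norm_apply_le (x : Jet b) (Fin.succ 1)
        rw [Submodule.coe_norm] at *
        calc _ ≤ ‖(x : Jet b)‖ * (‖(x : Jet b)‖ + ‖(x : Jet b)‖) := by gcongr
          _ = _ := by ring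
      · rw [Real.sqrt_mul (by positivity), Real.sqrt_sq (norm_nonneg _)]

theorem coeFn_sobolevToL4 (h : IsDepth b bᵢ bₛ) (x : sobolev h) :
    sobolevToL4 h x =ᵐ[depthMeasure b] (x : Jet b) 0 :=
  MemLp.coeFn_toLp (h.exists_eLpNorm_four_sq_le.choose_spec.2 x x.2).1

theorem exists_norm_sobolevToL4_sq_le (h : IsDepth b bᵢ bₛ) : ∃ C, 0 ≤ C ∧ ∀ x : sobolev h,
    ‖sobolevToL4 h x‖ ^ 2 ≤ C * (‖(x : Jet b) 0‖ * ∑ i : Fin 2, ‖(x : Jet b) i.succ‖) := by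
  obtain ⟨h0, h1⟩ := h.exists_eLpNorm_four_sq_le.choose_spec
  refine ⟨_, h0, fun x => ?_⟩
  have h2 := (h1 x x.2).2
  change ‖(h1 x x.2).1.toLp _‖ ^ 2 ≤ _
  rwa [Lp.norm_toLp]

/-- The `j`-th coordinate of the field, in `L⁴_b`. -/
noncomputable def coordL4 (h : IsDepth b bᵢ bₛ) (j : Fin 2) :
    sobolev h →L[ℝ] Lp ℝ 4 (depthMeasure b) :=
  ((EuclideanSpace.proj j : Plane →L[ℝ] ℝ).compLpL 4 (depthMeasure b)).comp (sobolevToL4 h)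

theorem coeFn_coordL4 (h : IsDepth b bᵢ bₛ) (j : Fin 2) (x : sobolev h) :
    coordL4 h j x =ᵐ[depthMeasure b] fun t => (x : Jet b) 0 t j := by
  filter_upwards [(EuclideanSpace.proj j : Plane →L[ℝ] ℝ).coeFn_compLpL (p := 4) (sobolevToL4 h x),
    coeFn_sobolevToL4 h x] with t h1 h2
  rw [coordL4, ContinuousLinearMap.comp_apply, h1, h2]
  rfl

theorem norm_coordL4_le (h : IsDepth b bᵢ bₛ) (j : Fin 2) (x : sobolev h) :
    ‖coordL4 h j x‖ ≤ ‖sobolevToL4 h x‖ := by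
  refine Lp.norm_le_norm_of_ae_le ?_
  filter_upwards [coeFn_coordL4 h j x, coeFn_sobolevToL4 h x] with t h1 h2
  rw [h1, h2]
  exact PiLp.norm_apply_le ((x : Jet b) 0 t) j

/-- The product of a scalar function and a field, both in `L⁴_b`. -/
noncomputable def smulL4 (b : Plane → ℝ) :
    Lp ℝ 4 (depthMeasure b) →L[ℝ] Lp Plane 4 (depthMeasure b) →L[ℝ] L2b b :=
  (ContinuousLinearMap.lsmul ℝ ℝ : ℝ →L[ℝ] Plane →L[ℝ] Plane).holderL (depthMeasure b) 4 4 2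

/-- The convective form `v ↦ (u ⬝ ∇w, v)_b` on `H¹_b`. It is written with products of `L⁴_b`
functions, so that its continuity in all arguments is that of bounded operators. -/
noncomputable def convection (h : IsDepth b bᵢ bₛ) (u w : sobolev h) : sobolev h →L[ℝ] ℝ :=
  ∑ j : Fin 2, (innerSL ℝ (component h j.succ w)).comp ((smulL4 b (coordL4 h j u)).comp
    (sobolevToL4 h))

theorem coeFn_smulL4 (f : Lp ℝ 4 (depthMeasure b)) (g : Lp Plane 4 (depthMeasure b)) :
    smulL4 b f g =ᵐ[depthMeasure b] fun t => f t • g t :=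
  (ContinuousLinearMap.lsmul ℝ ℝ : ℝ →L[ℝ] Plane →L[ℝ] Plane).coeFn_holder f g

theorem norm_smulL4_le (f : Lp ℝ 4 (depthMeasure b)) (g : Lp Plane 4 (depthMeasure b)) :
    ‖smulL4 b f g‖ ≤ ‖f‖ * ‖g‖ := by
  refine (ContinuousLinearMap.norm_holder_apply_apply_le
    (ContinuousLinearMap.lsmul ℝ ℝ : ℝ →L[ℝ] Plane →L[ℝ] Plane) f g).trans ?_
  rw [mul_assoc]
  exact mul_le_of_le_one_left (by positivity) (ContinuousLinearMap.opNorm_lsmul_le)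

theorem convection_apply (h : IsDepth b bᵢ bₛ) (u w v : sobolev h) :
    convection h u w v = convectiveForm ((u : Jet b) 0) (fun j => (w : Jet b) j.succ)
      ((v : Jet b) 0) := by
  have hae : ∀ j : Fin 2, (fun t => (u : Jet b) 0 t j * inner ℝ ((w : Jet b) j.succ t)
      ((v : Jet b) 0 t)) =ᵐ[depthMeasure b]
      fun t => inner ℝ ((w : Jet b) j.succ t) (smulL4 b (coordL4 h j u) (sobolevToL4 h v) t) := by
    intro j
    filter_upwards [coeFn_coordL4 h j u, coeFn_sobolevToL4 h v,
      coeFn_smulL4 (coordL4 h j u) (sobolevToL4 h v)] with t h1 h2 h3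
    rw [h3, h1, h2, inner_smul_right]
  rw [convectiveForm, integral_finsetSum _ fun j _ =>
    (L2.integrable_inner (𝕜 := ℝ) _ _).congr (hae j).symm]
  simp only [convection, sum_apply, ContinuousLinearMap.comp_apply,
    innerSL_apply_apply]
  refine Finset.sum_congr rfl fun j _ => ?_
  rw [integral_congr_ae (hae j), L2.inner_def]
  rfl

theorem continuous_convection (h : IsDepth b bᵢ bₛ) :
    Continuous fun p : sobolev h × sobolev h => convection h p.1 p.2 := by
  unfold convection
  fun_prop

theorem abs_convection_le (h : IsDepth b bᵢ bₛ) (u w v : sobolev h) :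
    |convection h u w v| ≤
      ‖sobolevToL4 h u‖ * ‖sobolevToL4 h v‖ * ∑ i : Fin 2, ‖(w : Jet b) i.succ‖ := by
  simp only [convection, sum_apply, ContinuousLinearMap.comp_apply,
    innerSL_apply_apply]
  rw [Finset.mul_sum]
  refine (Finset.abs_sum_le_sum_abs _ _).trans (Finset.sum_le_sum fun j _ => ?_)
  refine (abs_real_inner_le_norm _ _).trans ?_
  rw [mul_comm]
  gcongr
  · exact (norm_smulL4_le _ _).trans (by gcongr; exact norm_coordL4_le h j u)
  · rfl

/-- For test fields the sum of both sides is `∫ b u ⬝ ∇(w ⬝ v) dx`, which vanishes for solenoidal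
`u`. -/
theorem convection_eq_neg_of_isTestJet (h : IsDepth b bᵢ bₛ) {u w v : sobolev h}
    (hu : IsSolenoidal b ((u : Jet b) 0)) (hw : IsTestJet (w : Jet b))
    (hv : IsTestJet (v : Jet b)) : convection h u w v = - convection h u v w := by
  obtain ⟨f, hf, hfs, hf0, hf1⟩ := hw
  obtain ⟨g, hg, hgs, hg0, hg1⟩ := hv
  have hψ : ContDiff ℝ ∞ fun t => inner ℝ (f t) (g t) := hf.inner ℝ hg
  have hψs : HasCompactSupport fun t => (inner ℝ (f t) (g t) : ℝ) := by
    refine hfs.mono fun t ht h0 => ht ?_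
    simp [h0]
  have key := hu _ hψ hψs
  rw [eq_neg_iff_add_eq_zero, ← key]
  simp only [convection, sum_apply, ContinuousLinearMap.comp_apply,
    innerSL_apply_apply, L2.inner_def]
  rw [← integral_finsetSum _ fun j _ => L2.integrable_inner (𝕜 := ℝ) _ _,
    ← integral_finsetSum _ fun j _ => L2.integrable_inner (𝕜 := ℝ) _ _,
    ← integral_add (integrable_finsetSum _ fun j _ => L2.integrable_inner (𝕜 := ℝ) _ _)
      (integrable_finsetSum _ fun j _ => L2.integrable_inner (𝕜 := ℝ) _ _)]
  refine integral_congr_ae ?_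
  filter_upwards [ae_all_iff.2 fun j => coeFn_coordL4 h j u, coeFn_sobolevToL4 h v,
    coeFn_sobolevToL4 h w, ae_all_iff.2 fun j =>
      coeFn_smulL4 (coordL4 h j u) (sobolevToL4 h v), ae_all_iff.2 fun j =>
      coeFn_smulL4 (coordL4 h j u) (sobolevToL4 h w), h.ae_iff.2 hf0, h.ae_iff.2 hg0,
    ae_all_iff.2 fun j => h.ae_iff.2 (hf1 j), ae_all_iff.2 fun j => h.ae_iff.2 (hg1 j)]
    with t h1 h2 h3 h4 h5 h6 h7 h8 h9
  have hx := eq_add_coordVec ((u : Jet b) 0 t)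
  rw [fderiv_inner_apply ℝ (hf.differentiable (by norm_num) t) (hg.differentiable (by norm_num) t)]
  simp only [component_apply, h4, h5, h1, h2, h3, h6, h7, h8, h9, Fin.sum_univ_two, inner_smul_right]
  generalize ((u : Jet b) 0 t) = z at *
  rw [hx]
  simp only [map_add, map_smul, inner_add_left, inner_add_right, inner_smul_left, inner_smul_right]
  simp [real_inner_comm]
  ring

/-- The convective form is skew-symmetric in its last two arguments if the transporting field is
solenoidal. -/
theorem convection_eq_neg (h : IsDepth b bᵢ bₛ) {u : sobolev h}
    (hu : IsSolenoidal b ((u : Jet b) 0)) (w v : sobolev h) :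
    convection h u w v = - convection h u v w := by
  have hd := (dense_isTestJet h).prod (dense_isTestJet h)
  have hc : Continuous fun p : sobolev h × sobolev h => convection h u p.1 p.2 :=
    ((continuous_convection h).comp (continuous_const.prodMk continuous_fst)).clm_apply
      continuous_snd
  exact congrFun (Continuous.ext_on hd hc (hc.comp continuous_swap).neg
    fun p hp => convection_eq_neg_of_isTestJet h hu hp.1 hp.2) (w, v)

end Convection

/-! ### Multiplication operators on `L²` -/

section Multiplication

variable {α : Type*} [MeasurableSpace α] {μ : Measure α} {E : Type*} [NormedAddCommGroup E]
  [InnerProductSpace ℝ E]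

theorem memLp_top_of_bounds {g : α → ℝ} (hg : Measurable g) {m M : ℝ} (h : ∀ x, m ≤ g x ∧ g x ≤ M) :
    MemLp g ⊤ μ :=
  memLp_top_of_bound hg.aestronglyMeasurable (max |m| |M|) (Eventually.of_forall fun x =>
    abs_le_max_abs_abs (h x).1 (h x).2)

/-- Multiplication by an essentially bounded function, as an operator on `L²`. -/
noncomputable def mulL2 (E : Type*) [NormedAddCommGroup E] [InnerProductSpace ℝ E] {g : α → ℝ}
    (hg : MemLp g ⊤ μ) : Lp E 2 μ →L[ℝ] Lp E 2 μ :=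
  (ContinuousLinearMap.lsmul ℝ ℝ : ℝ →L[ℝ] E →L[ℝ] E).holderL μ ⊤ 2 2 (hg.toLp g)

theorem coeFn_mulL2 {g : α → ℝ} (hg : MemLp g ⊤ μ) (f : Lp E 2 μ) :
    mulL2 E hg f =ᵐ[μ] fun x => g x • f x := by
  filter_upwards [(ContinuousLinearMap.lsmul ℝ ℝ : ℝ →L[ℝ] E →L[ℝ] E).coeFn_holder (r := 2)
    (hg.toLp g) f, hg.coeFn_toLp] with x h1 h2
  rw [← h2]
  exact h1

theorem inner_mulL2_eq {g : α → ℝ} (hg : MemLp g ⊤ μ) (f k : Lp E 2 μ) :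
    inner ℝ (mulL2 E hg f) k = ∫ x, g x * inner ℝ (f x) (k x) ∂μ := by
  rw [L2.inner_def]
  refine integral_congr_ae ?_
  filter_upwards [coeFn_mulL2 hg f] with x hx
  rw [hx, real_inner_smul_left]

theorem integrable_mul_inner {g : α → ℝ} (hg : MemLp g ⊤ μ) (f k : Lp E 2 μ) :
    Integrable (fun x => g x * inner ℝ (f x) (k x)) μ := by
  refine (L2.integrable_inner (𝕜 := ℝ) (mulL2 E hg f) k).congr ?_
  filter_upwards [coeFn_mulL2 hg f] with x hx
  rw [hx, real_inner_smul_left]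

theorem le_inner_mulL2 {g : α → ℝ} (hg : MemLp g ⊤ μ) {m : ℝ} (hm : ∀ x, m ≤ g x) (f : Lp E 2 μ) :
    m * ‖f‖ ^ 2 ≤ inner ℝ (mulL2 E hg f) f := by
  rw [inner_mulL2_eq, ← real_inner_self_eq_norm_sq, L2.inner_def, ← integral_const_mul]
  refine integral_mono ((L2.integrable_inner (𝕜 := ℝ) f f).const_mul m)
    (integrable_mul_inner hg f f) fun x => ?_
  exact mul_le_mul_of_nonneg_right (hm x) real_inner_self_nonneg

theorem eq_zero_of_inner_mulL2_eq_zero {g : α → ℝ} (hg : MemLp g ⊤ μ) (hpos : ∀ x, 0 < g x)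
    {f : Lp E 2 μ} (h : inner ℝ (mulL2 E hg f) f = 0) : f = 0 := by
  rw [inner_mulL2_eq, integral_eq_zero_iff_of_nonneg
    (fun x => mul_nonneg (hpos x).le real_inner_self_nonneg) (integrable_mul_inner hg f f)] at h
  refine Lp.ext ?_
  filter_upwards [h, Lp.coeFn_zero E 2 μ] with x hx h0
  rw [h0]
  simpa [(hpos x).ne'] using hx

end Multiplication

/-! ### Korn's identity for test fields -/

section Korn

/-- Integration by parts twice: the Jacobian determinant of a smooth compactly supported field on
the plane has zero mean. -/
theorem integral_fderiv_mul_eq {f g : Plane → ℝ} (hf : ContDiff ℝ ∞ f) (hg : ContDiff ℝ ∞ g)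
    (hfs : HasCompactSupport f) (v w : Plane) :
    ∫ x, fderiv ℝ f x v * fderiv ℝ g x w = ∫ x, fderiv ℝ f x w * fderiv ℝ g x v := by
  have hfd : ∀ e, ContDiff ℝ ∞ fun x => fderiv ℝ f x e := fun e =>
    (hf.fderiv_right (m := ∞) (by norm_num)).clm_apply contDiff_const
  have hgd : ∀ e, ContDiff ℝ ∞ fun x => fderiv ℝ g x e := fun e =>
    (hg.fderiv_right (m := ∞) (by norm_num)).clm_apply contDiff_const
  have key : ∀ e e', ∫ x, fderiv ℝ f x e * fderiv ℝ g x e' =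
      - ∫ x, f x * fderiv ℝ (fun x => fderiv ℝ g x e') x e := by
    intro e e'
    have c2 : Continuous fun x => fderiv ℝ (fun x => fderiv ℝ g x e') x e :=
      ((hgd e').continuous_fderiv (by norm_num)).clm_apply continuous_const
    have h1 := integral_mul_fderiv_eq_neg_fderiv_mul_of_integrable (μ := volume) (f := f)
      (g := fun x => fderiv ℝ g x e') (v := e)
      (((hfd e).continuous.mul (hgd e').continuous).integrable_of_hasCompactSupport
        (hfs.fderiv_apply ℝ e).mul_right)
      ((hf.continuous.mul c2).integrable_of_hasCompactSupport hfs.mul_right)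
      ((hf.continuous.mul (hgd e').continuous).integrable_of_hasCompactSupport hfs.mul_right)
      (fun x _ => hf.differentiable (by norm_num) x)
      (fun x _ => (hgd e').differentiable (by norm_num) x)
    rw [h1, neg_neg]
  rw [key, key]
  congr 2 with x
  have hs : IsSymmSndFDerivAt ℝ g x := hg.contDiffAt.isSymmSndFDerivAt (by
    simp only [minSmoothness_of_isRCLikeNormedField]
    exact ENat.LEInfty.out)
  have hd : DifferentiableAt ℝ (fderiv ℝ g) x :=
    (hg.fderiv_right (m := ∞) (by norm_num)).differentiable (by norm_num) x
  have e1 : ∀ a c, fderiv ℝ (fun x => fderiv ℝ g x a) x c = fderiv ℝ (fderiv ℝ g) x c a := by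
    intro a c
    have := (hd.hasFDerivAt.clm_apply (hasFDerivAt_const a x)).fderiv
    rw [this]; simp
  rw [e1, e1, hs.eq]

/-- On the plane the square of the strain differs from that of the gradient by a multiple of the
Jacobian determinant. -/
theorem sum_strain_sq (A : Fin 2 → Plane) :
    ∑ i, ∑ j, strain A i j ^ 2 = 2 * ∑ i, ‖A i‖ ^ 2 - 4 * (A 0 0 * A 1 1 - A 1 0 * A 0 1) := by
  simp only [Fin.sum_univ_two, EuclideanSpace.real_norm_sq_eq, strain]
  simp
  ring

theorem continuous_strain (i j : Fin 2) : Continuous fun A : Fin 2 → Plane => strain A i j := by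
  unfold strain
  split_ifs <;> fun_prop

/-- For a smooth compactly supported field, the `L²` norm of the strain is that of the gradient up
to a factor, since the Jacobian determinant has zero mean. -/
theorem integral_sum_strain_sq {w : Plane → Plane} (hw : ContDiff ℝ ∞ w) (hws : HasCompactSupport w) :
    ∑ i, ∑ j, ∫ x, strain (fun k => fderiv ℝ w x (coordVec k)) i j ^ 2
      = 2 * ∑ i, ∫ x, ‖fderiv ℝ w x (coordVec i)‖ ^ 2 := by
  have hc : ∀ i : Fin 2, Continuous fun x => fderiv ℝ w x (coordVec i) := fun i =>
    (hw.continuous_fderiv (by norm_num)).clm_apply continuous_const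
  have hint : ∀ F : (Fin 2 → Plane) → ℝ, Continuous F → F 0 = 0 →
      Integrable (fun x => F fun k => fderiv ℝ w x (coordVec k)) volume := by
    intro F hF h0
    refine (hF.comp (continuous_pi hc)).integrable_of_hasCompactSupport ?_
    refine (hws.fderiv ℝ).comp_left (g := fun A : Plane →L[ℝ] Plane => F fun k => A (coordVec k)) ?_
    simp only [zero_apply]
    exact h0
  have h0 : ∀ i j, strain (0 : Fin 2 → Plane) i j = 0 := fun i j => by simp [strain]
  have hcoord : ∀ j : Fin 2, ContDiff ℝ ∞ fun x => w x j := fun j =>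
    (EuclideanSpace.proj j : Plane →L[ℝ] ℝ).contDiff.comp hw
  have hcoord' : ∀ (j : Fin 2) x v, fderiv ℝ (fun x => w x j) x v = fderiv ℝ w x v j := by
    intro j x v
    have := ((EuclideanSpace.proj j : Plane →L[ℝ] ℝ).hasFDerivAt.comp x
      (hw.differentiable (by norm_num) x).hasFDerivAt).fderiv
    exact congrArg (fun A : Plane →L[ℝ] ℝ => A v) this
  have hdet := integral_fderiv_mul_eq (hcoord 0) (hcoord 1)
    (hws.comp_left (g := fun v : Plane => v 0) rfl) (coordVec 0) (coordVec 1)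
  simp only [hcoord'] at hdet
  have hS : ∀ i j, Integrable (fun x => strain (fun k => fderiv ℝ w x (coordVec k)) i j ^ 2) volume :=
    fun i j => hint (fun A => strain A i j ^ 2) ((continuous_strain i j).pow 2) (by simp [h0])
  have hN : ∀ i, Integrable (fun x => ‖fderiv ℝ w x (coordVec i)‖ ^ 2) volume :=
    fun i => hint (fun A => ‖A i‖ ^ 2) (by fun_prop) (by simp)
  have hA : Integrable (fun x => fderiv ℝ w x (coordVec 0) 0 * fderiv ℝ w x (coordVec 1) 1) volume :=
    hint (fun A => A 0 0 * A 1 1) (by fun_prop) (by simp)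
  have hB : Integrable (fun x => fderiv ℝ w x (coordVec 1) 0 * fderiv ℝ w x (coordVec 0) 1) volume :=
    hint (fun A => A 1 0 * A 0 1) (by fun_prop) (by simp)
  simp_rw [← integral_finsetSum _ fun j _ => hS _ j]
  rw [← integral_finsetSum _ fun i _ => integrable_finsetSum _ fun j _ => hS i j,
    ← integral_finsetSum _ fun i _ => hN i]
  simp_rw [sum_strain_sq]
  have hAB : Integrable (fun x => fderiv ℝ w x (coordVec 0) 0 * fderiv ℝ w x (coordVec 1) 1
      - fderiv ℝ w x (coordVec 1) 0 * fderiv ℝ w x (coordVec 0) 1) volume := hA.sub hB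
  rw [integral_sub ((integrable_finsetSum _ fun i _ => hN i).const_mul _)
    (hAB.const_mul _), integral_const_mul, integral_const_mul, integral_sub hA hB, hdet,
    sub_self, mul_zero, sub_zero]

end Korn

/-! ### The dissipation form -/

section Dissipation

variable {b : Plane → ℝ} {bᵢ bₛ : ℝ}

/-- The `j`-th coordinate of the partial derivative `∂ᵢ u`, in `L²_b`. -/
noncomputable def gradEntry (h : IsDepth b bᵢ bₛ) (i j : Fin 2) :
    sobolev h →L[ℝ] Lp ℝ 2 (depthMeasure b) :=
  ((EuclideanSpace.proj j : Plane →L[ℝ] ℝ).compLpL 2 (depthMeasure b)).comp (component h i.succ)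

theorem coeFn_gradEntry (h : IsDepth b bᵢ bₛ) (i j : Fin 2) (x : sobolev h) :
    gradEntry h i j x =ᵐ[depthMeasure b] fun t => (x : Jet b) i.succ t j :=
  (EuclideanSpace.proj j : Plane →L[ℝ] ℝ).coeFn_compLpL (p := 2) _

/-- The entry `(i, j)` of the strain, in `L²_b`. -/
noncomputable def strainEntry (h : IsDepth b bᵢ bₛ) (i j : Fin 2) :
    sobolev h →L[ℝ] Lp ℝ 2 (depthMeasure b) :=
  gradEntry h i j + gradEntry h j i - if i = j then ∑ k, gradEntry h k k else 0

theorem coeFn_strainEntry (h : IsDepth b bᵢ bₛ) (i j : Fin 2) (x : sobolev h) :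
    strainEntry h i j x =ᵐ[depthMeasure b] fun t =>
      strain (fun k => (x : Jet b) k.succ t) i j := by
  have h1 := coeFn_gradEntry h i j x
  have h2 := coeFn_gradEntry h j i x
  unfold strainEntry strain
  split_ifs with hij
  · rw [Fin.sum_univ_two]
    filter_upwards [h1, h2, coeFn_gradEntry h 0 0 x, coeFn_gradEntry h 1 1 x,
      Lp.coeFn_sub (gradEntry h i j x + gradEntry h j i x) (gradEntry h 0 0 x + gradEntry h 1 1 x),
      Lp.coeFn_add (gradEntry h i j x) (gradEntry h j i x),
      Lp.coeFn_add (gradEntry h 0 0 x) (gradEntry h 1 1 x)] with t e1 e2 e3 e4 e5 e6 e7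
    simp only [sub_apply, add_apply, e5, Pi.sub_apply, e6, e7, Pi.add_apply, e1, e2, e3, e4,
      Fin.sum_univ_two]
  · filter_upwards [h1, h2, Lp.coeFn_add (gradEntry h i j x) (gradEntry h j i x)] with t e1 e2 e6
    simp only [sub_zero, add_apply, e6, Pi.add_apply, e1, e2]

variable {ν η : Plane → ℝ}

/-- The dissipation form `(u, v) ↦ ∫ b ν S(u) : S(v) dx + (η u, v)_b` on `H¹_b`. -/
noncomputable def dissipation (h : IsDepth b bᵢ bₛ) (hν : MemLp ν ⊤ (depthMeasure b))
    (hη : MemLp η ⊤ (depthMeasure b)) : sobolev h →L[ℝ] sobolev h →L[ℝ] ℝ :=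
  (∑ i : Fin 2, ∑ j : Fin 2, (isBoundedBilinearMap_inner (𝕜 := ℝ)).toContinuousLinearMap.bilinearComp
    ((mulL2 ℝ hν).comp (strainEntry h i j)) (strainEntry h i j)) +
  (isBoundedBilinearMap_inner (𝕜 := ℝ)).toContinuousLinearMap.bilinearComp
    ((mulL2 Plane hη).comp (component h 0)) (component h 0)

theorem dissipation_apply (h : IsDepth b bᵢ bₛ) (hν : MemLp ν ⊤ (depthMeasure b))
    (hη : MemLp η ⊤ (depthMeasure b)) (x y : sobolev h) :
    dissipation h hν hη x y =
      (∑ i, ∑ j, inner ℝ (mulL2 ℝ hν (strainEntry h i j x)) (strainEntry h i j y)) +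
        inner ℝ (mulL2 Plane hη ((x : Jet b) 0)) ((y : Jet b) 0) := by
  simp only [dissipation, add_apply, sum_apply]
  rfl

theorem dissipation_eq (h : IsDepth b bᵢ bₛ) (hν : MemLp ν ⊤ (depthMeasure b))
    (hη : MemLp η ⊤ (depthMeasure b)) (x y : sobolev h) :
    dissipation h hν hη x y =
      viscousForm ν (fun i => (x : Jet b) i.succ) (fun i => (y : Jet b) i.succ) +
        frictionForm η ((x : Jet b) 0) ((y : Jet b) 0) := by
  rw [dissipation_apply, inner_mulL2_eq, frictionForm, viscousForm]
  congr 1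
  simp_rw [inner_mulL2_eq]
  simp_rw [← integral_finsetSum _ fun j _ => integrable_mul_inner hν _ _]
  rw [← integral_finsetSum _ fun i _ => integrable_finsetSum _ fun j _ =>
    integrable_mul_inner hν _ _]
  refine integral_congr_ae ?_
  filter_upwards [ae_all_iff.2 fun i => ae_all_iff.2 fun j => coeFn_strainEntry h i j x,
    ae_all_iff.2 fun i => ae_all_iff.2 fun j => coeFn_strainEntry h i j y] with t h1 h2
  have hr : ∀ p q : ℝ, inner ℝ p q = p * q := fun p q => mul_comm _ _
  simp only [h1, h2, hr, Finset.mul_sum]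

theorem dissipation_symm (h : IsDepth b bᵢ bₛ) (hν : MemLp ν ⊤ (depthMeasure b))
    (hη : MemLp η ⊤ (depthMeasure b)) (x y : sobolev h) :
    dissipation h hν hη x y = dissipation h hν hη y x := by
  rw [dissipation_apply, dissipation_apply]
  simp only [inner_mulL2_eq]
  congr 1
  · refine Finset.sum_congr rfl fun i _ => Finset.sum_congr rfl fun j _ => ?_
    congr with t
    rw [real_inner_comm]
  · congr with t
    rw [real_inner_comm]

/-- Comparison of the norm of `L²_b` with the unweighted norm of a test field. -/
theorem IsDepth.norm_sq_le_of_ae_eq {E : Type*} [NormedAddCommGroup E] [InnerProductSpace ℝ E]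
    (h : IsDepth b bᵢ bₛ) {f : Lp E 2 (depthMeasure b)} {g : Plane → E} (hfg : f =ᵐ[volume] g)
    (hg : Continuous g) (hgs : HasCompactSupport g) :
    bᵢ * ∫ x, ‖g x‖ ^ 2 ≤ ‖f‖ ^ 2 ∧ ‖f‖ ^ 2 ≤ bₛ * ∫ x, ‖g x‖ ^ 2 := by
  have hc : HasCompactSupport fun x => ‖g x‖ ^ 2 :=
    hgs.comp_left (g := fun v : E => ‖v‖ ^ 2) (by simp)
  have hgc : Continuous fun x => ‖g x‖ ^ 2 := hg.norm.pow 2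
  have hi : Integrable (fun x => ‖g x‖ ^ 2) volume := hgc.integrable_of_hasCompactSupport hc
  have hi' : Integrable (fun x => b x * ‖g x‖ ^ 2) volume :=
    (h.contDiff.continuous.mul hgc).integrable_of_hasCompactSupport hc.mul_left
  have e : ‖f‖ ^ 2 = ∫ x, b x * ‖g x‖ ^ 2 := by
    rw [← real_inner_self_eq_norm_sq, L2.inner_def, h.integral_depthMeasure]
    refine integral_congr_ae ?_
    filter_upwards [hfg] with x hx
    rw [hx, real_inner_self_eq_norm_sq, smul_eq_mul]
  rw [e, ← integral_const_mul, ← integral_const_mul]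
  exact ⟨integral_mono (hi.const_mul _) hi' fun x =>
      mul_le_mul_of_nonneg_right (h.lower_le x) (by positivity),
    integral_mono hi' (hi.const_mul _) fun x =>
      mul_le_mul_of_nonneg_right (h.le_upper x) (by positivity)⟩

/-- Korn's inequality in `H¹_b`, by density of test fields. -/
theorem sum_norm_sq_le_strainEntry (h : IsDepth b bᵢ bₛ) (x : sobolev h) :
    ∑ i : Fin 2, ‖(x : Jet b) i.succ‖ ^ 2 ≤
      bₛ / (2 * bᵢ) * ∑ i, ∑ j, ‖strainEntry h i j x‖ ^ 2 := by
  have hbi := h.lower_pos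
  have hbs := h.upper_pos
  -- both sides are continuous, so that smooth compactly supported fields suffice
  have hcl : IsClosed {x : sobolev h | ∑ i : Fin 2, ‖component h i.succ x‖ ^ 2 ≤
      bₛ / (2 * bᵢ) * ∑ i, ∑ j, ‖strainEntry h i j x‖ ^ 2} :=
    isClosed_le (by fun_prop) (by fun_prop)
  refine closure_minimal ?_ hcl ((dense_isTestJet h) x)
  rintro y ⟨w, hw, hws, -, hw1⟩
  have hc : ∀ i : Fin 2, Continuous fun x => fderiv ℝ w x (coordVec i) := fun i =>
    (hw.continuous_fderiv (by norm_num)).clm_apply continuous_const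
  have e1 : ∀ i : Fin 2, ‖component h i.succ y‖ ^ 2 ≤ bₛ * ∫ x, ‖fderiv ℝ w x (coordVec i)‖ ^ 2 :=
    fun i => (h.norm_sq_le_of_ae_eq (hw1 i) (hc i) (hws.fderiv_apply ℝ _)).2
  have e2 : ∀ i j : Fin 2, bᵢ * ∫ x, strain (fun k => fderiv ℝ w x (coordVec k)) i j ^ 2 ≤
      ‖strainEntry h i j y‖ ^ 2 := by
    intro i j
    have hs : strainEntry h i j y =ᵐ[volume] fun x =>
        strain (fun k => fderiv ℝ w x (coordVec k)) i j := by
      filter_upwards [h.ae_iff.1 (coeFn_strainEntry h i j y), ae_all_iff.2 hw1] with t h1 h2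
      simp only [h1, h2]
    have := (h.norm_sq_le_of_ae_eq hs ((continuous_strain i j).comp (continuous_pi hc))
      ((hws.fderiv ℝ).comp_left (g := fun A : Plane →L[ℝ] Plane =>
        strain (fun k => A (coordVec k)) i j) (by simp [strain]))).1
    simpa only [Real.norm_eq_abs, sq_abs] using this
  have e3 := integral_sum_strain_sq hw hws
  have e4 : bᵢ * ∑ i, ∑ j, ∫ x, strain (fun k => fderiv ℝ w x (coordVec k)) i j ^ 2 ≤
      ∑ i, ∑ j, ‖strainEntry h i j y‖ ^ 2 := by
    rw [Finset.mul_sum]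
    simp_rw [Finset.mul_sum]
    exact Finset.sum_le_sum fun i _ => Finset.sum_le_sum fun j _ => e2 i j
  rw [mem_ofPred_eq]
  calc ∑ i : Fin 2, ‖component h i.succ y‖ ^ 2
      ≤ bₛ * ∑ i, ∫ x, ‖fderiv ℝ w x (coordVec i)‖ ^ 2 := by
        rw [Finset.mul_sum]; exact Finset.sum_le_sum fun i _ => e1 i
    _ = bₛ / (2 * bᵢ) * (bᵢ * ∑ i, ∑ j, ∫ x, strain (fun k => fderiv ℝ w x (coordVec k)) i j ^ 2) := by
        rw [e3]; field_simp
    _ ≤ _ := by gcongr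

theorem sum_norm_sq_le_dissipation (h : IsDepth b bᵢ bₛ) (hν : MemLp ν ⊤ (depthMeasure b))
    (hη : MemLp η ⊤ (depthMeasure b)) {νᵢ : ℝ} (hνᵢ : 0 < νᵢ) (hνl : ∀ x, νᵢ ≤ ν x)
    (hη0 : ∀ x, 0 < η x) (x : sobolev h) :
    ∑ i : Fin 2, ‖(x : Jet b) i.succ‖ ^ 2 ≤
      bₛ / (2 * bᵢ * νᵢ) * dissipation h hν hη x x := by
  have hbi := h.lower_pos
  have hbs := h.upper_pos
  have h1 : νᵢ * ∑ i, ∑ j, ‖strainEntry h i j x‖ ^ 2 ≤ dissipation h hν hη x x := by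
    rw [dissipation_apply, Finset.mul_sum]
    simp_rw [Finset.mul_sum]
    have h2 := le_inner_mulL2 hη (fun x => (hη0 x).le) ((x : Jet b) 0)
    rw [zero_mul] at h2
    refine le_add_of_le_of_nonneg (Finset.sum_le_sum fun i _ => Finset.sum_le_sum fun j _ =>
      le_inner_mulL2 hν hνl _) h2
  calc _ ≤ _ := sum_norm_sq_le_strainEntry h x
    _ = bₛ / (2 * bᵢ * νᵢ) * (νᵢ * ∑ i, ∑ j, ‖strainEntry h i j x‖ ^ 2) := by field_simp
    _ ≤ _ := by gcongr

theorem dissipation_nonneg (h : IsDepth b bᵢ bₛ) (hν : MemLp ν ⊤ (depthMeasure b))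
    (hη : MemLp η ⊤ (depthMeasure b)) (hν0 : ∀ x, 0 < ν x) (hη0 : ∀ x, 0 < η x) (x : sobolev h) :
    0 ≤ dissipation h hν hη x x := by
  rw [dissipation_apply]
  have h2 := le_inner_mulL2 hη (fun x => (hη0 x).le) ((x : Jet b) 0)
  rw [zero_mul] at h2
  refine add_nonneg (Finset.sum_nonneg fun i _ => Finset.sum_nonneg fun j _ => ?_) h2
  have h3 := le_inner_mulL2 hν (fun x => (hν0 x).le) (strainEntry h i j x)
  rwa [zero_mul] at h3

theorem field_eq_zero_of_dissipation_eq_zero (h : IsDepth b bᵢ bₛ)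
    (hν : MemLp ν ⊤ (depthMeasure b)) (hη : MemLp η ⊤ (depthMeasure b)) (hν0 : ∀ x, 0 < ν x)
    (hη0 : ∀ x, 0 < η x) {x : sobolev h} (hx : dissipation h hν hη x x = 0) :
    (x : Jet b) 0 = 0 := by
  refine eq_zero_of_inner_mulL2_eq_zero hη hη0 (le_antisymm ?_ ?_)
  · rw [dissipation_apply] at hx
    rw [← hx]
    refine le_add_of_nonneg_left (Finset.sum_nonneg fun i _ => Finset.sum_nonneg fun j _ => ?_)
    have h3 := le_inner_mulL2 hν (fun x => (hν0 x).le) (strainEntry h i j x)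
    rwa [zero_mul] at h3
  · have h2 := le_inner_mulL2 hη (fun x => (hη0 x).le) ((x : Jet b) 0)
    rwa [zero_mul] at h2

end Dissipation

/-! ### The Poincaré inequality on balls -/

section Poincare

theorem enorm_integral_sq_le {α E : Type*} [MeasurableSpace α] {μ : Measure α} [NormedAddCommGroup E]
    [NormedSpace ℝ E] {k : α → E} (hk : AEStronglyMeasurable k μ) :
    ‖∫ x, k x ∂μ‖ₑ ^ 2 ≤ μ univ * ∫⁻ x, ‖k x‖ₑ ^ 2 ∂μ := by
  have h1 : ∫⁻ x, ‖k x‖ₑ ∂μ ≤ μ univ ^ (1 / 2 : ℝ) * (∫⁻ x, ‖k x‖ₑ ^ 2 ∂μ) ^ (1 / 2 : ℝ) := by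
    have := ENNReal.lintegral_mul_norm_pow_le (μ := μ) (f := fun _ => 1) (g := fun x => ‖k x‖ₑ ^ 2)
      aemeasurable_const (hk.enorm.pow_const 2) (p := 1 / 2) (q := 1 / 2) (by norm_num) (by norm_num)
      (by norm_num)
    simp only [ENNReal.one_rpow, one_mul, lintegral_const] at this
    convert this using 3 with x
    rw [← ENNReal.rpow_natCast, ← ENNReal.rpow_mul]; norm_num
  calc _ ≤ (μ univ ^ (1 / 2 : ℝ) * (∫⁻ x, ‖k x‖ₑ ^ 2 ∂μ) ^ (1 / 2 : ℝ)) ^ 2 := by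
        gcongr
        exact (enorm_integral_le_lintegral_enorm _).trans h1
    _ = _ := by
        rw [mul_pow, ← ENNReal.rpow_natCast, ← ENNReal.rpow_natCast, ← ENNReal.rpow_mul,
          ← ENNReal.rpow_mul]
        norm_num

/-- Change of variables for a dilation of the plane with factor at least one half. -/
theorem lintegral_comp_add_smul_le {f : Plane → ℝ≥0∞} (hf : Measurable f) (c : Plane) {s : ℝ}
    (hs : 1 / 2 ≤ s) : ∫⁻ y, f (c + s • y) ≤ 4 * ∫⁻ y, f y := by
  have hs0 : 0 < s := by linarith
  have h1 : ∫⁻ y, f (c + s • y) = ∫⁻ y, f (c + y) ∂(Measure.map (fun y : Plane => s • y) volume) := by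
    rw [lintegral_map (by fun_prop) (by fun_prop)]
  rw [h1, Measure.map_addHaar_smul _ hs0.ne', lintegral_smul_measure, lintegral_add_left_eq_self f c]
  have h2 : ENNReal.ofReal |(s ^ Module.finrank ℝ Plane)⁻¹| ≤ 4 := by
    have : Module.finrank ℝ Plane = 2 := by simp [Plane]
    rw [this, abs_of_pos (by positivity), show (4 : ℝ≥0∞) = ENNReal.ofReal 4 by norm_num]
    refine ENNReal.ofReal_le_ofReal ?_
    rw [inv_le_comm₀ (by positivity) (by norm_num)]
    nlinarith
  rw [smul_eq_mul]
  gcongr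

theorem enorm_sub_sq_le_lintegral {h : Plane → ℝ} (hh : ContDiff ℝ 1 h) (x y : Plane) :
    ‖h x - h y‖ₑ ^ 2 ≤ ‖x - y‖ₑ ^ 2 *
      ∫⁻ s in Ioc (0 : ℝ) 1, ‖fderiv ℝ h (x + s • (y - x))‖ₑ ^ 2 := by
  have hc : Continuous fun s : ℝ => fderiv ℝ h (x + s • (y - x)) (y - x) :=
    ((hh.continuous_fderiv (by norm_num)).comp (by fun_prop)).clm_apply continuous_const
  have h1 : h y - h x = ∫ s in (0 : ℝ)..1, fderiv ℝ h (x + s • (y - x)) (y - x) := by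
    rw [intervalIntegral.integral_eq_sub_of_hasDerivAt (f := fun s : ℝ => h (x + s • (y - x)))
      (fun s _ => ?_) (hc.intervalIntegrable _ _)]
    · simp
    · have hl : HasDerivAt (fun s : ℝ => x + s • (y - x)) (y - x) s := by
        simpa using ((hasDerivAt_id s).smul_const (y - x)).const_add x
      exact (hh.differentiable (by norm_num) _).hasFDerivAt.comp_hasDerivAt s hl
  rw [enorm_sub_rev, h1, intervalIntegral.integral_of_le zero_le_one]
  refine (enorm_integral_sq_le hc.aestronglyMeasurable).trans ?_
  simp only [Measure.restrict_apply_univ, Real.volume_Ioc, sub_zero, ENNReal.ofReal_one, one_mul]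
  rw [← lintegral_const_mul' _ _ (by finiteness)]
  refine lintegral_mono fun s => ?_
  rw [← mul_pow, mul_comm, enorm_sub_rev x y]
  gcongr
  exact ContinuousLinearMap.le_opENorm _ _

/-- Mean square differences of `h` over a ball are bounded by the gradient, integrating along
segments. -/
theorem lintegral_lintegral_enorm_sub_sq_le {h : Plane → ℝ} (hh : ContDiff ℝ 1 h) (R : ℝ) :
    ∫⁻ x in Metric.ball 0 R, ∫⁻ y in Metric.ball 0 R, ‖h x - h y‖ₑ ^ 2 ≤
      ENNReal.ofReal (2 * R) ^ 2 * (4 * volume (Metric.ball (0 : Plane) R)) *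
        ∫⁻ x in Metric.ball 0 R, ‖fderiv ℝ h x‖ₑ ^ 2 := by
  set B : Set Plane := Metric.ball 0 R with hB
  have hBm : MeasurableSet B := measurableSet_ball
  have hfd : Continuous (fderiv ℝ h) := hh.continuous_fderiv (by norm_num)
  set g : Plane → ℝ≥0∞ := B.indicator fun x => ‖fderiv ℝ h x‖ₑ ^ 2 with hg
  have hgm : Measurable g := (hfd.measurable.enorm.pow_const 2).indicator hBm
  have hgi : ∫⁻ x in B, ‖fderiv ℝ h x‖ₑ ^ 2 = ∫⁻ x, g x := (lintegral_indicator hBm _).symm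
  have hpt : ∀ x ∈ B, ∀ y ∈ B, ‖h x - h y‖ₑ ^ 2 ≤
      ENNReal.ofReal (2 * R) ^ 2 * ∫⁻ s in Ioc (0 : ℝ) 1, g (x + s • (y - x)) := by
    intro x hx y hy
    refine (enorm_sub_sq_le_lintegral hh x y).trans ?_
    gcongr ?_ ^ 2 * ?_
    · rw [← ofReal_norm]
      refine ENNReal.ofReal_le_ofReal ?_
      rw [hB, mem_ball_zero_iff] at hx hy
      linarith [norm_sub_le x y]
    · refine setLIntegral_mono' measurableSet_Ioc fun s hs => ?_
      have hmem : x + s • (y - x) ∈ B :=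
        (convex_ball (0 : Plane) R).add_smul_sub_mem hx hy ⟨hs.1.le, hs.2⟩
      rw [hg, indicator_of_mem hmem]
  -- one of the two end points of the segment carries a weight at least one half
  have hs : ∀ s ∈ Ioc (0 : ℝ) 1, ∫⁻ x in B, ∫⁻ y in B, g (x + s • (y - x)) ≤
      4 * volume B * ∫⁻ x, g x := by
    intro s hs
    have hconst : ∫⁻ _ in B, (4 * ∫⁻ x, g x) = 4 * volume B * ∫⁻ x, g x := by
      rw [setLIntegral_const]; ring
    rw [← hconst]
    rcases le_total (1 / 2) s with h2 | h2
    · refine lintegral_mono fun x => (setLIntegral_le_lintegral _ _).trans ?_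
      refine le_trans (le_of_eq ?_) (lintegral_comp_add_smul_le hgm (x - s • x) h2)
      congr with y; congr 1; rw [smul_sub]; abel
    · rw [lintegral_lintegral_swap]
      · refine lintegral_mono fun y => (setLIntegral_le_lintegral _ _).trans ?_
        refine le_trans (le_of_eq ?_) (lintegral_comp_add_smul_le hgm (s • y)
          (s := 1 - s) (by linarith))
        congr with x; congr 1; rw [smul_sub, sub_smul, one_smul]; abel
      · exact (hgm.comp (by fun_prop :
          Measurable fun p : Plane × Plane => p.1 + s • (p.2 - p.1))).aemeasurable
  have hm2 : ∀ x : Plane, Measurable fun p : Plane × ℝ => g (x + p.2 • (p.1 - x)) := fun x =>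
    hgm.comp (by fun_prop)
  have hm4 : Measurable fun p : Plane × ℝ => ∫⁻ y in B, g (p.1 + p.2 • (y - p.1)) := by
    have : Measurable fun q : (Plane × ℝ) × Plane => g (q.1.1 + q.1.2 • (q.2 - q.1.1)) :=
      hgm.comp (by fun_prop)
    exact this.lintegral_prod_right' (ν := volume.restrict B)
  calc ∫⁻ x in B, ∫⁻ y in B, ‖h x - h y‖ₑ ^ 2
      ≤ ∫⁻ x in B, ∫⁻ y in B, ENNReal.ofReal (2 * R) ^ 2 *
          ∫⁻ s in Ioc (0 : ℝ) 1, g (x + s • (y - x)) :=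
        setLIntegral_mono' hBm fun x hx => setLIntegral_mono' hBm fun y hy => hpt x hx y hy
    _ = ENNReal.ofReal (2 * R) ^ 2 * ∫⁻ x in B, ∫⁻ y in B,
          ∫⁻ s in Ioc (0 : ℝ) 1, g (x + s • (y - x)) := by
        rw [← lintegral_const_mul' _ _ (by finiteness)]
        congr with x
        rw [← lintegral_const_mul' _ _ (by finiteness)]
    _ = ENNReal.ofReal (2 * R) ^ 2 * ∫⁻ s in Ioc (0 : ℝ) 1, ∫⁻ x in B, ∫⁻ y in B,
          g (x + s • (y - x)) := by
        congr 1
        rw [← lintegral_lintegral_swap (f := fun x s => ∫⁻ y in B, g (x + s • (y - x)))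
          hm4.aemeasurable]
        congr with x
        exact lintegral_lintegral_swap (f := fun y s => g (x + s • (y - x))) (hm2 x).aemeasurable
    _ ≤ ENNReal.ofReal (2 * R) ^ 2 * ∫⁻ s in Ioc (0 : ℝ) 1, 4 * volume B * ∫⁻ x, g x := by
        exact mul_le_mul_right (setLIntegral_mono' measurableSet_Ioc hs) _
    _ = _ := by
        rw [setLIntegral_const, Real.volume_Ioc, hgi]
        simp [mul_assoc]

/-- The Poincaré inequality on balls, for functions normalised by a zero mean on the unit ball. -/
theorem exists_lintegral_sq_le_fderiv {R : ℝ} (hR : 1 ≤ R) : ∃ C : ℝ≥0∞, C ≠ ⊤ ∧ ∀ h : Plane → ℝ,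
    ContDiff ℝ 1 h → ∫ x in Metric.ball 0 1, h x = 0 →
    ∫⁻ x in Metric.ball 0 R, ‖h x‖ₑ ^ 2 ≤ C * ∫⁻ x in Metric.ball 0 R, ‖fderiv ℝ h x‖ₑ ^ 2 := by
  set V := volume (Metric.ball (0 : Plane) 1) with hV
  have hV0 : V ≠ 0 := (Metric.measure_ball_pos _ _ one_pos).ne'
  have hVt : V ≠ ⊤ := measure_ball_lt_top.ne
  have hBt : volume (Metric.ball (0 : Plane) R) ≠ ⊤ := measure_ball_lt_top.ne
  refine ⟨V⁻¹ * (ENNReal.ofReal (2 * R) ^ 2 * (4 * volume (Metric.ball (0 : Plane) R))), by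
    have := ENNReal.inv_ne_top.2 hV0
    finiteness, fun h hh h0 => ?_⟩
  have hpt : ∀ x, ‖h x‖ₑ ^ 2 ≤ V⁻¹ * ∫⁻ y in Metric.ball 0 R, ‖h x - h y‖ₑ ^ 2 := by
    intro x
    have hi : IntegrableOn h (Metric.ball 0 1) volume :=
      hh.continuous.continuousOn.integrableOn_compact (isCompact_closedBall (0 : Plane) 1)
        |>.mono_set Metric.ball_subset_closedBall
    have : IsFiniteMeasure (volume.restrict (Metric.ball (0 : Plane) 1)) :=
      ⟨by rw [Measure.restrict_apply_univ]; exact measure_ball_lt_top⟩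
    have e : ∫ y in Metric.ball 0 1, (h x - h y) = (volume.real (Metric.ball (0 : Plane) 1)) * h x := by
      rw [integral_sub (integrable_const _) hi, h0, sub_zero, setIntegral_const, smul_eq_mul]
    have h1 := enorm_integral_sq_le (μ := volume.restrict (Metric.ball (0 : Plane) 1))
      (k := fun y => h x - h y) (continuous_const.sub hh.continuous).aestronglyMeasurable
    rw [e, enorm_mul, mul_pow, Measure.restrict_apply_univ] at h1
    have e2 : ‖volume.real (Metric.ball (0 : Plane) 1)‖ₑ = V := by
      rw [Real.enorm_eq_ofReal measureReal_nonneg, ofReal_measureReal hVt]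
    rw [e2] at h1
    have h2 : ∫⁻ y in Metric.ball 0 1, ‖h x - h y‖ₑ ^ 2 ≤ ∫⁻ y in Metric.ball 0 R, ‖h x - h y‖ₑ ^ 2 :=
      lintegral_mono_set (Metric.ball_subset_ball hR)
    calc ‖h x‖ₑ ^ 2 = V⁻¹ * (V⁻¹ * (V ^ 2 * ‖h x‖ₑ ^ 2)) := by
          rw [pow_two V, mul_assoc V, ← mul_assoc V⁻¹ V, ENNReal.inv_mul_cancel hV0 hVt, one_mul,
            ← mul_assoc V⁻¹ V, ENNReal.inv_mul_cancel hV0 hVt, one_mul]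
      _ ≤ V⁻¹ * (V⁻¹ * (V * ∫⁻ y in Metric.ball 0 1, ‖h x - h y‖ₑ ^ 2)) := by gcongr
      _ = V⁻¹ * ∫⁻ y in Metric.ball 0 1, ‖h x - h y‖ₑ ^ 2 := by
          rw [← mul_assoc V⁻¹ V, ENNReal.inv_mul_cancel hV0 hVt, one_mul]
      _ ≤ _ := by gcongr
  calc _ ≤ ∫⁻ x in Metric.ball 0 R, V⁻¹ * ∫⁻ y in Metric.ball 0 R, ‖h x - h y‖ₑ ^ 2 :=
        lintegral_mono fun x => hpt x
    _ = V⁻¹ * ∫⁻ x in Metric.ball 0 R, ∫⁻ y in Metric.ball 0 R, ‖h x - h y‖ₑ ^ 2 :=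
        lintegral_const_mul' _ _ (ENNReal.inv_ne_top.2 hV0)
    _ ≤ _ := by
        rw [mul_assoc]
        gcongr
        exact lintegral_lintegral_enorm_sub_sq_le hh R

end Poincare

/-! ### Stream functions -/

section StreamFunctions

/-- The rotation by a right angle `A ↦ (A 1, - A 0)`, from covectors to vectors of the plane, so
that `rot ∘ fderiv ℝ h` is the solenoidal field with stream function `h`. -/
noncomputable def rot : (Plane →L[ℝ] ℝ) →L[ℝ] Plane :=
  (ContinuousLinearMap.apply ℝ ℝ (coordVec 1)).smulRight (coordVec 0) -
    (ContinuousLinearMap.apply ℝ ℝ (coordVec 0)).smulRight (coordVec 1)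

theorem rot_apply (A : Plane →L[ℝ] ℝ) :
    rot A = A (coordVec 1) • coordVec 0 - A (coordVec 0) • coordVec 1 := rfl

theorem rot_apply_zero (A : Plane →L[ℝ] ℝ) : rot A 0 = A (coordVec 1) := by
  simp [rot_apply]

theorem rot_apply_one (A : Plane →L[ℝ] ℝ) : rot A 1 = - A (coordVec 0) := by
  simp [rot_apply]

theorem norm_le_two_mul_norm_rot (A : Plane →L[ℝ] ℝ) : ‖A‖ ≤ 2 * ‖rot A‖ := by
  refine (opNorm_le_add_coordVec A).trans ?_
  have h0 : ‖A (coordVec 1)‖ ≤ ‖rot A‖ := by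
    rw [← rot_apply_zero]; exact PiLp.norm_apply_le _ _
  have h1 : ‖A (coordVec 0)‖ ≤ ‖rot A‖ := by
    rw [← norm_neg, ← rot_apply_one]; exact PiLp.norm_apply_le _ _
  linarith

/-- A smooth field without divergence on the plane has a stream function, which can be normalised
by a zero mean on the unit ball. -/
theorem exists_stream {m : Plane → Plane} (hm : ContDiff ℝ ∞ m)
    (hdiv : ∀ x, fderiv ℝ m x (coordVec 0) 0 + fderiv ℝ m x (coordVec 1) 1 = 0) :
    ∃ h : Plane → ℝ, ContDiff ℝ ∞ h ∧ (∀ x, rot (fderiv ℝ h x) = m x) ∧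
      ∫ x in Metric.ball 0 1, h x = 0 := by
  set J : Plane →L[ℝ] (Plane →L[ℝ] ℝ) :=
    (EuclideanSpace.proj 0 : Plane →L[ℝ] ℝ).smulRight (EuclideanSpace.proj 1 : Plane →L[ℝ] ℝ) -
    (EuclideanSpace.proj 1 : Plane →L[ℝ] ℝ).smulRight (EuclideanSpace.proj 0 : Plane →L[ℝ] ℝ)
    with hJ
  have hJa : ∀ v w : Plane, J v w = v 0 * w 1 - v 1 * w 0 := fun v w => by simp [hJ]
  have hω : ContDiff ℝ ∞ fun x => J (m x) := J.contDiff.comp hm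
  have hd : ∀ x, fderiv ℝ (fun x => J (m x)) x = J.comp (fderiv ℝ m x) := fun x =>
    (J.hasFDerivAt.comp x (hm.differentiable (by norm_num) x).hasFDerivAt).fderiv
  obtain ⟨h, hh⟩ := convex_univ.exists_forall_hasFDerivAt_of_fderiv_symmetric isOpen_univ
    (hω.differentiable (by norm_num)).differentiableOn (fun x _ v w => by
      simp only [hd, ContinuousLinearMap.comp_apply, hJa]
      have hv : fderiv ℝ m x v = v 0 • fderiv ℝ m x (coordVec 0) + v 1 • fderiv ℝ m x (coordVec 1) := by
        conv_lhs => rw [eq_add_coordVec v]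
        rw [map_add, map_smul, map_smul]
      have hw : fderiv ℝ m x w = w 0 • fderiv ℝ m x (coordVec 0) + w 1 • fderiv ℝ m x (coordVec 1) := by
        conv_lhs => rw [eq_add_coordVec w]
        rw [map_add, map_smul, map_smul]
      rw [hv, hw]
      simp only [PiLp.add_apply, PiLp.smul_apply, smul_eq_mul]
      linear_combination (v 0 * w 1 - v 1 * w 0) * hdiv x)
  have hh' : ∀ x, HasFDerivAt h (J (m x)) x := fun x => hh x (mem_univ x)
  have hc : ContDiff ℝ ∞ h := by
    rw [contDiff_infty_iff_fderiv]
    refine ⟨fun x => (hh' x).differentiableAt, ?_⟩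
    have : fderiv ℝ h = fun x => J (m x) := funext fun x => (hh' x).fderiv
    rwa [this]
  have hfin : IsFiniteMeasure (volume.restrict (Metric.ball (0 : Plane) 1)) :=
    ⟨by rw [Measure.restrict_apply_univ]; exact measure_ball_lt_top⟩
  have hi : IntegrableOn h (Metric.ball 0 1) volume :=
    hc.continuous.continuousOn.integrableOn_compact (isCompact_closedBall (0 : Plane) 1)
      |>.mono_set Metric.ball_subset_closedBall
  set V := volume.real (Metric.ball (0 : Plane) 1) with hV
  have hV0 : V ≠ 0 := by
    rw [hV, Measure.real, ENNReal.toReal_ne_zero]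
    exact ⟨(Metric.measure_ball_pos _ _ one_pos).ne', measure_ball_lt_top.ne⟩
  refine ⟨fun x => h x - V⁻¹ * ∫ x in Metric.ball 0 1, h x, hc.sub contDiff_const, fun x => ?_, ?_⟩
  · rw [fderiv_sub_const, (hh' x).fderiv]
    ext i
    fin_cases i
    · simp [rot_apply, hJa]
    · simp [rot_apply, hJa]
  · rw [integral_sub hi (integrable_const _), setIntegral_const, smul_eq_mul, ← hV, ← mul_assoc,
      mul_inv_cancel₀ hV0, one_mul, sub_self]

variable {b : Plane → ℝ} {bᵢ bₛ : ℝ}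

/-- The field `u` with `b u = (∂₁ h, - ∂₀ h)`. -/
noncomputable def streamField (b : Plane → ℝ) (h : Plane → ℝ) (x : Plane) : Plane :=
  (b x)⁻¹ • rot (fderiv ℝ h x)

theorem IsDepth.contDiff_inv (hb : IsDepth b bᵢ bₛ) : ContDiff ℝ ∞ fun x => (b x)⁻¹ :=
  hb.contDiff.inv fun x => (hb.pos x).ne'

theorem IsDepth.contDiff_streamField (hb : IsDepth b bᵢ bₛ) {h : Plane → ℝ} (hh : ContDiff ℝ ∞ h) :
    ContDiff ℝ ∞ (streamField b h) :=
  hb.contDiff_inv.smul (rot.contDiff.comp (hh.fderiv_right (m := ∞) (by norm_num)))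

theorem hasCompactSupport_streamField {h : Plane → ℝ} (hs : HasCompactSupport h) :
    HasCompactSupport (streamField b h) := by
  have h1 : HasCompactSupport fun x => rot (fderiv ℝ h x) :=
    (hs.fderiv ℝ).comp_left (g := fun A : Plane →L[ℝ] ℝ => rot A) (map_zero rot)
  exact h1.smul_left (f := fun x => (b x)⁻¹)

/-- Fields with a stream function are solenoidal. -/
theorem IsDepth.integral_fderiv_streamField (hb : IsDepth b bᵢ bₛ) {h ψ : Plane → ℝ}
    (hh : ContDiff ℝ ∞ h) (hψ : ContDiff ℝ ∞ ψ) (hψs : HasCompactSupport ψ) :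
    ∫ x, fderiv ℝ ψ x (streamField b h x) ∂(depthMeasure b) = 0 := by
  have hc : ∀ {g : Plane → ℝ}, ContDiff ℝ ∞ g → ∀ i, Continuous fun x => fderiv ℝ g x (coordVec i) :=
    fun hg i => (hg.continuous_fderiv (by norm_num)).clm_apply continuous_const
  have hi : ∀ i j, Integrable (fun x => fderiv ℝ ψ x (coordVec i) * fderiv ℝ h x (coordVec j)) volume :=
    fun i j => ((hc hψ i).mul (hc hh j)).integrable_of_hasCompactSupport
      (hψs.fderiv_apply ℝ _).mul_right
  rw [hb.integral_depthMeasure]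
  have e : ∀ x, b x • fderiv ℝ ψ x (streamField b h x) =
      fderiv ℝ ψ x (coordVec 0) * fderiv ℝ h x (coordVec 1) -
        fderiv ℝ ψ x (coordVec 1) * fderiv ℝ h x (coordVec 0) := by
    intro x
    have := (hb.pos x).ne'
    rw [streamField, map_smul, rot_apply, map_sub, map_smul, map_smul]
    simp only [smul_eq_mul]
    field_simp
  simp_rw [e]
  rw [integral_sub (hi 0 1) (hi 1 0), integral_fderiv_mul_eq hψ hh hψs, sub_self]

end StreamFunctions

/-! ### Estimates for localised stream functions -/

section LocalBounds

variable {b : Plane → ℝ} {bᵢ bₛ : ℝ}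

theorem eLpNorm_two_sq {E : Type*} [NormedAddCommGroup E] {α : Type*} [MeasurableSpace α]
    (μ : Measure α) (f : α → E) : eLpNorm f 2 μ ^ 2 = ∫⁻ x, ‖f x‖ₑ ^ 2 ∂μ := by
  have := eLpNorm_nnreal_pow_eq_lintegral (f := f) (μ := μ) (p := 2) (by norm_num)
  simpa using this

/-- The Poincaré inequality in terms of the field with stream function `h`. -/
theorem exists_eLpNorm_le_rot_fderiv {R : ℝ} (hR : 1 ≤ R) : ∃ C : ℝ≥0∞, C ≠ ⊤ ∧ ∀ h : Plane → ℝ,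
    ContDiff ℝ 1 h → ∫ x in Metric.ball 0 1, h x = 0 →
    eLpNorm h 2 (volume.restrict (Metric.ball 0 R)) ≤
      C * eLpNorm (fun x => rot (fderiv ℝ h x)) 2 (volume.restrict (Metric.ball 0 R)) := by
  obtain ⟨C, hC, hP⟩ := exists_lintegral_sq_le_fderiv hR
  refine ⟨C ^ (1 / 2 : ℝ) * 2, by finiteness, fun h hh h0 => ?_⟩
  have h1 := hP h hh h0
  rw [← eLpNorm_two_sq, ← eLpNorm_two_sq] at h1
  have h2 : eLpNorm (fderiv ℝ h) 2 (volume.restrict (Metric.ball 0 R)) ≤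
      2 * eLpNorm (fun x => rot (fderiv ℝ h x)) 2 (volume.restrict (Metric.ball 0 R)) := by
    have := eLpNorm_le_mul_eLpNorm_of_ae_le_mul (f := fderiv ℝ h)
      (g := fun x => rot (fderiv ℝ h x)) (c := 2) (μ := volume.restrict (Metric.ball 0 R))
      (Eventually.of_forall fun x => norm_le_two_mul_norm_rot _) 2
    simpa using this
  have hsq : ∀ a : ℝ≥0∞, (a ^ 2) ^ (1 / 2 : ℝ) = a := fun a => by
    rw [← ENNReal.rpow_natCast, ← ENNReal.rpow_mul]; norm_num
  have h3 := ENNReal.rpow_le_rpow h1 (z := 1 / 2) (by norm_num)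
  rw [ENNReal.mul_rpow_of_nonneg _ _ (by norm_num), hsq, hsq] at h3
  rw [mul_assoc]
  exact h3.trans (by gcongr)

theorem eLpNorm_le_add_add {α E₁ E₂ E₃ F : Type*} [MeasurableSpace α] {μ : Measure α}
    [NormedAddCommGroup E₁] [NormedAddCommGroup E₂] [NormedAddCommGroup E₃] [NormedAddCommGroup F]
    {f : α → F} {p : α → E₁} {q : α → E₂} {r : α → E₃} {K : ℝ} (hp : AEStronglyMeasurable p μ)
    (hq : AEStronglyMeasurable q μ) (hr : AEStronglyMeasurable r μ)
    (h : ∀ x, ‖f x‖ ≤ K * (‖p x‖ + ‖q x‖ + ‖r x‖)) :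
    eLpNorm f 2 μ ≤ ENNReal.ofReal K * (eLpNorm p 2 μ + eLpNorm q 2 μ + eLpNorm r 2 μ) := by
  have h1 := eLpNorm_le_mul_eLpNorm_of_ae_le_mul (f := f) (c := K)
    (g := (fun x => ‖p x‖) + (fun x => ‖q x‖) + fun x => ‖r x‖) (μ := μ)
    (Eventually.of_forall fun x => by
      rw [Pi.add_apply, Pi.add_apply, Real.norm_of_nonneg (by positivity)]
      exact h x) 2
  refine h1.trans ?_
  gcongr
  refine (eLpNorm_add_le (hp.norm.add hq.norm) hr.norm (by norm_num)).trans ?_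
  rw [eLpNorm_norm]
  gcongr
  refine (eLpNorm_add_le hp.norm hq.norm (by norm_num)).trans ?_
  rw [eLpNorm_norm, eLpNorm_norm]

theorem tsupport_streamField_subset (h : Plane → ℝ) : tsupport (streamField b h) ⊆ tsupport h := by
  refine closure_minimal (fun x hx => ?_) (isClosed_tsupport h)
  refine support_fderiv_subset ℝ (f := h) fun h0 => hx ?_
  simp only [streamField, h0, map_zero, smul_zero]

/-- The field with stream function `θ h`, where `θ` is a cutoff function, is controlled in `H¹` by
the field `m = (∂₁ h, - ∂₀ h)` and its gradient near the support of `θ`. -/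
theorem IsDepth.exists_eLpNorm_streamField_le (hb : IsDepth b bᵢ bₛ) {θ : Plane → ℝ}
    (hθ : ContDiff ℝ ∞ θ) {R : ℝ} (hR : 1 ≤ R) (hθs : tsupport θ ⊆ Metric.ball 0 R) :
    ∃ C : ℝ≥0∞, C ≠ ⊤ ∧ ∀ (h : Plane → ℝ) (m : Plane → Plane), ContDiff ℝ ∞ h →
      ∫ x in Metric.ball 0 1, h x = 0 → (∀ x, rot (fderiv ℝ h x) = m x) →
      eLpNorm (streamField b fun x => θ x * h x) 2 volume ≤
        C * (eLpNorm m 2 (volume.restrict (Metric.ball 0 R)) + ∑ i,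
          eLpNorm (fun x => fderiv ℝ m x (coordVec i)) 2 (volume.restrict (Metric.ball 0 R))) ∧
      ∀ i, eLpNorm (fun x => fderiv ℝ (streamField b fun x => θ x * h x) x (coordVec i)) 2 volume ≤
        C * (eLpNorm m 2 (volume.restrict (Metric.ball 0 R)) + ∑ i,
          eLpNorm (fun x => fderiv ℝ m x (coordVec i)) 2 (volume.restrict (Metric.ball 0 R))) := by
  obtain ⟨C, hC, hP⟩ := exists_eLpNorm_le_rot_fderiv hR
  have hcs : HasCompactSupport θ :=
    HasCompactSupport.of_support_subset_isCompact (isCompact_closedBall (0 : Plane) R)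
      ((subset_tsupport θ).trans (hθs.trans Metric.ball_subset_closedBall))
  set α : Plane → ℝ := fun x => (b x)⁻¹ * θ x with hα
  set β : Plane → Plane := streamField b θ with hβ
  have hαc : ContDiff ℝ ∞ α := hb.contDiff_inv.mul hθ
  have hαs : HasCompactSupport α := hcs.mul_left
  have hβc : ContDiff ℝ ∞ β := hb.contDiff_streamField hθ
  have hβs : HasCompactSupport β := hasCompactSupport_streamField hcs
  obtain ⟨A₁, hA₁⟩ := hαs.exists_bound_of_continuous hαc.continuous
  obtain ⟨A₂, hA₂⟩ := hβs.exists_bound_of_continuous hβc.continuous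
  obtain ⟨A₃, hA₃⟩ := (hαs.fderiv ℝ).exists_bound_of_continuous
    (hαc.continuous_fderiv (by norm_num))
  obtain ⟨A₄, hA₄⟩ := (hβs.fderiv ℝ).exists_bound_of_continuous
    (hβc.continuous_fderiv (by norm_num))
  have n1 := (norm_nonneg _).trans (hA₁ 0)
  have n2 := (norm_nonneg _).trans (hA₂ 0)
  have n3 := (norm_nonneg _).trans (hA₃ 0)
  have n4 := (norm_nonneg _).trans (hA₄ 0)
  set A := A₁ + 2 * A₂ + A₃ + A₄ with hA
  have hA0 : 0 ≤ A := by positivity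
  refine ⟨ENNReal.ofReal A * (1 + C), by finiteness, fun h m hh h0 hm => ?_⟩
  have hmc : ContDiff ℝ ∞ m := by
    have : m = fun x => rot (fderiv ℝ h x) := funext fun x => (hm x).symm
    rw [this]
    exact rot.contDiff.comp (hh.fderiv_right (m := ∞) (by norm_num))
  have hz : (streamField b fun x => θ x * h x) = fun x => α x • m x + h x • β x := by
    ext1 x
    have hd := ((hθ.differentiable (by norm_num) x).hasFDerivAt.mul
      (hh.differentiable (by norm_num) x).hasFDerivAt).fderiv
    change fderiv ℝ (fun x => θ x * h x) x = _ at hd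
    simp only [streamField, hd, map_add, map_smul, hm, hα, hβ, smul_add, smul_smul]
    rw [mul_comm (b x)⁻¹ (h x)]
  have hdz : ∀ x e, fderiv ℝ (streamField b fun x => θ x * h x) x e =
      (α x • fderiv ℝ m x e + fderiv ℝ α x e • m x) +
        (h x • fderiv ℝ β x e + fderiv ℝ h x e • β x) := by
    intro x e
    have hd := (((hαc.differentiable (by norm_num) x).hasFDerivAt.smul
      (hmc.differentiable (by norm_num) x).hasFDerivAt).add
      ((hh.differentiable (by norm_num) x).hasFDerivAt.smul
      (hβc.differentiable (by norm_num) x).hasFDerivAt)).fderiv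
    change fderiv ℝ (fun x => α x • m x + h x • β x) x = _ at hd
    rw [hz, hd]
    rfl
  set B : Set Plane := Metric.ball 0 R with hB
  set N := eLpNorm m 2 (volume.restrict B) + ∑ i,
    eLpNorm (fun x => fderiv ℝ m x (coordVec i)) 2 (volume.restrict B) with hN
  have hdm : ∀ i : Fin 2, Continuous fun x => fderiv ℝ m x (coordVec i) := fun i =>
    (hmc.continuous_fderiv (by norm_num)).clm_apply continuous_const
  have hts : tsupport (streamField b fun x => θ x * h x) ⊆ B :=
    (tsupport_streamField_subset _).trans ((tsupport_mul_subset_left (f := θ) (g := h)).trans hθs)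
  have hmN : eLpNorm m 2 (volume.restrict B) ≤ N := le_self_add
  have hhN : eLpNorm h 2 (volume.restrict B) ≤ C * N := by
    refine (hP h (hh.of_le (by exact_mod_cast le_top)) h0).trans ?_
    simp only [hm]
    gcongr
  have hdN : ∀ i, eLpNorm m 2 (volume.restrict B) +
      eLpNorm (fun x => fderiv ℝ m x (coordVec i)) 2 (volume.restrict B) ≤ N := by
    intro i
    rw [hN]
    gcongr
    exact Finset.single_le_sum (f := fun i =>
      eLpNorm (fun x => fderiv ℝ m x (coordVec i)) 2 (volume.restrict B)) (fun _ _ => zero_le)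
      (Finset.mem_univ i)
  have hfin : ∀ i, ENNReal.ofReal A * (eLpNorm m 2 (volume.restrict B) +
      eLpNorm (fun x => fderiv ℝ m x (coordVec i)) 2 (volume.restrict B) +
      eLpNorm h 2 (volume.restrict B)) ≤ ENNReal.ofReal A * (1 + C) * N := by
    intro i
    rw [mul_assoc, add_mul, one_mul]
    gcongr
    exact hdN i
  have hbound : ∀ x, ‖α x • m x + h x • β x‖ ≤ A * (‖m x‖ + ‖h x‖) := by
    intro x
    calc _ ≤ ‖α x‖ * ‖m x‖ + ‖h x‖ * ‖β x‖ := by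
          refine (norm_add_le _ _).trans ?_
          rw [norm_smul, norm_smul]
      _ ≤ A * ‖m x‖ + ‖h x‖ * A := by
          gcongr
          · linarith [hA₁ x]
          · linarith [hA₂ x]
      _ = _ := by ring
  constructor
  · rw [← eLpNorm_restrict_eq_of_support_subset ((subset_tsupport _).trans hts), hz]
    refine le_trans (eLpNorm_le_add_add hmc.continuous.aestronglyMeasurable
      (hdm 0).aestronglyMeasurable hh.continuous.aestronglyMeasurable fun x => ?_) (hfin 0)
    refine (hbound x).trans ?_
    gcongr
    linarith [norm_nonneg (fderiv ℝ m x (coordVec 0))]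
  · intro i
    have hsupp : Function.support (fun x => fderiv ℝ (streamField b fun x => θ x * h x) x (coordVec i))
        ⊆ B := by
      refine fun x hx => hts (support_fderiv_subset ℝ fun h0 => hx ?_)
      simp only [h0, zero_apply]
    rw [← eLpNorm_restrict_eq_of_support_subset hsupp]
    refine le_trans (eLpNorm_le_add_add hmc.continuous.aestronglyMeasurable
      (hdm i).aestronglyMeasurable hh.continuous.aestronglyMeasurable fun x => ?_) (hfin i)
    rw [hdz]
    have hop : ∀ {F : Type} [NormedAddCommGroup F] [NormedSpace ℝ F] (L : Plane →L[ℝ] F),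
        ‖L (coordVec i)‖ ≤ ‖L‖ := fun L => by simpa using L.le_opNorm (coordVec i)
    have b1 : ‖fderiv ℝ h x (coordVec i)‖ ≤ 2 * ‖m x‖ := by
      rw [← hm x]; exact (hop _).trans (norm_le_two_mul_norm_rot _)
    have b2 := (hop (fderiv ℝ α x)).trans (hA₃ x)
    have b3 := (hop (fderiv ℝ β x)).trans (hA₄ x)
    calc _ ≤ (‖α x‖ * ‖fderiv ℝ m x (coordVec i)‖ + ‖fderiv ℝ α x (coordVec i)‖ * ‖m x‖) +
          (‖h x‖ * ‖fderiv ℝ β x (coordVec i)‖ + ‖fderiv ℝ h x (coordVec i)‖ * ‖β x‖) := by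
          refine (norm_add_le _ _).trans (add_le_add ?_ ?_) <;>
          · refine (norm_add_le _ _).trans ?_
            rw [norm_smul, norm_smul]
      _ ≤ (A₁ * ‖fderiv ℝ m x (coordVec i)‖ + A₃ * ‖m x‖) + (‖h x‖ * A₄ + 2 * ‖m x‖ * A₂) := by
          gcongr
          · exact hA₁ x
          · exact hA₂ x
      _ ≤ _ := by
          have p1 := norm_nonneg (m x)
          have p2 := norm_nonneg (h x)
          have p3 := norm_nonneg (fderiv ℝ m x (coordVec i))
          have q1 : A₁ * ‖fderiv ℝ m x (coordVec i)‖ ≤ A * ‖fderiv ℝ m x (coordVec i)‖ := by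
            gcongr; linarith
          have q2 : (A₃ + 2 * A₂) * ‖m x‖ ≤ A * ‖m x‖ := by gcongr; linarith
          have q3 : A₄ * ‖h x‖ ≤ A * ‖h x‖ := by gcongr; linarith
          linarith

end LocalBounds

/-! ### Mollification on balls -/

section LocalMollification

theorem locallyIntegrable_of_forall_ball {F : Type*} [NormedAddCommGroup F] {g : Plane → F}
    (hg : ∀ R, MemLp g 2 (volume.restrict (Metric.ball 0 R))) : LocallyIntegrable g volume := by
  intro x
  refine ⟨Metric.ball 0 (‖x‖ + 1), Metric.isOpen_ball.mem_nhds (by simp), ?_⟩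
  have : IsFiniteMeasure (volume.restrict (Metric.ball (0 : Plane) (‖x‖ + 1))) :=
    ⟨by rw [Measure.restrict_apply_univ]; exact measure_ball_lt_top⟩
  exact (hg (‖x‖ + 1)).integrable (by norm_num)

variable {F : Type*} [NormedAddCommGroup F] [NormedSpace ℝ F]

/-- On a ball, the mollification only depends on the function in a slightly larger ball. -/
theorem mollify_indicator_eq (ρ : ContDiffBump (0 : Plane)) (hρ : ρ.rOut ≤ 1) (g : Plane → F)
    {R : ℝ} {x : Plane} (hx : x ∈ Metric.ball 0 R) :
    mollify ρ ((Metric.ball 0 (R + 1)).indicator g) x = mollify ρ g x := by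
  refine integral_congr_ae (Eventually.of_forall fun t => ?_)
  simp only [ContinuousLinearMap.lsmul_apply]
  by_cases ht : t ∈ Metric.ball (0 : Plane) ρ.rOut
  · rw [indicator_of_mem]
    rw [mem_ball_zero_iff] at *
    linarith [norm_sub_le x t]
  · rw [← ρ.support_normed_eq (μ := volume), Function.notMem_support] at ht
    rw [ht, zero_smul, zero_smul]

theorem exists_eLpNorm_mollify_sub_ball_le [CompleteSpace F] {g : Plane → F}
    (hg : ∀ R, MemLp g 2 (volume.restrict (Metric.ball 0 R))) (R : ℝ) {ε : ℝ≥0∞} (hε : 0 < ε) :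
    ∃ δ > 0, ∀ ρ : ContDiffBump (0 : Plane), ρ.rOut < δ →
      eLpNorm (mollify ρ g - g) 2 (volume.restrict (Metric.ball 0 R)) ≤ ε := by
  have h1 : MemLp ((Metric.ball 0 (R + 1)).indicator g) 2 volume :=
    (memLp_indicator_iff_restrict measurableSet_ball).2 (hg _)
  obtain ⟨δ, hδ, h⟩ := exists_eLpNorm_mollify_sub_le h1 hε
  refine ⟨min δ 1, by positivity, fun ρ hρ => ?_⟩
  refine le_trans ?_ (h ρ (hρ.trans_le (min_le_left _ _)))
  refine le_trans (le_of_eq (eLpNorm_congr_ae ?_)) (eLpNorm_mono_measure _ Measure.restrict_le_self)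
  filter_upwards [ae_restrict_mem measurableSet_ball] with x hx
  rw [Pi.sub_apply, Pi.sub_apply, mollify_indicator_eq ρ (hρ.le.trans (min_le_right _ _)) g hx,
    indicator_of_mem (Metric.ball_subset_ball (by linarith) hx)]

/-- A sequence of bump functions whose radii tend to zero. -/
noncomputable def bumpSeq (n : ℕ) : ContDiffBump (0 : Plane) :=
  ⟨1 / (2 * ((n : ℝ) + 1)), 1 / ((n : ℝ) + 1), by positivity, by
    apply one_div_lt_one_div_of_lt <;> linarith [(Nat.cast_nonneg n : (0 : ℝ) ≤ n)]⟩

theorem tendsto_bumpSeq : Tendsto (fun n => (bumpSeq n).rOut) atTop (𝓝 0) :=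
  tendsto_one_div_add_atTop_nhds_zero_nat

theorem tendsto_eLpNorm_mollify_sub [CompleteSpace F] {g : Plane → F} (hg : MemLp g 2 volume) :
    Tendsto (fun n => eLpNorm (mollify (bumpSeq n) g - g) 2 volume) atTop (𝓝 0) := by
  rw [ENNReal.tendsto_nhds_zero]
  intro ε hε
  obtain ⟨δ, hδ, h⟩ := exists_eLpNorm_mollify_sub_le hg hε
  filter_upwards [tendsto_bumpSeq.eventually (gt_mem_nhds hδ)] with n hn using h _ hn

theorem tendsto_eLpNorm_mollify_sub_ball [CompleteSpace F] {g : Plane → F}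
    (hg : ∀ R, MemLp g 2 (volume.restrict (Metric.ball 0 R))) (R : ℝ) :
    Tendsto (fun n => eLpNorm (mollify (bumpSeq n) g - g) 2 (volume.restrict (Metric.ball 0 R)))
      atTop (𝓝 0) := by
  rw [ENNReal.tendsto_nhds_zero]
  intro ε hε
  obtain ⟨δ, hδ, h⟩ := exists_eLpNorm_mollify_sub_ball_le hg R hε
  filter_upwards [tendsto_bumpSeq.eventually (gt_mem_nhds hδ)] with n hn using h _ hn

end LocalMollification

/-! ### Smooth approximation of the flux `b u` -/

section Flux

variable {b : Plane → ℝ} {bᵢ bₛ : ℝ}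

theorem memLp_ball_continuous_smul {F : Type*} [NormedAddCommGroup F] [NormedSpace ℝ F] {a : Plane → ℝ}
    (ha : Continuous a) {g : Plane → F} (hg : MemLp g 2 volume) (R : ℝ) :
    MemLp (fun x => a x • g x) 2 (volume.restrict (Metric.ball 0 R)) := by
  obtain ⟨C, hC⟩ := (isCompact_closedBall (0 : Plane) R).exists_bound_of_continuousOn ha.continuousOn
  refine (hg.mono_measure Measure.restrict_le_self).of_le_mul (c := C)
    (ha.aestronglyMeasurable.smul hg.1.restrict) ?_
  filter_upwards [ae_restrict_mem measurableSet_ball] with x hx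
  rw [norm_smul]
  gcongr
  exact hC x (Metric.ball_subset_closedBall hx)

/-- The product rule for weak derivatives. -/
theorem HasWeakGrad.smul_contDiff {F : Type*} [NormedAddCommGroup F] [NormedSpace ℝ F]
    {g : Plane → F} {G : Fin 2 → Plane → F} (hgG : HasWeakGrad g G) (hg : LocallyIntegrable g volume)
    (hG : ∀ i, LocallyIntegrable (G i) volume) {a : Plane → ℝ} (ha : ContDiff ℝ ∞ a) :
    HasWeakGrad (fun x => a x • g x) (fun i x => a x • G i x + fderiv ℝ a x (coordVec i) • g x) := by
  intro i ψ hψ hψs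
  have hda : Continuous fun x => fderiv ℝ a x (coordVec i) :=
    (ha.continuous_fderiv (by norm_num)).clm_apply continuous_const
  have hdψ : Continuous fun x => fderiv ℝ ψ x (coordVec i) :=
    (hψ.continuous_fderiv (by norm_num)).clm_apply continuous_const
  have hψa : ContDiff ℝ ∞ fun x => ψ x * a x := hψ.mul ha
  have h1 := hgG i _ hψa hψs.mul_right
  have hd : ∀ x, fderiv ℝ (fun x => ψ x * a x) x (coordVec i) =
      ψ x * fderiv ℝ a x (coordVec i) + a x * fderiv ℝ ψ x (coordVec i) := by
    intro x
    have := ((hψ.differentiable (by norm_num) x).hasFDerivAt.mul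
      (ha.differentiable (by norm_num) x).hasFDerivAt).fderiv
    change fderiv ℝ (fun x => ψ x * a x) x = _ at this
    rw [this]
    rfl
  have i1 : Integrable (fun x => (ψ x * fderiv ℝ a x (coordVec i)) • g x) volume :=
    hg.integrable_smul_left_of_hasCompactSupport (hψ.continuous.mul hda) hψs.mul_right
  have i2 : Integrable (fun x => (a x * fderiv ℝ ψ x (coordVec i)) • g x) volume :=
    hg.integrable_smul_left_of_hasCompactSupport (ha.continuous.mul hdψ)
      (hψs.fderiv_apply ℝ (coordVec i)).mul_left
  have i3 : Integrable (fun x => (ψ x * a x) • G i x) volume :=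
    (hG i).integrable_smul_left_of_hasCompactSupport hψa.continuous hψs.mul_right
  simp only [hd, add_smul] at h1
  rw [integral_add i1 i2] at h1
  simp only [smul_add, smul_smul]
  rw [integral_add i3 i1, neg_add, ← h1, add_neg_cancel_comm]
  simp only [mul_comm]

/-- The flux `b u` of a field `u` in `V` is the limit of smooth fields with stream functions
`h n`, its mollifications. The convergence of the gradients is only local, as `∇b` may be unbounded.
-/
theorem exists_smooth_flux (hb : IsDepth b bᵢ bₛ) {x : Jet b} (hx : x ∈ solSobolev hb) :
    ∃ (h : ℕ → Plane → ℝ) (G : Fin 2 → Plane → Plane), (∀ n, ContDiff ℝ ∞ (h n)) ∧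
      (∀ n, ∫ t in Metric.ball 0 1, h n t = 0) ∧
      Tendsto (fun n => eLpNorm ((fun t => rot (fderiv ℝ (h n) t)) - fun t => b t • x 0 t) 2 volume)
        atTop (𝓝 0) ∧
      (∀ R i, MemLp (G i) 2 (volume.restrict (Metric.ball 0 R))) ∧
      ∀ R i, Tendsto (fun n => eLpNorm ((fun t => fderiv ℝ (fun t => rot (fderiv ℝ (h n) t)) t
        (coordVec i)) - G i) 2 (volume.restrict (Metric.ball 0 R))) atTop (𝓝 0) := by
  set g : Plane → Plane := fun t => b t • x 0 t with hg
  set G : Fin 2 → Plane → Plane := fun i t => b t • x i.succ t + fderiv ℝ b t (coordVec i) • x 0 t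
    with hG
  have hgm : MemLp g 2 volume := by
    refine (hb.memLp_volume (x 0)).of_le_mul (c := bₛ)
      (hb.contDiff.continuous.aestronglyMeasurable.smul (hb.memLp_volume (x 0)).1)
      (Eventually.of_forall fun t => ?_)
    rw [norm_smul, Real.norm_of_nonneg (hb.pos t).le]
    gcongr
    exact hb.le_upper t
  have hGm : ∀ R i, MemLp (G i) 2 (volume.restrict (Metric.ball 0 R)) := fun R i =>
    (memLp_ball_continuous_smul hb.contDiff.continuous (hb.memLp_volume _) R).add
      (memLp_ball_continuous_smul ((hb.contDiff.continuous_fderiv (by norm_num)).clm_apply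
        continuous_const) (hb.memLp_volume _) R)
  have hGl : ∀ i, LocallyIntegrable (G i) volume := fun i =>
    locallyIntegrable_of_forall_ball fun R => hGm R i
  have hgl : LocallyIntegrable g volume := hgm.locallyIntegrable (by norm_num)
  have hgG : HasWeakGrad g G := (mem_sobolev_iff.1 hx.1).smul_contDiff
    ((hb.memLp_volume _).locallyIntegrable (by norm_num))
    (fun i => (hb.memLp_volume _).locallyIntegrable (by norm_num)) hb.contDiff
  have hcoord : ∀ {f : Plane → Plane}, LocallyIntegrable f volume → ∀ j : Fin 2,
      LocallyIntegrable (fun t => f t j) volume := fun hf j x => by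
    obtain ⟨s, hs, hi⟩ := hf x
    exact ⟨s, hs, (EuclideanSpace.proj j : Plane →L[ℝ] ℝ).integrable_comp hi⟩
  -- the divergence of the flux vanishes
  have hdiv : ∀ᵐ t, G 0 t 0 + G 1 t 1 = 0 := by
    refine ae_eq_zero_of_integral_contDiff_smul_eq_zero
      ((hcoord (hGl 0) 0).add (hcoord (hGl 1) 1)) fun ψ hψ hψs => ?_
    have i1 : ∀ i, Integrable (fun t => ψ t • G i t) volume := fun i =>
      (hGl i).integrable_smul_left_of_hasCompactSupport hψ.continuous hψs
    have i2 : ∀ i, Integrable (fun t => fderiv ℝ ψ t (coordVec i) • g t) volume := fun i =>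
      hgl.integrable_smul_left_of_hasCompactSupport
        ((hψ.continuous_fderiv (by norm_num)).clm_apply continuous_const)
        (hψs.fderiv_apply ℝ _)
    have e1 : ∀ i j : Fin 2, ∫ t, ψ t * G i t j = - ∫ t, fderiv ℝ ψ t (coordVec i) * g t j := by
      intro i j
      have := congrArg (EuclideanSpace.proj j : Plane →L[ℝ] ℝ) (hgG i ψ hψ hψs)
      rw [map_neg, ← ContinuousLinearMap.integral_comp_comm _ (i2 i),
        ← ContinuousLinearMap.integral_comp_comm _ (i1 i)] at this
      simp only [map_smul, PiLp.proj_apply, smul_eq_mul] at this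
      rw [this, neg_neg]
    have i3 : ∀ i j : Fin 2, Integrable (fun t => ψ t * G i t j) volume := fun i j =>
      (EuclideanSpace.proj j : Plane →L[ℝ] ℝ).integrable_comp (i1 i)
    have i4 : ∀ i j : Fin 2, Integrable (fun t => fderiv ℝ ψ t (coordVec i) * g t j) volume :=
      fun i j => (EuclideanSpace.proj j : Plane →L[ℝ] ℝ).integrable_comp (i2 i)
    have e2 := hx.2 ψ hψ hψs
    rw [hb.integral_depthMeasure] at e2
    have e3 : ∀ t, b t • fderiv ℝ ψ t (x 0 t) =
        fderiv ℝ ψ t (coordVec 0) * g t 0 + fderiv ℝ ψ t (coordVec 1) * g t 1 := by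
      intro t
      conv_lhs => rw [eq_add_coordVec (x 0 t)]
      rw [map_add, map_smul, map_smul]
      simp only [hg, PiLp.smul_apply, smul_eq_mul]
      ring
    simp only [e3] at e2
    rw [integral_add (i4 0 0) (i4 1 1)] at e2
    simp only [smul_eq_mul, mul_add]
    rw [integral_add (i3 0 0) (i3 1 1), e1, e1]
    linarith
  have hmdiv : ∀ n t, fderiv ℝ (mollify (bumpSeq n) g) t (coordVec 0) 0 +
      fderiv ℝ (mollify (bumpSeq n) g) t (coordVec 1) 1 = 0 := by
    intro n t
    rw [fderiv_mollify_apply _ hgG hgl, fderiv_mollify_apply _ hgG hgl]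
    set ρ := bumpSeq n
    have hi : ∀ i, Integrable (fun s => ρ.normed volume s • G i (t - s)) volume := fun i =>
      ρ.hasCompactSupport_normed.convolutionExists_left
        (ContinuousLinearMap.lsmul ℝ ℝ : ℝ →L[ℝ] Plane →L[ℝ] Plane) ρ.continuous_normed (hGl i) t
    have hc : ∀ i j : Fin 2, mollify ρ (G i) t j = ∫ s, ρ.normed volume s * G i (t - s) j := by
      intro i j
      have := (EuclideanSpace.proj j : Plane →L[ℝ] ℝ).integral_comp_comm (hi i)
      simp only [map_smul, PiLp.proj_apply, smul_eq_mul] at this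
      rw [this]
      rfl
    have hi' : ∀ i j : Fin 2, Integrable (fun s => ρ.normed volume s * G i (t - s) j) volume :=
      fun i j => (EuclideanSpace.proj j : Plane →L[ℝ] ℝ).integrable_comp (hi i)
    rw [hc, hc, ← integral_add (hi' 0 0) (hi' 1 1)]
    refine integral_eq_zero_of_ae ?_
    filter_upwards [(Measure.measurePreserving_sub_left (volume : Measure Plane)
      t).quasiMeasurePreserving.ae hdiv] with s hs
    rw [← mul_add, hs, mul_zero, Pi.zero_apply]
  choose h hh hhm hh0 using fun n => exists_stream (contDiff_mollify (bumpSeq n) hgl) (hmdiv n)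
  have hfun : ∀ n, (fun t => rot (fderiv ℝ (h n) t)) = mollify (bumpSeq n) g := fun n =>
    funext (hhm n)
  refine ⟨h, G, hh, hh0, ?_, hGm, fun R i => ?_⟩
  · simp only [hfun]
    exact tendsto_eLpNorm_mollify_sub hgm
  · have e : ∀ n, (fun t => fderiv ℝ (fun t => rot (fderiv ℝ (h n) t)) t (coordVec i)) =
        mollify (bumpSeq n) (G i) := fun n => by
      ext1 t
      rw [hfun, fderiv_mollify_apply _ hgG hgl]
    simp only [e]
    exact tendsto_eLpNorm_mollify_sub_ball (fun R => hGm R i) R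

end Flux

/-! ### Localised fields in `V` -/

section Density

variable {b : Plane → ℝ} {bᵢ bₛ : ℝ}

/-- The field with a given stream function, with its gradient, as an element of `V`. -/
theorem IsDepth.exists_streamJet (hb : IsDepth b bᵢ bₛ) {k : Plane → ℝ} (hk : ContDiff ℝ ∞ k)
    (hks : HasCompactSupport k) : ∃ y ∈ solSobolev hb, y 0 =ᵐ[volume] streamField b k ∧
      ∀ i : Fin 2, y i.succ =ᵐ[volume] fun t => fderiv ℝ (streamField b k) t (coordVec i) := by
  have hz := hb.contDiff_streamField hk
  have hzs := hasCompactSupport_streamField (b := b) hks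
  obtain ⟨y, hy, hy0, hy1⟩ := hb.exists_jet (hasWeakGrad_of_contDiff
    (hz.of_le (by exact_mod_cast le_top))) (hz.continuous.memLp_of_hasCompactSupport hzs) (fun i =>
      ((hz.continuous_fderiv (by norm_num)).clm_apply continuous_const).memLp_of_hasCompactSupport
        (hzs.fderiv_apply ℝ (coordVec i)))
  refine ⟨y, ⟨hy, fun ψ hψ hψs => ?_⟩, hy0, hy1⟩
  rw [← hb.integral_fderiv_streamField hk hψ hψs]
  refine integral_congr_ae ?_
  filter_upwards [hb.ae_iff.2 hy0] with t ht
  rw [ht]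

theorem IsDepth.enorm_jet_le (hb : IsDepth b bᵢ bₛ) {y : Jet b} {w : Plane → Plane}
    {W : Fin 2 → Plane → Plane} (h0 : y 0 =ᵐ[volume] w) (h1 : ∀ i : Fin 2, y i.succ =ᵐ[volume] W i) :
    ‖y‖ₑ ≤ ENNReal.ofReal bₛ ^ (1 / 2 : ℝ≥0∞).toReal *
      (eLpNorm w 2 volume + ∑ i, eLpNorm (W i) 2 volume) := by
  calc ‖y‖ₑ ≤ ENNReal.ofReal (‖y 0‖ + ∑ i : Fin 2, ‖y i.succ‖) := by
        rw [← ofReal_norm]; exact ENNReal.ofReal_le_ofReal (Jet.norm_le_sum y)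
    _ = ‖y 0‖ₑ + ∑ i : Fin 2, ‖y i.succ‖ₑ := by
        rw [ENNReal.ofReal_add (norm_nonneg _) (Finset.sum_nonneg fun _ _ => norm_nonneg _),
          ENNReal.ofReal_sum_of_nonneg fun _ _ => norm_nonneg _]
        simp only [ofReal_norm]
    _ ≤ _ := by
        rw [mul_add, Finset.mul_sum]
        gcongr with i
        · exact hb.enorm_le _ h0
        · exact hb.enorm_le _ (h1 i)

/-- Restriction of a field to the ball of radius `r`, extended by zero. -/
noncomputable def restrictBall (b : Plane → ℝ) (r : ℝ) : L2b b →L[ℝ] L2b b :=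
  mulL2 Plane (g := (Metric.ball (0 : Plane) r).indicator fun _ => (1 : ℝ))
    (memLp_top_of_bounds (measurable_const.indicator measurableSet_ball) (m := 0) (M := 1) fun x =>
      ⟨indicator_nonneg (fun _ _ => zero_le_one) x, indicator_le_self' (fun _ _ => zero_le_one) x⟩)

theorem IsDepth.coeFn_restrictBall (hb : IsDepth b bᵢ bₛ) (r : ℝ) (f : L2b b) :
    restrictBall b r f =ᵐ[volume] (Metric.ball (0 : Plane) r).indicator f := by
  filter_upwards [hb.ae_iff.1 (coeFn_mulL2 (E := Plane) _ f)] with x hx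
  rw [restrictBall, hx]
  by_cases h : x ∈ Metric.ball (0 : Plane) r <;> simp [h]

theorem IsDepth.restrictBall_eq_iff (hb : IsDepth b bᵢ bₛ) {r : ℝ} {f : L2b b} {g : L2b b} :
    restrictBall b r f = restrictBall b r g ↔
      ∀ᵐ x : Plane, x ∈ Metric.ball (0 : Plane) r → f x = g x := by
  constructor
  · intro h
    filter_upwards [hb.coeFn_restrictBall r f, hb.coeFn_restrictBall r g] with x h1 h2 hx
    rw [← indicator_of_mem hx f, ← h1, h, h2, indicator_of_mem hx]
  · intro h
    refine Lp.ext (hb.ae_iff.2 ?_)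
    filter_upwards [hb.coeFn_restrictBall r f, hb.coeFn_restrictBall r g, h] with x h1 h2 h3
    rw [h1, h2]
    by_cases hx : x ∈ Metric.ball (0 : Plane) r
    · rw [indicator_of_mem hx, indicator_of_mem hx, h3 hx]
    · rw [indicator_of_notMem hx, indicator_of_notMem hx]

theorem streamField_congr {h k : Plane → ℝ} {s : Set Plane} (hs : IsOpen s) (hhk : EqOn h k s)
    {x : Plane} (hx : x ∈ s) : streamField b h x = streamField b k x := by
  rw [streamField, streamField, (hhk.eventuallyEq_of_mem (hs.mem_nhds hx)).fderiv_eq]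

theorem streamField_cutoff_mul {R : ℝ} (hR : 0 < R) (h : Plane → ℝ) {x : Plane}
    (hx : x ∈ Metric.ball (0 : Plane) R) :
    streamField b (fun t => cutoff R t * h t) x = streamField b h x := by
  refine streamField_congr Metric.isOpen_ball (fun t ht => ?_) hx
  rw [cutoff_eq_one hR (mem_ball_zero_iff.1 ht).le, one_mul]

/-- The fields with stream functions `θ h n`, for a cutoff function `θ`, converge in `H¹_b`, to a
field which agrees with `x 0` where `θ = 1`. -/
theorem IsDepth.exists_tendsto_streamJet (hb : IsDepth b bᵢ bₛ) {x : Jet b} {h : ℕ → Plane → ℝ}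
    {G : Fin 2 → Plane → Plane} (hh : ∀ n, ContDiff ℝ ∞ (h n))
    (hh0 : ∀ n, ∫ t in Metric.ball 0 1, h n t = 0)
    (hm : Tendsto (fun n => eLpNorm ((fun t => rot (fderiv ℝ (h n) t)) - fun t => b t • x 0 t) 2
      volume) atTop (𝓝 0))
    (hG : ∀ R i, MemLp (G i) 2 (volume.restrict (Metric.ball 0 R)))
    (hdm : ∀ R i, Tendsto (fun n => eLpNorm ((fun t => fderiv ℝ (fun t => rot (fderiv ℝ (h n) t)) t
        (coordVec i)) - G i) 2 (volume.restrict (Metric.ball 0 R))) atTop (𝓝 0))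
    {R : ℝ} (hR : 1 ≤ R) :
    ∃ (y : ℕ → Jet b) (z : Jet b), (∀ n, y n ∈ solSobolev hb) ∧ z ∈ solSobolev hb ∧
      Tendsto y atTop (𝓝 z) ∧
      (∀ n, y n 0 =ᵐ[volume] streamField b fun t => cutoff R t * h n t) ∧
      restrictBall b R (z 0) = restrictBall b R (x 0) := by
  have hR0 : 0 < R := by linarith
  have hRR : 1 ≤ 2 * R + 1 := by linarith
  have hθs : tsupport (cutoff R) ⊆ Metric.ball 0 (2 * R + 1) := by
    refine (closure_minimal (fun t ht => ?_) Metric.isClosed_closedBall).trans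
      (Metric.closedBall_subset_ball (by linarith : 2 * R < 2 * R + 1))
    rw [mem_closedBall_zero_iff]
    by_contra! h
    exact ht (cutoff_eq_zero hR0 h.le)
  set B : Set Plane := Metric.ball 0 (2 * R + 1) with hB
  obtain ⟨C, hC, hL⟩ := hb.exists_eLpNorm_streamField_le (contDiff_cutoff R) hRR hθs
  have hck : ∀ n, ContDiff ℝ ∞ fun t => cutoff R t * h n t := fun n => (contDiff_cutoff R).mul (hh n)
  choose y hy hy0 hy1 using fun n => hb.exists_streamJet (hck n) (hasCompactSupport_cutoff hR0).mul_right
  set g : Plane → Plane := fun t => b t • x 0 t with hg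
  have hgm : AEStronglyMeasurable g volume :=
    hb.contDiff.continuous.aestronglyMeasurable.smul (hb.memLp_volume _).1
  set m : ℕ → Plane → Plane := fun n t => rot (fderiv ℝ (h n) t) with hmdef
  have hmc : ∀ n, ContDiff ℝ ∞ (m n) := fun n =>
    rot.contDiff.comp ((hh n).fderiv_right (m := ∞) (by norm_num))
  have hdmc : ∀ n i, Continuous fun t => fderiv ℝ (m n) t (coordVec i) := fun n i =>
    ((hmc n).continuous_fderiv (by norm_num)).clm_apply continuous_const
  -- distance of the smooth flux to the limiting flux
  set a : ℕ → ℝ≥0∞ := fun n => eLpNorm (m n - g) 2 volume + ∑ i : Fin 2,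
    eLpNorm ((fun t => fderiv ℝ (m n) t (coordVec i)) - G i) 2 (volume.restrict B) with ha
  have ha0 : Tendsto a atTop (𝓝 0) := by
    have := hm.add (tendsto_finsetSum Finset.univ fun (i : Fin 2) _ => hdm (2 * R + 1) i)
    simp only [add_zero, Finset.sum_const_zero] at this
    exact this
  set K : ℝ≥0∞ := ENNReal.ofReal bₛ ^ (1 / 2 : ℝ≥0∞).toReal with hK
  have hKt : K ≠ ⊤ := by simp [hK]
  have hcau : ∀ n k, ‖y n - y k‖ₑ ≤ K * (3 * C) * (a n + a k) := by
    intro n k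
    have hdh : ∀ t, fderiv ℝ (fun t => h n t - h k t) t = fderiv ℝ (h n) t - fderiv ℝ (h k) t :=
      fun t => fderiv_fun_sub ((hh n).differentiable (by norm_num) t)
        ((hh k).differentiable (by norm_num) t)
    have hint : ∀ n, IntegrableOn (h n) (Metric.ball 0 1) volume := fun n =>
      (hh n).continuous.continuousOn.integrableOn_compact (isCompact_closedBall (0 : Plane) 1)
        |>.mono_set Metric.ball_subset_closedBall
    obtain ⟨l0, l1⟩ := hL (fun t => h n t - h k t) (m n - m k) ((hh n).sub (hh k))
      (by rw [integral_sub (hint n) (hint k), hh0, hh0, sub_zero])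
      (fun t => by rw [hdh, map_sub]; rfl)
    set Z := streamField b fun t => cutoff R t * (h n t - h k t) with hZ
    have hZe : Z = (streamField b fun t => cutoff R t * h n t) -
        streamField b fun t => cutoff R t * h k t := by
      ext1 t
      have e : (fun t => cutoff R t * (h n t - h k t)) =
          fun t => cutoff R t * h n t - cutoff R t * h k t := by ext t; ring
      rw [hZ, e]
      simp only [streamField, Pi.sub_apply]
      rw [fderiv_fun_sub ((hck n).differentiable (by norm_num) t)
        ((hck k).differentiable (by norm_num) t), map_sub, smul_sub]
    have hN : eLpNorm (m n - m k) 2 (volume.restrict B) + ∑ i,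
        eLpNorm (fun t => fderiv ℝ (m n - m k) t (coordVec i)) 2 (volume.restrict B) ≤ a n + a k := by
      have tri : ∀ {μ : Measure Plane} {p q r : Plane → Plane}, AEStronglyMeasurable p μ →
          AEStronglyMeasurable q μ → AEStronglyMeasurable r μ →
          eLpNorm (p - q) 2 μ ≤ eLpNorm (p - r) 2 μ + eLpNorm (q - r) 2 μ := by
        intro μ p q r hp hq hr
        have := eLpNorm_sub_le (hp.sub hr) (hq.sub hr) (p := 2) (by norm_num)
        rwa [sub_sub_sub_cancel_right] at this
      have e : ∀ i, (fun t => fderiv ℝ (m n - m k) t (coordVec i)) =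
          (fun t => fderiv ℝ (m n) t (coordVec i)) - fun t => fderiv ℝ (m k) t (coordVec i) := by
        intro i
        ext1 t
        rw [fderiv_sub ((hmc n).differentiable (by norm_num) t)
          ((hmc k).differentiable (by norm_num) t)]
        rfl
      have n0 := (eLpNorm_mono_measure (m n - m k) (p := 2) (Measure.restrict_le_self (s := B))).trans
        (tri (hmc n).continuous.aestronglyMeasurable (hmc k).continuous.aestronglyMeasurable hgm)
      have n1 := fun i : Fin 2 => tri (hdmc n i).aestronglyMeasurable (hdmc k i).aestronglyMeasurable
        (hG (2 * R + 1) i).1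
      simp only [e]
      calc _ ≤ _ := add_le_add n0 (Finset.sum_le_sum fun i _ => n1 i)
        _ = a n + a k := by rw [Finset.sum_add_distrib, ha]; ring
    have q0 : (y n - y k) 0 =ᵐ[volume] Z := by
      rw [hZe]
      filter_upwards [hb.ae_iff.1 (Lp.coeFn_sub (y n 0) (y k 0)), hy0 n, hy0 k] with t h1 h2 h3
      rw [Pi.sub_apply, ← h2, ← h3]
      exact h1
    have q1 : ∀ i : Fin 2, (y n - y k) i.succ =ᵐ[volume] fun t => fderiv ℝ Z t (coordVec i) := by
      intro i
      rw [hZe]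
      filter_upwards [hb.ae_iff.1 (Lp.coeFn_sub (y n i.succ) (y k i.succ)), hy1 n i, hy1 k i]
        with t h1 h2 h3
      rw [fderiv_sub ((hb.contDiff_streamField (hck n)).differentiable (by norm_num) t)
        ((hb.contDiff_streamField (hck k)).differentiable (by norm_num) t), sub_apply, ← h2, ← h3]
      exact h1
    calc ‖y n - y k‖ₑ ≤ K * (eLpNorm Z 2 volume +
          ∑ i : Fin 2, eLpNorm (fun t => fderiv ℝ Z t (coordVec i)) 2 volume) := hb.enorm_jet_le q0 q1
      _ ≤ K * (C * (a n + a k) + ∑ i : Fin 2, C * (a n + a k)) := by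
          gcongr with i
          · exact l0.trans (by gcongr)
          · exact (l1 i).trans (by gcongr)
      _ = K * (3 * C) * (a n + a k) := by
          rw [Fin.sum_univ_two]; ring
  have hseq : CauchySeq y := by
    rw [EMetric.cauchySeq_iff]
    intro ε hε
    have ht : Tendsto (fun n => K * (3 * C) * a n) atTop (𝓝 0) := by
      have := ENNReal.Tendsto.const_mul (a := K * (3 * C)) ha0 (Or.inr (by finiteness))
      rwa [mul_zero] at this
    obtain ⟨N, hN⟩ := eventually_atTop.1 (ht.eventually (gt_mem_nhds (ENNReal.half_pos hε.ne')))
    refine ⟨N, fun n hn k hk => ?_⟩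
    calc edist (y n) (y k) = ‖y n - y k‖ₑ := edist_eq_enorm_sub _ _
      _ ≤ K * (3 * C) * a n + K * (3 * C) * a k := by rw [← mul_add]; exact hcau n k
      _ < ε / 2 + ε / 2 := ENNReal.add_lt_add (hN n hn) (hN k hk)
      _ = ε := ENNReal.add_halves ε
  obtain ⟨z, hz⟩ := cauchySeq_tendsto_of_complete hseq
  refine ⟨y, z, hy, (isClosed_solSobolev hb).mem_of_tendsto hz (Eventually.of_forall hy), hz, hy0, ?_⟩
  have t1 : Tendsto (fun n => restrictBall b R (y n 0)) atTop (𝓝 (restrictBall b R (z 0))) :=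
    ((restrictBall b R).continuous.tendsto _).comp
      (((PiLp.proj 2 (fun _ : Fin 3 => L2b b) 0 : Jet b →L[ℝ] L2b b).continuous.tendsto z).comp hz)
  refine tendsto_nhds_unique t1 ?_
  rw [tendsto_iff_edist_tendsto_0]
  have t2 : Tendsto (fun n => K * (ENNReal.ofReal bᵢ⁻¹ * a n)) atTop (𝓝 0) := by
    have := ENNReal.Tendsto.const_mul (a := K) (ENNReal.Tendsto.const_mul
      (a := ENNReal.ofReal bᵢ⁻¹) ha0 (Or.inr ENNReal.ofReal_ne_top)) (Or.inr hKt)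
    rwa [mul_zero, mul_zero] at this
  refine tendsto_of_tendsto_of_tendsto_of_le_of_le tendsto_const_nhds t2 (fun _ => zero_le)
    fun n => ?_
  simp only
  rw [edist_eq_enorm_sub, ← map_sub]
  refine (hb.enorm_le _ (hb.coeFn_restrictBall _ _)).trans ?_
  refine mul_le_mul_right ?_ _
  refine le_trans (eLpNorm_le_mul_eLpNorm_of_ae_le_mul (g := m n - g) (c := bᵢ⁻¹) ?_ 2)
    (by gcongr; exact le_self_add)
  filter_upwards [hb.ae_iff.1 (Lp.coeFn_sub (y n 0) (x 0)), hy0 n] with t h1 h2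
  by_cases ht : t ∈ Metric.ball (0 : Plane) R
  · have e : (y n 0 - x 0 : L2b b) t = (b t)⁻¹ • (m n - g) t := by
      rw [h1, Pi.sub_apply, h2, streamField_cutoff_mul hR0 _ ht, Pi.sub_apply, smul_sub, hg, smul_smul,
        inv_mul_cancel₀ (hb.pos t).ne', one_smul]
      rfl
    rw [indicator_of_mem ht, e, norm_smul, norm_inv, Real.norm_of_nonneg (hb.pos t).le]
    gcongr
    · exact hb.lower_pos
    · exact hb.lower_le t
  · rw [indicator_of_notMem ht, norm_zero]
    have := hb.lower_pos
    positivity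

end Density

/-! ### Density of smooth fields in `V` -/

section SmoothFields

variable {b : Plane → ℝ} {bᵢ bₛ : ℝ}

/-- A series of smooth functions whose `j`-th term vanishes on the ball of radius `j` is, locally,
a finite sum. -/
theorem exists_contDiff_eq_sum {W : ℕ → Plane → Plane} (hW : ∀ j, ContDiff ℝ ∞ (W j))
    (h0 : ∀ (j : ℕ) (x : Plane), ‖x‖ < j → W j x = 0) :
    ∃ F : Plane → Plane, ContDiff ℝ ∞ F ∧ ∀ (N : ℕ) (x : Plane), ‖x‖ < N →
      F x = ∑ j ∈ Finset.range N, W j x := by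
  have key : ∀ (N : ℕ) (x : Plane), ‖x‖ < N →
      ∑ j ∈ Finset.range (⌊‖x‖⌋₊ + 1), W j x = ∑ j ∈ Finset.range N, W j x := by
    intro N x hx
    have h1 : ⌊‖x‖⌋₊ + 1 ≤ N := Nat.floor_lt (norm_nonneg x) |>.2 hx
    refine Finset.sum_subset (Finset.range_subset_range.2 h1) fun j _ hj => h0 j x ?_
    rw [Finset.mem_range, not_lt] at hj
    exact (Nat.lt_floor_add_one ‖x‖).trans_le (by exact_mod_cast hj)
  refine ⟨fun x => ∑ j ∈ Finset.range (⌊‖x‖⌋₊ + 1), W j x, ?_, key⟩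
  rw [contDiff_iff_contDiffAt]
  intro x
  obtain ⟨N, hN⟩ := exists_nat_gt ‖x‖
  have h1 : ContDiff ℝ ∞ fun x => ∑ j ∈ Finset.range N, W j x := ContDiff.sum fun j _ => hW j
  refine h1.contDiffAt.congr_of_eventuallyEq ?_
  filter_upwards [Metric.isOpen_ball.mem_nhds (mem_ball_zero_iff.2 hN)] with t ht
  exact key N t (mem_ball_zero_iff.1 ht)

theorem coeFn_sum_range (f : ℕ → L2b b) (N : ℕ) :
    (∑ j ∈ Finset.range N, f j : L2b b) =ᵐ[depthMeasure b] fun t => ∑ j ∈ Finset.range N, f j t := by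
  induction N with
  | zero =>
    filter_upwards [Lp.coeFn_zero Plane 2 (depthMeasure b)] with t ht
    simpa using ht
  | succ N ih =>
    rw [Finset.sum_range_succ]
    filter_upwards [ih, Lp.coeFn_add (∑ j ∈ Finset.range N, f j) (f N)] with t h1 h2
    rw [h2, Pi.add_apply, h1, Finset.sum_range_succ]

/-- Smooth fields `w j n` in `V` which converge in `V` as `n → ∞`, to limits `Z j` which
agree with the given field on the ball of radius `j`. -/
theorem exists_smooth_localisation (hb : IsDepth b bᵢ bₛ) {x : Jet b} (hx : x ∈ solSobolev hb) :
    ∃ (w : ℕ → ℕ → Plane → Plane) (Y : ℕ → ℕ → Jet b) (Z : ℕ → Jet b),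
      (∀ j n, ContDiff ℝ ∞ (w j n)) ∧ (∀ j n, Y j n ∈ solSobolev hb) ∧
      (∀ j, Z j ∈ solSobolev hb) ∧ (∀ j, Tendsto (Y j) atTop (𝓝 (Z j))) ∧
      (∀ j n, Y j n 0 =ᵐ[volume] w j n) ∧ Z 0 = 0 ∧
      (∀ (j k n : ℕ) (t : Plane), 1 ≤ j → j ≤ k → ‖t‖ < j → w k n t = w j n t) ∧
      ∀ j : ℕ, 1 ≤ j → restrictBall b (j : ℝ) (Z j 0) = restrictBall b (j : ℝ) (x 0) := by
  obtain ⟨h, G, hh, hh0, hm, hG, hdm⟩ := exists_smooth_flux hb hx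
  have hR : ∀ j : ℕ, (1 : ℝ) ≤ (j + 1 : ℕ) := fun j => by
    push_cast; linarith [(Nat.cast_nonneg j : (0 : ℝ) ≤ j)]
  choose y z hy hz hyz hy0 hz0 using fun j : ℕ =>
    hb.exists_tendsto_streamJet hh hh0 hm hG hdm (hR j)
  refine ⟨fun j n => Nat.casesOn j 0 fun k => streamField b fun t => cutoff (k + 1 : ℕ) t * h n t,
    fun j n => Nat.casesOn j 0 fun k => y k n, fun j => Nat.casesOn j 0 fun k => z k,
    ?_, ?_, ?_, ?_, ?_, rfl, ?_, ?_⟩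
  · rintro (_ | j) n
    · exact contDiff_const
    · exact hb.contDiff_streamField ((contDiff_cutoff _).mul (hh _))
  · rintro (_ | j) n; exacts [zero_mem _, hy j n]
  · rintro (_ | j); exacts [zero_mem _, hz j]
  · rintro (_ | j); exacts [tendsto_const_nhds, hyz j]
  · rintro (_ | j) n
    · exact hb.ae_iff.1 (Lp.coeFn_zero _ _ _)
    · exact hy0 j n
  · rintro (_ | j) (_ | k) n t hj hjk ht
    · omega
    · omega
    · omega
    · have hkr : ((j + 1 : ℕ) : ℝ) ≤ (k + 1 : ℕ) := by exact_mod_cast hjk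
      change streamField b (fun t => cutoff (k + 1 : ℕ) t * h n t) t =
        streamField b (fun t => cutoff (j + 1 : ℕ) t * h n t) t
      rw [streamField_cutoff_mul (by linarith [hR k]) (h n) (mem_ball_zero_iff.2 (ht.trans_le hkr)),
        streamField_cutoff_mul (by linarith [hR j]) (h n) (mem_ball_zero_iff.2 ht)]
  · rintro (_ | j) hj
    · omega
    · exact hz0 j

/-- A field in `V` with a smooth representative. -/
def IsSmoothJet (x : Jet b) : Prop := ∃ F : Plane → Plane, ContDiff ℝ ∞ F ∧ x 0 =ᵐ[volume] F

/-- Smooth fields are dense in `V`. The gradient of `b` may be unbounded, so that mollifying `b u`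
is not enough: the stream function of `b u` is localised by a partition of unity, and each piece
is smoothed with its own precision. -/
theorem dense_isSmoothJet (hb : IsDepth b bᵢ bₛ) :
    Dense {x : solSobolev hb | IsSmoothJet (x : Jet b)} := by
  rw [Metric.dense_iff]
  rintro ⟨x, hx⟩ r hr
  obtain ⟨w, Y, Z, hwc, hYV, hZV, hYZ, hYw, hZ0, hw, hZx⟩ := exists_smooth_localisation hb hx
  have hn : ∀ j : ℕ, ∃ n, ‖(Y (j + 1) n - Y j n) - (Z (j + 1) - Z j)‖ ≤ r / 4 * (1 / 2) ^ j := by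
    intro j
    have h1 : Tendsto (fun n => ‖(Y (j + 1) n - Y j n) - (Z (j + 1) - Z j)‖) atTop (𝓝 0) := by
      have := (((hYZ (j + 1)).sub (hYZ j)).sub (tendsto_const_nhds (x := Z (j + 1) - Z j))).norm
      rwa [sub_self, norm_zero] at this
    exact (h1.eventually (ge_mem_nhds (by positivity : 0 < r / 4 * (1 / 2) ^ j))).exists
  choose n hn using hn
  set W : ℕ → Plane → Plane := fun j => w (j + 1) (n j) - w j (n j) with hW
  have hWc : ∀ j, ContDiff ℝ ∞ (W j) := fun j => (hwc _ _).sub (hwc _ _)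
  have hW0 : ∀ (j : ℕ) (t : Plane), ‖t‖ < j → W j t = 0 := by
    intro j t ht
    have hj : 1 ≤ j := by
      rw [Nat.one_le_iff_ne_zero]
      rintro rfl
      exact absurd ht (by simp)
    simp only [hW, Pi.sub_apply, hw j (j + 1) (n j) t hj (by omega) ht, sub_self]
  obtain ⟨F, hF, hFW⟩ := exists_contDiff_eq_sum hWc hW0
  -- with `Z 0 = 0`, the telescoping series of the `Z (j + 1) - Z j` represents `x` on each ball;
  -- the sum of the errors `e j` turns it into a series of smooth fields
  set e : ℕ → Jet b := fun j => (Y (j + 1) (n j) - Y j (n j)) - (Z (j + 1) - Z j) with he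
  have hsum : Summable fun j : ℕ => r / 4 * (1 / 2 : ℝ) ^ j := summable_geometric_two.mul_left _
  have hes : Summable e := Summable.of_norm_bounded hsum hn
  have hev : ‖∑' j, e j‖ ≤ r / 2 := by
    have := tsum_of_norm_bounded (hsum.hasSum) hn
    rw [tsum_mul_left, tsum_geometric_two] at this
    linarith
  have heV : ∀ j, e j ∈ solSobolev hb := fun j =>
    sub_mem (sub_mem (hYV _ _) (hYV _ _)) (sub_mem (hZV _) (hZV _))
  have htV : ∑' j, e j ∈ solSobolev hb :=
    (isClosed_solSobolev hb).mem_of_tendsto hes.hasSum.tendsto_sum_nat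
      (Eventually.of_forall fun N => sum_mem fun j _ => heV j)
  -- on each ball the sum of the series is a finite sum of smooth fields
  have hball : ∀ N : ℕ, ∀ᵐ t : Plane, ‖t‖ < (N + 1 : ℕ) → (x + ∑' j, e j) 0 t = F t := by
    intro N
    set P : Jet b →L[ℝ] L2b b := (restrictBall b ((N + 1 : ℕ) : ℝ)).comp
      (PiLp.proj 2 (fun _ : Fin 3 => L2b b) 0 : Jet b →L[ℝ] L2b b) with hP
    have hPa : ∀ v : Jet b, P v = restrictBall b ((N + 1 : ℕ) : ℝ) (v 0) := fun v => rfl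
    have hPY : ∀ j, N + 1 ≤ j → ∀ n, P (Y (j + 1) n - Y j n) = 0 := by
      intro j hj n
      rw [map_sub, sub_eq_zero, hPa, hPa]
      refine hb.restrictBall_eq_iff.2 ?_
      filter_upwards [hYw (j + 1) n, hYw j n] with t h1 h2 ht
      rw [mem_ball_zero_iff] at ht
      rw [h1, h2, hw (N + 1) (j + 1) n t (by omega) (by omega) ht, hw (N + 1) j n t (by omega) hj ht]
    have hPZ : ∀ j, N + 1 ≤ j → P (Z (j + 1) - Z j) = 0 := by
      intro j hj
      have h1 : Tendsto (fun n => P (Y (j + 1) n - Y j n)) atTop (𝓝 (P (Z (j + 1) - Z j))) :=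
        (P.continuous.tendsto _).comp ((hYZ (j + 1)).sub (hYZ j))
      simp only [hPY j hj] at h1
      exact tendsto_nhds_unique h1 tendsto_const_nhds
    have hPe : P (∑' j, e j) = ∑ j ∈ Finset.range (N + 1), P (Y (j + 1) (n j) - Y j (n j)) -
        P x := by
      have hPx : P (Z (N + 1)) = P x := by rw [hPa, hPa, hZx (N + 1) (by omega)]
      rw [P.map_tsum hes, tsum_eq_sum (s := Finset.range (N + 1)) (fun j hj => ?_)]
      · have h1 : ∀ j, P (e j) = P (Y (j + 1) (n j) - Y j (n j)) - (P (Z (j + 1)) - P (Z j)) :=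
          fun j => by rw [he, map_sub, map_sub P (Z (j + 1))]
        simp only [h1]
        rw [Finset.sum_sub_distrib, Finset.sum_range_sub (fun j => P (Z j)), hPx, hZ0, map_zero,
          sub_zero]
      · rw [Finset.mem_range, not_lt] at hj
        rw [he, map_sub, hPY j hj, hPZ j hj, sub_zero]
    have hPx : restrictBall b ((N + 1 : ℕ) : ℝ) ((x + ∑' j, e j) 0) = restrictBall b ((N + 1 : ℕ) : ℝ)
        (∑ j ∈ Finset.range (N + 1), (Y (j + 1) (n j) - Y j (n j)) 0) := by
      rw [← hPa, map_add, hPe, map_sum, add_sub_cancel]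
      rfl
    have hYae : ∀ᵐ t : Plane, ∀ j, (Y (j + 1) (n j) - Y j (n j)) 0 t = W j t := by
      rw [ae_all_iff]
      intro j
      filter_upwards [hb.ae_iff.1 (Lp.coeFn_sub (Y (j + 1) (n j) 0) (Y j (n j) 0)),
        hYw (j + 1) (n j), hYw j (n j)] with t h1 h2 h3
      change _ = (w (j + 1) (n j) - w j (n j)) t
      rw [Pi.sub_apply, ← h2, ← h3]
      exact h1
    filter_upwards [hb.restrictBall_eq_iff.1 hPx, hb.ae_iff.1 (coeFn_sum_range
      (fun j => (Y (j + 1) (n j) - Y j (n j)) 0) (N + 1)), hYae] with t h1 h2 h3 ht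
    rw [hFW (N + 1) t ht, h1 (mem_ball_zero_iff.2 ht), h2]
    exact Finset.sum_congr rfl fun j _ => h3 j
  refine ⟨⟨x + ∑' j, e j, add_mem hx htV⟩, ?_, F, hF, ?_⟩
  · rw [Metric.mem_ball, Subtype.dist_eq, dist_eq_norm, add_sub_cancel_left]
    linarith
  filter_upwards [ae_all_iff.2 hball] with t ht
  obtain ⟨N, hN⟩ := exists_nat_gt ‖t‖
  exact ht N (hN.trans (by push_cast; linarith))

end SmoothFields

/-! ### The forms on `V` -/

section Forms

variable {b : Plane → ℝ} {bᵢ bₛ : ℝ}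

/-- Korn's inequality in terms of the dissipation. -/
theorem sum_norm_le_sqrt_dissipation (hb : IsDepth b bᵢ bₛ) {ν η : Plane → ℝ}
    (hν : MemLp ν ⊤ (depthMeasure b))
    (hη : MemLp η ⊤ (depthMeasure b)) {νᵢ : ℝ} (hνᵢ : 0 < νᵢ) (hνl : ∀ x, νᵢ ≤ ν x)
    (hη0 : ∀ x, 0 < η x) (x : sobolev hb) :
    ∑ i : Fin 2, ‖(x : Jet b) i.succ‖ ≤
      √(2 * (bₛ / (2 * bᵢ * νᵢ))) * √(dissipation hb hν hη x x) := by
  have hbi := hb.lower_pos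
  have hbs := hb.upper_pos
  have h1 := sum_norm_sq_le_dissipation hb hν hη hνᵢ hνl hη0 x
  rw [← Real.sqrt_mul (by positivity)]
  refine Real.le_sqrt_of_sq_le ?_
  rw [Fin.sum_univ_two] at *
  nlinarith [sq_nonneg (‖(x : Jet b) (Fin.succ 0)‖ - ‖(x : Jet b) (Fin.succ 1)‖)]

/-- The embedding of `V` into `H¹_b`. -/
noncomputable def toSobolev (hb : IsDepth b bᵢ bₛ) : solSobolev hb →L[ℝ] sobolev hb :=
  (solSobolev hb).subtypeL.codRestrict (sobolev hb) fun x => x.2.1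

theorem coe_toSobolev (hb : IsDepth b bᵢ bₛ) (x : solSobolev hb) :
    ((toSobolev hb x : sobolev hb) : Jet b) = x := rfl

/-- The embedding of `V` into `L²_b`. -/
noncomputable def toField (hb : IsDepth b bᵢ bₛ) : solSobolev hb →L[ℝ] L2b b :=
  (component hb 0).comp (toSobolev hb)

theorem toField_apply (hb : IsDepth b bᵢ bₛ) (x : solSobolev hb) :
    toField hb x = (x : Jet b) 0 := rfl

variable {ν η : Plane → ℝ}

/-- The dissipation form on `V`. -/
noncomputable def solDissipation (hb : IsDepth b bᵢ bₛ) (hν : MemLp ν ⊤ (depthMeasure b))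
    (hη : MemLp η ⊤ (depthMeasure b)) : solSobolev hb →L[ℝ] solSobolev hb →L[ℝ] ℝ :=
  (dissipation hb hν hη).bilinearComp (toSobolev hb) (toSobolev hb)

theorem solDissipation_apply (hb : IsDepth b bᵢ bₛ) (hν : MemLp ν ⊤ (depthMeasure b))
    (hη : MemLp η ⊤ (depthMeasure b)) (v w : solSobolev hb) :
    solDissipation hb hν hη v w = dissipation hb hν hη (toSobolev hb v) (toSobolev hb w) := rfl

/-- The convective term `v ↦ (w ↦ (v ⬝ ∇v, w)_b)` on `V`. -/
noncomputable def solConvection (hb : IsDepth b bᵢ bₛ) (v : solSobolev hb) : solSobolev hb →L[ℝ] ℝ :=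
  (convection hb (toSobolev hb v) (toSobolev hb v)).comp (toSobolev hb)

theorem solConvection_apply (hb : IsDepth b bᵢ bₛ) (v w : solSobolev hb) :
    solConvection hb v w = convection hb (toSobolev hb v) (toSobolev hb v) (toSobolev hb w) := rfl

theorem continuous_solConvection (hb : IsDepth b bᵢ bₛ) : Continuous (solConvection hb) := by
  have h1 : Continuous fun v : solSobolev hb => convection hb (toSobolev hb v) (toSobolev hb v) :=
    Continuous.comp (g := fun p : sobolev hb × sobolev hb => convection hb p.1 p.2)
      (f := fun v => (toSobolev hb v, toSobolev hb v)) (continuous_convection hb)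
      ((toSobolev hb).continuous.prodMk (toSobolev hb).continuous)
  exact h1.clm_comp continuous_const

theorem solConvection_self (hb : IsDepth b bᵢ bₛ) (v : solSobolev hb) :
    solConvection hb v v = 0 := by
  have h1 := convection_eq_neg hb (u := toSobolev hb v) v.2.2 (toSobolev hb v) (toSobolev hb v)
  rw [solConvection_apply]
  linarith

/-- Skew symmetry moves the derivative to the test field, and Ladyzhenskaya's inequality bounds
the two factors `v` that remain. -/
theorem exists_abs_solConvection_le (hb : IsDepth b bᵢ bₛ) (hν : MemLp ν ⊤ (depthMeasure b))
    (hη : MemLp η ⊤ (depthMeasure b)) {νᵢ : ℝ} (hνᵢ : 0 < νᵢ) (hνl : ∀ x, νᵢ ≤ ν x)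
    (hη0 : ∀ x, 0 < η x) : ∃ C, 0 ≤ C ∧ ∀ v w, |solConvection hb v w| ≤ C * ‖toField hb v‖ *
      √(solDissipation hb hν hη v v) * √(solDissipation hb hν hη w w) := by
  obtain ⟨C, hC, hL⟩ := exists_norm_sobolevToL4_sq_le hb
  have hbi := hb.lower_pos
  have hbs := hb.upper_pos
  set κ := 2 * (bₛ / (2 * bᵢ * νᵢ)) with hκ
  have hκ0 : 0 ≤ κ := by positivity
  refine ⟨C * κ, by positivity, fun v w => ?_⟩
  rw [solConvection_apply, convection_eq_neg hb (u := toSobolev hb v) v.2.2, abs_neg]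
  have h1 := abs_convection_le hb (toSobolev hb v) (toSobolev hb w) (toSobolev hb v)
  have hv := sum_norm_le_sqrt_dissipation hb hν hη hνᵢ hνl hη0 (toSobolev hb v)
  have hw := sum_norm_le_sqrt_dissipation hb hν hη hνᵢ hνl hη0 (toSobolev hb w)
  rw [← pow_two] at h1
  calc _ ≤ _ := h1
    _ ≤ C * (‖toField hb v‖ * (√κ * √(solDissipation hb hν hη v v))) *
        (√κ * √(solDissipation hb hν hη w w)) := by
        refine mul_le_mul ((hL (toSobolev hb v)).trans ?_) hw
          (Finset.sum_nonneg fun _ _ => norm_nonneg _) (by positivity)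
        exact mul_le_mul_of_nonneg_left (mul_le_mul_of_nonneg_left hv (norm_nonneg _)) hC
    _ = C * (√κ * √κ) * ‖toField hb v‖ * √(solDissipation hb hν hη v v) *
        √(solDissipation hb hν hη w w) := by ring
    _ = _ := by rw [Real.mul_self_sqrt hκ0]

/-- The dissipation form is coercive on `V` modulo the norm of `L²_b`. -/
theorem norm_sq_le_solDissipation (hb : IsDepth b bᵢ bₛ) (hν : MemLp ν ⊤ (depthMeasure b))
    (hη : MemLp η ⊤ (depthMeasure b)) {νᵢ : ℝ} (hνᵢ : 0 < νᵢ) (hνl : ∀ x, νᵢ ≤ ν x)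
    (hη0 : ∀ x, 0 < η x) (v : solSobolev hb) :
    ‖v‖ ^ 2 ≤ (1 + bₛ / (2 * bᵢ * νᵢ)) * (‖toField hb v‖ ^ 2 + solDissipation hb hν hη v v) := by
  have hbi := hb.lower_pos
  have hbs := hb.upper_pos
  have h1 := sum_norm_sq_le_dissipation hb hν hη hνᵢ hνl hη0 (toSobolev hb v)
  have h2 := dissipation_nonneg hb hν hη (fun x => hνᵢ.trans_le (hνl x)) hη0 (toSobolev hb v)
  have h3 : ‖v‖ ^ 2 = ‖toField hb v‖ ^ 2 + ∑ i : Fin 2, ‖(toSobolev hb v : Jet b) i.succ‖ ^ 2 := by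
    rw [Submodule.coe_norm, PiLp.norm_sq_eq_of_L2, Fin.sum_univ_succ]
    rfl
  rw [h3, solDissipation_apply]
  have h4 : 0 ≤ bₛ / (2 * bᵢ * νᵢ) := by positivity
  nlinarith [sq_nonneg ‖toField hb v‖]

end Forms

/-! ### Weak solutions as functions with values in `V` -/

section Lift

variable {b : Plane → ℝ} {bᵢ bₛ : ℝ}

open Classical in
/-- The function with values in `V` whose components are `u` and `Du`; it is zero at the times,
forming a null set, at which these are not in `V`. -/
noncomputable def lift (hb : IsDepth b bᵢ bₛ) (u : ℝ → L2b b) (Du : Fin 2 → ℝ → L2b b) (t : ℝ) :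
    solSobolev hb :=
  if h : (WithLp.toLp 2 (Fin.cons (u t) fun i => Du i t) : Jet b) ∈ solSobolev hb then ⟨_, h⟩ else 0

theorem ae_coe_lift_eq (hb : IsDepth b bᵢ bₛ) {u : ℝ → L2b b} {Du : Fin 2 → ℝ → L2b b}
    (hu : IsWeaklyContinuous b u) (hD : IsLocallySquareIntegrable b u Du) :
    ∀ᵐ t ∂volume.restrict (Ici (0 : ℝ)),
      (lift hb u Du t : Jet b) = WithLp.toLp 2 (Fin.cons (u t) fun i => Du i t) := by
  filter_upwards [hD.gradient, ae_restrict_mem measurableSet_Ici] with t h1 h2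
  have h : (WithLp.toLp 2 (Fin.cons (u t) fun i => Du i t) : Jet b) ∈ solSobolev hb :=
    ⟨h1, hu.solenoidal t h2⟩
  rw [lift, dif_pos h]

theorem memLp_lift (hb : IsDepth b bᵢ bₛ) {u : ℝ → L2b b} {Du : Fin 2 → ℝ → L2b b}
    (hu : IsWeaklyContinuous b u) (hD : IsLocallySquareIntegrable b u Du) {T : ℝ} (hT : 0 < T) :
    MemLp (lift hb u Du) 2 (volume.restrict (Icc 0 T)) := by
  set x : ℝ → Jet b := fun t => WithLp.toLp 2 (Fin.cons (u t) fun i => Du i t) with hx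
  have hae : ∀ᵐ t ∂volume.restrict (Icc 0 T), (lift hb u Du t : Jet b) = x t :=
    ae_restrict_of_ae_restrict_of_subset Icc_subset_Ici_self (ae_coe_lift_eq hb hu hD)
  have h0 := hD.memLp T hT
  have h1 := hD.memLp_gradient T hT
  have hxm : AEStronglyMeasurable x (volume.restrict (Icc 0 T)) := by
    have hc : Continuous fun p : L2b b × L2b b × L2b b =>
        (WithLp.toLp 2 ![p.1, p.2.1, p.2.2] : Jet b) := by
      refine (PiLp.continuous_toLp 2 _).comp (continuous_pi fun i => ?_)
      fin_cases i
      · exact continuous_fst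
      · exact continuous_fst.comp continuous_snd
      · exact continuous_snd.comp continuous_snd
    refine (hc.comp_aestronglyMeasurable (h0.1.prodMk ((h1 0).1.prodMk (h1 1).1))).congr
      (Eventually.of_forall fun t => ?_)
    simp only [hx]
    congr 1
    ext i
    fin_cases i <;> rfl
  have hm : AEStronglyMeasurable (lift hb u Du) (volume.restrict (Icc 0 T)) :=
    Topology.IsEmbedding.subtypeVal.aestronglyMeasurable_comp_iff.1
      (hxm.congr (hae.mono fun t ht => ht.symm))
  refine ((h0.norm.add ((h1 0).norm.add (h1 1).norm))).of_le hm ?_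
  filter_upwards [hae] with t ht
  rw [Submodule.coe_norm, ht]
  refine (Jet.norm_le_sum _).trans ((le_of_eq ?_).trans (le_abs_self _))
  rw [Fin.sum_univ_two]
  rfl

end Lift

/-! ### The weak formulation for time-independent test fields -/

section Abstract

variable {V H : Type*} [NormedAddCommGroup V] [NormedSpace ℝ V] [NormedAddCommGroup H]
  [InnerProductSpace ℝ H]

/-- If the integrated evolution equation from time `0` holds against a dense set of `V`, then the
equation between two times holds against every vector of `V`: both sides are continuous in the
vector, since the right-hand side is the integral of a function with values in the dual of `V`. -/
theorem evolution_equation_of_dense {ι : V →L[ℝ] H} {A : V →L[ℝ] V →L[ℝ] ℝ} {N : V → V →L[ℝ] ℝ}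
    (hN : Continuous N) {C : ℝ} (hNC : ∀ v, ‖N v‖ ≤ C * ‖v‖ ^ 2) {f u : ℝ → H} {U : ℝ → V}
    (hf : IntegrableOn f (Ici 0) volume)
    (hU : ∀ T, 0 < T → MemLp U 2 (volume.restrict (Icc 0 T))) {S : Set V} (hS : Dense S)
    {c : V → ℝ} (heq : ∀ v ∈ S, ∀ r, 0 ≤ r → inner ℝ (u r) (ι v) +
      ∫ τ in (0 : ℝ)..r, (A (U τ) v + N (U τ) v) = (∫ τ in (0 : ℝ)..r, inner ℝ (ι v) (f τ)) + c v)
    (w : V) (s t : ℝ) (hs : 0 ≤ s) (hst : s ≤ t) :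
    inner ℝ (u t) (ι w) - inner ℝ (u s) (ι w) =
      ∫ τ in s..t, (inner ℝ (f τ) (ι w) - A (U τ) w - N (U τ) w) := by
  have ht : 0 ≤ t := hs.trans hst
  set L : ℝ → V →L[ℝ] ℝ := fun τ => (innerSL ℝ (f τ)).comp ι - A (U τ) - N (U τ) with hL
  have hLii : ∀ r, 0 ≤ r → IntervalIntegrable L volume 0 r := fun r hr => by
    rw [intervalIntegrable_iff_integrableOn_Ioc_of_le hr]
    have hr' : 0 < r + 1 := by linarith
    have hUm := hU (r + 1) hr'
    have hfi : Integrable f (volume.restrict (Icc 0 (r + 1))) := hf.mono_set Icc_subset_Ici_self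
    have i1 : Integrable (fun τ => (innerSL ℝ (f τ)).comp ι) (volume.restrict (Icc 0 (r + 1))) :=
      (hfi.norm.mul_const ‖ι‖).mono'
        (((innerSL ℝ).continuous.clm_comp continuous_const).comp_aestronglyMeasurable hfi.1)
        (Eventually.of_forall fun τ =>
          (ContinuousLinearMap.opNorm_comp_le _ _).trans_eq (by rw [innerSL_apply_norm]))
    have i2 : Integrable (fun τ => A (U τ)) (volume.restrict (Icc 0 (r + 1))) :=
      A.integrable_comp (hUm.integrable (by norm_num))
    have i3 : Integrable (fun τ => N (U τ)) (volume.restrict (Icc 0 (r + 1))) :=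
      ((hUm.integrable_norm_pow (by norm_num)).const_mul C).mono'
        (hN.comp_aestronglyMeasurable hUm.1) (Eventually.of_forall fun τ => hNC _)
    have i : IntegrableOn L (Icc 0 (r + 1)) volume := (i1.sub i2).sub i3
    exact i.mono_set fun x hx => ⟨hx.1.le, by linarith [hx.2]⟩
  have hR : ∀ v : V, ∫ τ in s..t, L τ v =
      ((∫ τ in (0 : ℝ)..t, L τ) - ∫ τ in (0 : ℝ)..s, L τ) v := by
    intro v
    rw [intervalIntegral.integral_interval_sub_left (hLii t ht) (hLii s hs)]
    exact (ContinuousLinearMap.intervalIntegral_apply ((hLii s hs).symm.trans (hLii t ht)) v).symm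
  change inner ℝ (u t) (ι w) - inner ℝ (u s) (ι w) = ∫ τ in s..t, L τ w
  rw [hR]
  refine congrFun (Continuous.ext_on hS
    (f := fun w => inner ℝ (u t) (ι w) - inner ℝ (u s) (ι w))
    (g := fun w => ((∫ τ in (0 : ℝ)..t, L τ) - ∫ τ in (0 : ℝ)..s, L τ) w)
    ((continuous_const.inner ι.continuous).sub (continuous_const.inner ι.continuous))
    (ContinuousLinearMap.continuous _) fun v hv => ?_) w
  have key : ∀ r, 0 ≤ r → inner ℝ (u r) (ι v) = (∫ τ in (0 : ℝ)..r, L τ) v + c v := by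
    intro r hr
    have hfi : IntervalIntegrable (fun τ => inner ℝ (ι v) (f τ)) volume 0 r := by
      rw [intervalIntegrable_iff_integrableOn_Ioc_of_le hr]
      exact Integrable.const_inner _ (hf.mono_set fun x hx => hx.1.le)
    have hLv : IntervalIntegrable (fun τ => L τ v) volume 0 r := by
      have := hLii r hr
      rw [intervalIntegrable_iff_integrableOn_Ioc_of_le hr] at this ⊢
      exact (ContinuousLinearMap.apply ℝ ℝ v).integrable_comp this
    have e : ∀ τ, A (U τ) v + N (U τ) v = inner ℝ (ι v) (f τ) - L τ v := fun τ => by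
      simp only [hL, sub_apply, ContinuousLinearMap.comp_apply, innerSL_apply_apply]
      rw [real_inner_comm]
      ring
    have h1 := heq v hv r hr
    simp only [e] at h1
    rw [intervalIntegral.integral_sub hfi hLv] at h1
    rw [ContinuousLinearMap.intervalIntegral_apply (hLii r hr)]
    linarith
  simp only [sub_apply]
  rw [key t ht, key s hs]
  ring

end Abstract

section WeakSolution

variable {b : Plane → ℝ} {bᵢ bₛ : ℝ} {ν η : Plane → ℝ}

/-- A smooth field in `V`, constant in time, is an admissible test field. -/
theorem isTestField_const (hb : IsDepth b bᵢ bₛ) {w : solSobolev hb} (hw : IsSmoothJet (w : Jet b)) :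
    IsTestField b (fun _ => (w : Jet b) 0) (fun i _ => (w : Jet b) i.succ) (fun _ => 0) := by
  obtain ⟨F, hF, hwF⟩ := hw
  exact
    { smooth := ⟨fun _ => F, (hF.comp contDiff_snd).contDiffOn, fun t _ => hb.ae_iff.2 hwF⟩
      solenoidal := fun _ _ => w.2.2
      gradient := fun _ _ => w.2.1
      continuousOn := continuousOn_const
      continuousOn_gradient := fun _ => continuousOn_const
      hasDeriv := fun t _ => hasDerivWithinAt_const _ _ _
      continuousOn_deriv := continuousOn_const }

/-- The convective term is a quadratic map into the dual of `V`, hence integrable in time along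
functions in `L²` with values in `V`. -/
theorem exists_norm_solConvection_le (hb : IsDepth b bᵢ bₛ) :
    ∃ C, 0 ≤ C ∧ ∀ v, ‖solConvection hb v‖ ≤ C * ‖v‖ ^ 2 := by
  set E := (sobolevToL4 hb).comp (toSobolev hb) with hE
  refine ⟨‖E‖ ^ 2 * 2, by positivity, fun v =>
    ContinuousLinearMap.opNorm_le_bound _ (by positivity) fun w => ?_⟩
  have h1 := abs_convection_le hb (toSobolev hb v) (toSobolev hb v) (toSobolev hb w)
  have h2 : ∑ i : Fin 2, ‖((toSobolev hb v : sobolev hb) : Jet b) i.succ‖ ≤ 2 * ‖v‖ := by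
    rw [Fin.sum_univ_two, two_mul]
    exact add_le_add (Jet.norm_apply_le (v : Jet b) _) (Jet.norm_apply_le (v : Jet b) _)
  calc ‖solConvection hb v w‖ ≤ _ := h1
    _ ≤ (‖E‖ * ‖v‖) * (‖E‖ * ‖w‖) * (2 * ‖v‖) :=
        mul_le_mul (mul_le_mul (E.le_opNorm v) (E.le_opNorm w) (norm_nonneg _) (by positivity)) h2
          (Finset.sum_nonneg fun _ _ => norm_nonneg _) (by positivity)
    _ = _ := by ring

/-- The weak formulation between two times, tested with an arbitrary field in `V` that does not
depend on time. The initial datum cancels. -/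
theorem IsWeakSolution.equation (hb : IsDepth b bᵢ bₛ) (hν : MemLp ν ⊤ (depthMeasure b))
    (hη : MemLp η ⊤ (depthMeasure b)) {f u : ℝ → L2b b} {u₀ : Plane → Plane}
    (hf : IntegrableOn f (Ici 0) volume) (hu : IsWeaklyContinuous b u)
    {Du : Fin 2 → ℝ → L2b b} (hD : IsLocallySquareIntegrable b u Du)
    (heq : ∀ (φ : ℝ → L2b b) (Dφ : Fin 2 → ℝ → L2b b) (φ' : ℝ → L2b b), IsTestField b φ Dφ φ' →
      ∀ t : ℝ, 0 ≤ t →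
        inner ℝ (u t) (φ t) +
          ∫ τ in (0 : ℝ)..t,
            (- inner ℝ (u τ) (φ' τ)
              + viscousForm ν (fun i => Du i τ) (fun i => Dφ i τ)
              + frictionForm η (u τ) (φ τ)
              + convectiveForm (u τ) (fun i => Du i τ) (φ τ)) =
        (∫ τ in (0 : ℝ)..t, inner ℝ (φ τ) (f τ)) +
          ∫ x, inner ℝ (u₀ x) (φ 0 x) ∂(depthMeasure b))
    (w : solSobolev hb) (s t : ℝ) (hs : 0 ≤ s) (hst : s ≤ t) :
    inner ℝ (u t) (toField hb w) - inner ℝ (u s) (toField hb w) =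
      ∫ τ in s..t, (inner ℝ (f τ) (toField hb w) - solDissipation hb hν hη (lift hb u Du τ) w
        - solConvection hb (lift hb u Du τ) w) := by
  obtain ⟨C, -, hcv⟩ := exists_norm_solConvection_le hb
  refine evolution_equation_of_dense (continuous_solConvection hb) hcv hf
    (fun T hT => memLp_lift hb hu hD hT) (dense_isSmoothJet hb)
    (c := fun v => ∫ x, inner ℝ (u₀ x) ((v : Jet b) 0 x) ∂(depthMeasure b))
    (fun v hv r hr => ?_) w s t hs hst
  refine Eq.trans ?_ (heq _ _ _ (isTestField_const hb hv) r hr)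
  refine congrArg (inner ℝ (u r) (toField hb v) + ·) (intervalIntegral.integral_congr_ae' ?_ ?_)
  · filter_upwards [(ae_restrict_iff' measurableSet_Ici).1 (ae_coe_lift_eq hb hu hD)] with τ hτ hτr
    have hτ' := hτ hτr.1.le
    have e0 : u τ = (lift hb u Du τ : Jet b) 0 := by rw [hτ']; rfl
    have e1 : (fun i => Du i τ) = fun i : Fin 2 => (lift hb u Du τ : Jet b) i.succ := by
      rw [hτ']; rfl
    rw [e0, e1, inner_zero_right]
    simp only [solDissipation_apply, solConvection_apply, dissipation_eq, convection_apply,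
      coe_toSobolev]
    ring
  · exact Eventually.of_forall fun τ hτ => absurd (hτ.1.trans_le hτ.2) (by simpa using hr)

end WeakSolution

/-! ### Decay of weak solutions -/

theorem theorem3 (b ν η : Plane → ℝ)
    (hb : ContDiff ℝ ∞ b) (bᵢ bₛ : ℝ) (hbᵢ : 0 < bᵢ) (hb_bounds : ∀ x, bᵢ ≤ b x ∧ b x ≤ bₛ)
    (hν : Measurable ν) (νᵢ νₛ : ℝ) (hνᵢ : 0 < νᵢ) (hν_bounds : ∀ x, νᵢ ≤ ν x ∧ ν x ≤ νₛ)
    (hη : ContDiff ℝ ∞ η) (hη_pos : ∀ x, 0 < η x) (ηₛ : ℝ) (hη_le : ∀ x, η x ≤ ηₛ)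
    (u₀ : Plane → Plane) (hu₀ : MemLp u₀ 2 volume)
    (f : ℝ → L2b b) (hf : IntegrableOn f (Ici 0) volume)
    (u : ℝ → L2b b) (hu : IsWeakSolution b ν η f u₀ u) :
    Tendsto (fun t : ℝ => eLpNorm (u t) 2 (volume : Measure Plane)) atTop (𝓝 0) := by
  have hd : IsDepth b bᵢ bₛ := ⟨hb, hbᵢ, fun x => (hb_bounds x).1, fun x => (hb_bounds x).2⟩
  have hν' : MemLp ν ⊤ (depthMeasure b) := memLp_top_of_bounds hν hν_bounds
  have hη' : MemLp η ⊤ (depthMeasure b) :=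
    memLp_top_of_bounds hη.continuous.measurable fun x => ⟨(hη_pos x).le, hη_le x⟩
  have hνl : ∀ x, νᵢ ≤ ν x := fun x => (hν_bounds x).1
  obtain ⟨huc, Du, hD, heq⟩ := hu
  have : CompleteSpace (solSobolev hd) := (isClosed_solSobolev hd).completeSpace_coe
  obtain ⟨C, hC, hconv⟩ := exists_abs_solConvection_le hd hν' hη' hνᵢ hνl hη_pos
  have hsol : IsDissipativeSolution (toField hd) (solDissipation hd hν' hη') (solConvection hd) C f u
      (lift hd u Du) :=
    { form_symm := fun v w => dissipation_symm hd hν' hη' _ _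
      form_nonneg := fun v => dissipation_nonneg hd hν' hη' (fun x => hνᵢ.trans_le (hνl x)) hη_pos _
      const_nonneg := hC
      continuous_convection := continuous_solConvection hd
      convection_le := hconv
      convection_self := solConvection_self hd
      integrable_force := hf
      memLp := fun T hT => memLp_lift hd huc hD hT
      ae_eq := by
        filter_upwards [ae_coe_lift_eq hd huc hD] with t ht
        rw [toField_apply, ht]
        rfl
      bounded := huc.bounded
      continuousOn := fun t ht => huc.continuousOn _ (huc.solenoidal t ht)
      equation := IsWeakSolution.equation hd hν' hη' hf huc hD heq }
  have hbs := hd.upper_pos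
  have hlim := hsol.tendsto_norm_zero (K := 1 + bₛ / (2 * bᵢ * νᵢ)) (by positivity)
    (norm_sq_le_solDissipation hd hν' hη' hνᵢ hνl hη_pos)
    (fun v hv => field_eq_zero_of_dissipation_eq_zero hd hν' hη' (fun x => hνᵢ.trans_le (hνl x))
      hη_pos hv)
  have h1 : Tendsto (fun t => ENNReal.ofReal bᵢ⁻¹ ^ (1 / 2 : ℝ≥0∞).toReal * ENNReal.ofReal ‖u t‖)
      atTop (𝓝 0) := by
    have := ENNReal.Tendsto.const_mul (a := ENNReal.ofReal bᵢ⁻¹ ^ (1 / 2 : ℝ≥0∞).toReal)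
      (ENNReal.tendsto_ofReal hlim) (Or.inr (by simp))
    simpa using this
  refine tendsto_of_tendsto_of_tendsto_of_le_of_le tendsto_const_nhds h1 (fun _ => zero_le)
    fun t => ?_
  simp only
  rw [ofReal_norm, Lp.enorm_def]
  exact hd.eLpNorm_volume_le (by norm_num) (u t)
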